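/- **Setting.** Let $q\in\mathbb C^*$ be not a root of unity, let $2s\in\mathbb Z_{\ge 0}$, and let $\mathcal V$ be a complex vector space of dimension $2s+1$. Let $r_0\in\mathbb C^*$ and, for each label $x\in\{\cdot,*,\diamond\}$, let $\mathsf b^x,\mathsf c^x\in\mathbb C^*$ with $\mathsf b^x\mathsf c^x=r_0^{-2}$. Put $\theta^x_M=\mathsf b^xq^{2M}+\mathsf c^xq^{-2M}$ (also for $M=s$), $[X,Y]_q=qXY-q^{-1}YX$, $(a;Q)_n=\prod_{k=0}^{n-1}(1-aQ^k)$, $(a_1,\dots,a_m;Q)_n=\prod_j(a_j;Q)_n$, and $$\omega^{\{a,b,c\}}=-(q-q^{-1})^2\Big(\theta^a_s\theta^b_s-\tfrac1{r_0}(q^{2s+1}+q^{-2s-1})\theta^c_s\Big).$$ Let $(A^{\cdot},A^*)$ be a Leonard pair on $\mathcal V$ with eigenvalue sequences $(\theta^{\cdot}_M)_{M=0}^{2s}$, $(\theta^*_M)_{M=0}^{2s}$: there is a basis in which $A^{\cdot}$ is $\mathrm{diag}(\theta^{\cdot}_0,\dots,\theta^{\cdot}_{2s})$ and $A^*$ is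 irreducible tridiagonal, and a basis in which $A^*$ is $\mathrm{diag}(\theta^*_0,\dots,\theta^*_{2s})$ and $A^{\cdot}$ is irreducible tridiagonal. Assume that $$[A^{\cdot},[A^{\cdot},A^*]_q]_{q^{-1}}=-\tfrac{(q^2-q^{-2})^2}{r_0^2}A^*+\omega^{\{\cdot,*,\diamond\}}A^{\cdot}+\tfrac{q+q^{-1}}{r_0}\omega^{\{\cdot,\diamond,*\}}\mathbb I,$$ $$[A^*,[A^*,A^{\cdot}]_q]_{q^{-1}}=-\tfrac{(q^2-q^{-2})^2}{r_0^2}A^{\cdot}+\omega^{\{\cdot,*,\diamond\}}A^*+\tfrac{q+q^{-1}}{r_0}\omega^{\{*,\diamond,\cdot\}}\mathbb I,$$ and put $$A^\diamond=\frac{r_0}{q^2-q^{-2}}[A^*,A^{\cdot}]_q+\frac{r_0\,\omega^{\{\cdot,*,\diamond\}}}{(q-q^{-1})(q^2-q^{-2})}\mathbb I .$$ Assume, with $(a,b,c)=(\cdot,*,\diamond)$: (i) $\mathsf b^x/\mathsf c^x\ne q^{-2M}$ for $x\in\{\cdot,*,\diamond\}$ and $0\le M\le 4s$; (ii) $\mathsf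 c^b\ne-r_0q^{-2M+1}\mathsf c^a\mathsf c^c$, $\ \mathsf b^a\ne-r_0q^{-2M+1+4s}\mathsf b^b\mathsf b^c$, $\ \mathsf c^a\ne-r_0q^{2M+4s-1}\mathsf b^b\mathsf b^c$, $\ \mathsf c^b\ne-r_0q^{2M-1}\mathsf b^a\mathsf c^c$ for $1\le M\le 2s$. **Coefficients.** For labels $a,b,c$ put $$A^{(b,a)}_{M,M-1}=q^{2-4s}\frac{(1-q^{2M})(\mathsf c^a-\mathsf b^aq^{2M+4s})(\mathsf b^b\mathsf b^cr_0q^{4s-1}+\mathsf b^aq^{2M-2})(\mathsf c^a\mathsf c^cr_0q^{-1}+\mathsf c^bq^{2M-2})}{(\mathsf c^a-\mathsf b^aq^{4M-2})(\mathsf c^a-\mathsf b^aq^{4M})},$$ $$A^{(b,a)}_{M-1,M}=\frac{(1-q^{2M-4s-2})(\mathsf c^a-\mathsf b^aq^{2M-2})(\mathsf c^a+\mathsf b^b\mathsf b^cr_0q^{2M+4s-1})(\mathsf c^b+\mathsf b^a\mathsf c^cr_0q^{2M-1})}{(\mathsf c^a-\mathsf b^aq^{4M-4})(\mathsf c^a-\mathsf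 b^aq^{4M-2})},$$ for $1\le M\le 2s$, $A^{(b,a)}_{M,M}=\theta^b_0-A^{(b,a)}_{M,M+1}-A^{(b,a)}_{M,M-1}$ with $A^{(b,a)}_{0,-1}=A^{(b,a)}_{2s,2s+1}=0$, and all other entries $0$. Let $\sigma$ be the substitution $\mathsf b^a\leftrightarrow\mathsf b^b$, $\mathsf c^a\leftrightarrow\mathsf c^b$, $\mathsf b^cq^{4s}\leftrightarrow\mathsf c^c$, and let $A^{(a,b)}_{M,N}=\sigma(A^{(b,a)}_{M,N})$. Put $$R^{\{a,c\}}_M(\theta^b_N)={}_4\phi_3\!\left(\begin{matrix}q^{-2M},\ \frac{\mathsf b^a}{\mathsf c^a}q^{2M},\ q^{-2N},\ \frac{\mathsf b^b}{\mathsf c^b}q^{2N}\\ -\frac{\mathsf b^a\mathsf c^c}{\mathsf c^b}r_0q,\ -\frac{\mathsf b^b\mathsf b^c}{\mathsf c^a}r_0q^{4s+1},\ q^{-4s}\end{matrix};q^2,q^2\right)$$ (the $q$-Racah polynomial, a sum over $0\le j\le M$), $$k^{\{a,b,c\}}_N=\frac{(-\frac{\mathsf b^b\mathsf b^c}{\mathsf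 c^a}r_0q^{4s+1},-\frac{\mathsf b^a\mathsf c^c}{\mathsf c^b}r_0q,\frac{\mathsf b^b}{\mathsf c^b},q^{-4s};q^2)_N}{(q^2,-\frac{\mathsf b^b\mathsf b^c}{\mathsf b^a}r_0q,-\frac{\mathsf c^a\mathsf c^c}{\mathsf c^b}r_0q^{1-4s},\frac{\mathsf b^b}{\mathsf c^b}q^{4s+2};q^2)_N}\,\frac{1-\frac{\mathsf b^b}{\mathsf c^b}q^{4N}}{(\frac{\mathsf b^a}{\mathsf c^a})^N(1-\frac{\mathsf b^b}{\mathsf c^b})},\qquad k^{\{b,a,c\}}_M=\sigma(k^{\{a,b,c\}}_M),$$ $$\nu_0^{\{a,b,c\}}=\frac{(\frac{\mathsf b^a}{\mathsf c^a}q^2,\frac{\mathsf b^b}{\mathsf c^b}q^2;q^2)_{2s}}{(-\frac{\mathsf b^b\mathsf b^c}{\mathsf c^a}r_0q^{4s+1})^{2s}(-\frac{\mathsf b^a\mathsf c^c}{\mathsf b^b}r_0q^{1-4s},-\frac{\mathsf c^a\mathsf c^c}{\mathsf c^b}r_0q^{1-4s};q^2)_{2s}},$$ $$P^{\{a,b\}}_{MN}=k_N^{\{a,b,c\}}R_M^{\{a,c\}}(\theta_N^b),\qquad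 Q^{\{a,b\}}_{NM}=(\nu_0^{\{a,b,c\}})^{-1}k_M^{\{b,a,c\}}R_M^{\{a,c\}}(\theta_N^b)\qquad(0\le M,N\le 2s),$$ and, for scalars $f_0,g_0,h_0$, $$f_M=f_0\prod_{k=0}^{M-1}\frac{\mathsf c^aq^{-2k-2}+r_0q^{-1}\mathsf c^b\mathsf b^c}{\mathsf b^aq^{2k}+r_0q^{-1}\mathsf c^b\mathsf b^c},\quad g_M=g_0\prod_{k=0}^{M-1}q^{4k}\frac{\mathsf b^b}{\mathsf c^b}\frac{\mathsf c^bq^{-2k}+r_0q\mathsf c^a\mathsf b^c}{\mathsf b^bq^{2k}+r_0q^{-1}\mathsf c^a\mathsf b^c},\quad h_M=h_0\prod_{k=0}^{M-1}q^{4k}\frac{\mathsf b^c}{\mathsf c^c}\frac{\mathsf c^cq^{-2k}+r_0q\mathsf c^b\mathsf b^a}{\mathsf b^cq^{2k}+r_0q^{-1}\mathsf c^b\mathsf b^a}.$$ **Proposition.** $(A^{\cdot},A^*,A^\diamond)$ is a Leonard triple: for each of the three maps there is a basis in which it is diagonal and the other two are irreducible tridiagonal. Let $(a,b,c)\in\{(\cdot,*,\diamond),(*,\diamond,\cdot),(\diamond,\cdot,*)\}$;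 formulas for $(b,c,a)$ and $(c,a,b)$ are obtained by relabelling. Then $Q^{\{a,b\}}=(P^{\{a,b\}})^{-1}$. There exist bases $\{|\theta^a_M\rangle\}$, $\{|\theta^b_M\rangle\}$, $\{|\theta^c_M\rangle\}$ of $\mathcal V$ with $A^x|\theta^x_M\rangle=\theta^x_M|\theta^x_M\rangle$ for $x=a,b,c$ and $$A^b|\theta^a_N\rangle=\sum_MA^{(b,a)}_{M,N}|\theta^a_M\rangle,\qquad A^a|\theta^b_N\rangle=\sum_MA^{(a,b)}_{M,N}|\theta^b_M\rangle,\qquad A^b|\theta^c_N\rangle=\sum_MA^{(b,c)}_{M,N}|\theta^c_M\rangle .$$ For any such bases, after multiplying the whole basis $\{|\theta^b_M\rangle\}$ by a suitable nonzero scalar, there is $g_0\in\mathbb C^*$, and for every $f_0\in\mathbb C^*$ there is $h_0\in\mathbb C^*$, such that for all $0\le M,N\le 2s$ $$|\theta^b_N\rangle=\sum_{M=0}^{2s}P^{\{a,b\}}_{MN}|\theta^a_M\rangle,\qquad |\theta^a_M\rangle=\sum_{N=0}^{2s}\big((P^{\{a,b\}})^{-1}\big)_{NM}|\theta^b_N\rangle;$$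 $$|\theta^c_N\rangle=\sum_{M=0}^{2s}g_MP^{\{b,c\}}_{MN}|\theta^b_M\rangle,\qquad |\theta^b_M\rangle=\sum_{N=0}^{2s}g_M^{-1}\big((P^{\{b,c\}})^{-1}\big)_{NM}|\theta^c_N\rangle;$$ $$|\theta^a_N\rangle=\sum_{M=0}^{2s}f_N^{-1}h_MP^{\{c,a\}}_{MN}|\theta^c_M\rangle,\qquad |\theta^c_M\rangle=\sum_{N=0}^{2s}f_Nh_M^{-1}\big((P^{\{c,a\}})^{-1}\big)_{NM}|\theta^a_N\rangle .$$ -/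

import Mathlib

open scoped BigOperators

noncomputable section

namespace QRacah

/-- The `q`-shifted factorial `(a;Q)_n`. -/
def qPoch (a Q : ℂ) (n : ℕ) : ℂ := ∏ k ∈ Finset.range n, (1 - a * Q ^ k)

/-- The terminating basic hypergeometric series `₄φ₃` with upper parameters `a₁ a₂ a₃ a₄`
(where `a₁ = Q^{-n}`, so that the series stops at `j = n`), lower parameters `b₁ b₂ b₃`,
base `Q` and argument `z`. -/
def phi43 (n : ℕ) (a₁ a₂ a₃ a₄ b₁ b₂ b₃ Q z : ℂ) : ℂ :=
  ∑ j ∈ Finset.range (n + 1),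
    (qPoch a₁ Q j * qPoch a₂ Q j * qPoch a₃ Q j * qPoch a₄ Q j) /
      (qPoch b₁ Q j * qPoch b₂ Q j * qPoch b₃ Q j * qPoch Q Q j) * z ^ j

/-- For `d = 2s`, the scalars `q, r₀` and the scalars `𝖻^a, 𝖼^a, 𝖻^b, 𝖼^b, 𝖻^c, 𝖼^c` attached to an
ordered triple `(a, b, c)` of labels. -/
structure Params (d : ℕ) where
  q : ℂ
  r₀ : ℂ
  ba : ℂ
  ca : ℂ
  bb : ℂ
  cb : ℂ
  bc : ℂ
  cc : ℂ

/-- `𝖻 q^{2M} + 𝖼 q^{-2M}`. -/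
def theta (q b c : ℂ) (M : ℕ) : ℂ := b * q ^ (2 * (M : ℤ)) + c * q ^ (-2 * (M : ℤ))

/-- `θ_s = 𝖻 q^{2s} + 𝖼 q^{-2s}`, where `d = 2s`. -/
def thetaMid (d : ℕ) (q b c : ℂ) : ℂ := b * q ^ (d : ℤ) + c * q ^ (-(d : ℤ))

namespace Params

variable {d : ℕ} (p : Params d)

/-- The substitution `𝖻^a ↔ 𝖻^b`, `𝖼^a ↔ 𝖼^b`, `𝖻^c q^{4s} ↔ 𝖼^c`. -/
def swap : Params d where
  q := p.q
  r₀ := p.r₀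
  ba := p.bb
  ca := p.cb
  bb := p.ba
  cb := p.ca
  bc := p.cc * p.q ^ (-2 * (d : ℤ))
  cc := p.bc * p.q ^ (2 * (d : ℤ))

/-- The scalar `ω^{a,b,c}`. -/
def omega : ℂ :=
  -(p.q - p.q⁻¹) ^ 2 *
    (thetaMid d p.q p.ba p.ca * thetaMid d p.q p.bb p.cb -
      1 / p.r₀ * (p.q ^ ((d : ℤ) + 1) + p.q ^ (-(d : ℤ) - 1)) * thetaMid d p.q p.bc p.cc)

/-- The subdiagonal coefficient `A^{(b,a)}_{M,M-1}`; it vanishes for `M = 0`. -/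
def lower (M : ℕ) : ℂ :=
  p.q ^ (2 - 2 * (d : ℤ)) *
    ((1 - p.q ^ (2 * (M : ℤ))) *
      (p.ca - p.ba * p.q ^ (2 * (M : ℤ) + 2 * (d : ℤ))) *
      (p.bb * p.bc * p.r₀ * p.q ^ (2 * (d : ℤ) - 1) + p.ba * p.q ^ (2 * (M : ℤ) - 2)) *
      (p.ca * p.cc * p.r₀ * p.q⁻¹ + p.cb * p.q ^ (2 * (M : ℤ) - 2))) /
    ((p.ca - p.ba * p.q ^ (4 * (M : ℤ) - 2)) * (p.ca - p.ba * p.q ^ (4 * (M : ℤ))))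

/-- The superdiagonal coefficient `A^{(b,a)}_{M-1,M}`; it vanishes for `M = d + 1`. -/
def upper (M : ℕ) : ℂ :=
  ((1 - p.q ^ (2 * (M : ℤ) - 2 * (d : ℤ) - 2)) *
      (p.ca - p.ba * p.q ^ (2 * (M : ℤ) - 2)) *
      (p.ca + p.bb * p.bc * p.r₀ * p.q ^ (2 * (M : ℤ) + 2 * (d : ℤ) - 1)) *
      (p.cb + p.ba * p.cc * p.r₀ * p.q ^ (2 * (M : ℤ) - 1))) /
    ((p.ca - p.ba * p.q ^ (4 * (M : ℤ) - 4)) * (p.ca - p.ba * p.q ^ (4 * (M : ℤ) - 2)))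

/-- The tridiagonal matrix with entries `A^{(b,a)}_{M,N}`, for `0 ≤ M, N ≤ d`. The matrix with
entries `A^{(a,b)}_{M,N}` is `p.swap.tri`. -/
def tri : Matrix (Fin (d + 1)) (Fin (d + 1)) ℂ := fun M N =>
  if (M : ℕ) = N + 1 then p.lower M
  else if (N : ℕ) = M + 1 then p.upper N
  else if M = N then theta p.q p.bb p.cb 0 - p.upper (M + 1) - p.lower M
  else 0

/-- The value `R^{a,c}_M(θ^b_N)` of the `q`-Racah polynomial. -/
def racah (M N : ℕ) : ℂ :=
  phi43 M (p.q ^ (-2 * (M : ℤ))) (p.ba / p.ca * p.q ^ (2 * (M : ℤ)))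
    (p.q ^ (-2 * (N : ℤ))) (p.bb / p.cb * p.q ^ (2 * (N : ℤ)))
    (-(p.ba * p.cc / p.cb) * p.r₀ * p.q)
    (-(p.bb * p.bc / p.ca) * p.r₀ * p.q ^ (2 * (d : ℤ) + 1))
    (p.q ^ (-2 * (d : ℤ))) (p.q ^ 2) (p.q ^ 2)

/-- The weight `k^{a,b,c}_N`. -/
def weight (N : ℕ) : ℂ :=
  (qPoch (-(p.bb * p.bc / p.ca) * p.r₀ * p.q ^ (2 * (d : ℤ) + 1)) (p.q ^ 2) N *
      qPoch (-(p.ba * p.cc / p.cb) * p.r₀ * p.q) (p.q ^ 2) N *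
      qPoch (p.bb / p.cb) (p.q ^ 2) N *
      qPoch (p.q ^ (-2 * (d : ℤ))) (p.q ^ 2) N) /
    (qPoch (p.q ^ 2) (p.q ^ 2) N *
      qPoch (-(p.bb * p.bc / p.ba) * p.r₀ * p.q) (p.q ^ 2) N *
      qPoch (-(p.ca * p.cc / p.cb) * p.r₀ * p.q ^ (1 - 2 * (d : ℤ))) (p.q ^ 2) N *
      qPoch (p.bb / p.cb * p.q ^ (2 * (d : ℤ) + 2)) (p.q ^ 2) N) *
    ((1 - p.bb / p.cb * p.q ^ (4 * (N : ℤ))) / ((p.ba / p.ca) ^ N * (1 - p.bb / p.cb)))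

/-- The normalization `ν^{a,b,c}_0`. -/
def nu : ℂ :=
  (qPoch (p.ba / p.ca * p.q ^ 2) (p.q ^ 2) d * qPoch (p.bb / p.cb * p.q ^ 2) (p.q ^ 2) d) /
    ((-(p.bb * p.bc / p.ca) * p.r₀ * p.q ^ (2 * (d : ℤ) + 1)) ^ d *
      qPoch (-(p.ba * p.cc / p.bb) * p.r₀ * p.q ^ (1 - 2 * (d : ℤ))) (p.q ^ 2) d *
      qPoch (-(p.ca * p.cc / p.cb) * p.r₀ * p.q ^ (1 - 2 * (d : ℤ))) (p.q ^ 2) d)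

/-- The matrix `P^{a,b}`, with entries `k^{a,b,c}_N R^{a,c}_M(θ^b_N)` (row `M`, column `N`). -/
def trans : Matrix (Fin (d + 1)) (Fin (d + 1)) ℂ := fun M N =>
  p.weight N * p.racah M N

/-- The matrix written `(P^{a,b})⁻¹`, with entries `(ν^{a,b,c}_0)⁻¹ k^{b,a,c}_M R^{a,c}_M(θ^b_N)`
(row `N`, column `M`), where `k^{b,a,c}_M` is `p.swap.weight M`. -/
def transInv : Matrix (Fin (d + 1)) (Fin (d + 1)) ℂ := fun N M =>
  p.nu⁻¹ * p.swap.weight M * p.racah M N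

/-- The factor `f_M` with initial value `f₀`. -/
def fFactor (f₀ : ℂ) (M : ℕ) : ℂ :=
  f₀ * ∏ k ∈ Finset.range M,
    (p.ca * p.q ^ (-2 * (k : ℤ) - 2) + p.r₀ * p.q⁻¹ * p.cb * p.bc) /
      (p.ba * p.q ^ (2 * (k : ℤ)) + p.r₀ * p.q⁻¹ * p.cb * p.bc)

/-- The factor `g_M` with initial value `g₀`. -/
def gFactor (g₀ : ℂ) (M : ℕ) : ℂ :=
  g₀ * ∏ k ∈ Finset.range M,
    p.q ^ (4 * (k : ℤ)) * (p.bb / p.cb) *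
      ((p.cb * p.q ^ (-2 * (k : ℤ)) + p.r₀ * p.q * p.ca * p.bc) /
        (p.bb * p.q ^ (2 * (k : ℤ)) + p.r₀ * p.q⁻¹ * p.ca * p.bc))

/-- The factor `h_M` with initial value `h₀`. -/
def hFactor (h₀ : ℂ) (M : ℕ) : ℂ :=
  h₀ * ∏ k ∈ Finset.range M,
    p.q ^ (4 * (k : ℤ)) * (p.bc / p.cc) *
      ((p.cc * p.q ^ (-2 * (k : ℤ)) + p.r₀ * p.q * p.cb * p.ba) /
        (p.bc * p.q ^ (2 * (k : ℤ)) + p.r₀ * p.q⁻¹ * p.cb * p.ba))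

end Params

/-- The parameters attached to the ordered triple of labels `(i, j, k)`. The labels
`0, 1, 2` stand for `., *, ⋄`. -/
def params (d : ℕ) (q r₀ : ℂ) (b c : Fin 3 → ℂ) (i j k : Fin 3) : Params d where
  q := q
  r₀ := r₀
  ba := b i
  ca := c i
  bb := b j
  cb := c j
  bc := b k
  cc := c k

/-- A square matrix is irreducible tridiagonal: all entries off the three central diagonals
vanish, and all entries on the sub- and superdiagonal are nonzero. -/
def IsIrredTridiagonal {n : ℕ} (X : Matrix (Fin n) (Fin n) ℂ) : Prop :=
  (∀ i j : Fin n, ((i : ℕ) + 1 < j ∨ (j : ℕ) + 1 < i) → X i j = 0) ∧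
    ∀ i j : Fin n, ((i : ℕ) + 1 = j ∨ (j : ℕ) + 1 = i) → X i j ≠ 0

section Maps

variable {V : Type*} [AddCommGroup V] [Module ℂ V]

/-- `(A, B)` is a Leonard pair on the `(d+1)`-dimensional space `V`, with eigenvalue sequence
`θ 0, …, θ d` for `A` and `θ' 0, …, θ' d` for `B` (in these orders the other map is irreducible
tridiagonal). -/
def IsLeonardPair (d : ℕ) (A B : Module.End ℂ V) (θ θ' : ℕ → ℂ) : Prop :=
  (∃ v : Module.Basis (Fin (d + 1)) ℂ V,
    LinearMap.toMatrix v v A = Matrix.diagonal (fun M : Fin (d + 1) => θ M) ∧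
      IsIrredTridiagonal (LinearMap.toMatrix v v B)) ∧
  (∃ w : Module.Basis (Fin (d + 1)) ℂ V,
    LinearMap.toMatrix w w B = Matrix.diagonal (fun M : Fin (d + 1) => θ' M) ∧
      IsIrredTridiagonal (LinearMap.toMatrix w w A))

/-- `(A 0, A 1, A 2)` is a Leonard triple on the `(d+1)`-dimensional space `V`: for each of the
three maps there is a basis in which it is diagonal and the other two are irreducible
tridiagonal. -/
def IsLeonardTriple (d : ℕ) (A : Fin 3 → Module.End ℂ V) : Prop :=
  ∀ i : Fin 3, ∃ v : Module.Basis (Fin (d + 1)) ℂ V,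
    (LinearMap.toMatrix v v (A i)).IsDiag ∧
      ∀ j : Fin 3, j ≠ i → IsIrredTridiagonal (LinearMap.toMatrix v v (A j))

/-- The `q`-commutator `[X, Y]_q = q X Y - q⁻¹ Y X`. -/
def qComm (q : ℂ) (X Y : Module.End ℂ V) : Module.End ℂ V := q • (X * Y) - q⁻¹ • (Y * X)

/-- The construction of the triple `(A 0, A 1, A 2) = (A, A*, A⋄)` of `q`-Racah type from a
Leonard pair `(A, A*)` of `q`-Racah type. -/
structure IsQRacahTriple (d : ℕ) (q r₀ : ℂ) (b c : Fin 3 → ℂ)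
    (A : Fin 3 → Module.End ℂ V) : Prop where
  q_ne_zero : q ≠ 0
  q_not_root : ∀ n : ℕ, 0 < n → q ^ n ≠ 1
  r_ne_zero : r₀ ≠ 0
  b_ne_zero : ∀ x, b x ≠ 0
  c_ne_zero : ∀ x, c x ≠ 0
  b_mul_c : ∀ x, b x * c x = r₀ ^ (-2 : ℤ)
  /-- `(A, A*)` is a Leonard pair of `q`-Racah type. -/
  pair : IsLeonardPair d (A 0) (A 1) (theta q (b 0) (c 0)) (theta q (b 1) (c 1))
  /-- The Askey-Wilson relations of the pair. -/
  aw₁ : qComm q⁻¹ (A 0) (qComm q (A 0) (A 1)) =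
    (-(q ^ 2 - q ^ (-2 : ℤ)) ^ 2 / r₀ ^ 2) • A 1 + (params d q r₀ b c 0 1 2).omega • A 0 +
      ((q + q⁻¹) / r₀ * (params d q r₀ b c 0 2 1).omega) • (1 : Module.End ℂ V)
  aw₂ : qComm q⁻¹ (A 1) (qComm q (A 1) (A 0)) =
    (-(q ^ 2 - q ^ (-2 : ℤ)) ^ 2 / r₀ ^ 2) • A 0 + (params d q r₀ b c 0 1 2).omega • A 1 +
      ((q + q⁻¹) / r₀ * (params d q r₀ b c 1 2 0).omega) • (1 : Module.End ℂ V)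
  /-- The definition of the third map. -/
  third : A 2 = (r₀ / (q ^ 2 - q ^ (-2 : ℤ))) • qComm q (A 1) (A 0) +
    (r₀ * (params d q r₀ b c 0 1 2).omega / ((q - q⁻¹) * (q ^ 2 - q ^ (-2 : ℤ)))) •
      (1 : Module.End ℂ V)
  /-- Absence of multiplicities in the spectra. The values `M = 0` and `M = 2d` are included so
  that no denominator in the coefficients vanishes. -/
  cond_i : ∀ x, ∀ M : ℕ, M ≤ 2 * d → b x / c x ≠ q ^ (-2 * (M : ℤ))
  cond_ii₁ : ∀ M : ℕ, 1 ≤ M → M ≤ d → c 1 ≠ -r₀ * q ^ (-2 * (M : ℤ) + 1) * c 0 * c 2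
  cond_ii₂ : ∀ M : ℕ, 1 ≤ M → M ≤ d →
    b 0 ≠ -r₀ * q ^ (-2 * (M : ℤ) + 1 + 2 * (d : ℤ)) * b 1 * b 2
  cond_ii₃ : ∀ M : ℕ, 1 ≤ M → M ≤ d →
    c 0 ≠ -r₀ * q ^ (2 * (M : ℤ) + 2 * (d : ℤ) - 1) * b 1 * b 2
  cond_ii₄ : ∀ M : ℕ, 1 ≤ M → M ≤ d → c 1 ≠ -r₀ * q ^ (2 * (M : ℤ) - 1) * b 0 * c 2

/-- `va, vb, vc` are eigenbases of `Aa, Ab, Ac`, for the eigenvalues `θ^a_M, θ^b_M, θ^c_M`, in which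
* `Ab` acts on `va` with the coefficients `A^{(b,a)}_{M,N}`,
* `Aa` acts on `vb` with the coefficients `A^{(a,b)}_{M,N}`,
* `Ab` acts on `vc` with the coefficients `A^{(b,c)}_{M,N}`.

These conditions determine each basis up to an overall nonzero scalar. The labels `(a, b, c)`
are `(i, j, k)`. -/
structure AreEigenbases (d : ℕ) (q r₀ : ℂ) (b c : Fin 3 → ℂ) (A : Fin 3 → Module.End ℂ V)
    (i j k : Fin 3) (va vb vc : Module.Basis (Fin (d + 1)) ℂ V) : Prop where
  diag_a : LinearMap.toMatrix va va (A i) =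
    Matrix.diagonal (fun M : Fin (d + 1) => theta q (b i) (c i) M)
  diag_b : LinearMap.toMatrix vb vb (A j) =
    Matrix.diagonal (fun M : Fin (d + 1) => theta q (b j) (c j) M)
  diag_c : LinearMap.toMatrix vc vc (A k) =
    Matrix.diagonal (fun M : Fin (d + 1) => theta q (b k) (c k) M)
  tri_a : LinearMap.toMatrix va va (A j) = (params d q r₀ b c i j k).tri
  tri_b : LinearMap.toMatrix vb vb (A i) = (params d q r₀ b c i j k).swap.tri
  tri_c : LinearMap.toMatrix vc vc (A j) = (params d q r₀ b c j k i).swap.tri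

end Maps

end QRacah

end

noncomputable section

namespace QRacah

/-! Because `𝖻^x 𝖼^x = r₀⁻²`, each label carries a single scalar; with `u = r₀ 𝖻^a`, `v = r₀ 𝖻^b`,
`w = r₀ 𝖻^c` the situation becomes cyclic in `(u, v, w)`. Let `T` be the matrix of coefficients
`A^{(b,a)}`, `S` that of `A^{(a,b)}`, `R` the matrix of `q`-Racah values, `K` the diagonal of
weights, and `Θ_a`, `Θ_b` the eigenvalue matrices.

Transition matrix. `T` acts bidiagonally on the `q`-factorials in which the `₄φ₃` is expanded, and
the expansion coefficients make the result telescope to `T R = R Θ_b` (`tri_mul_racahMat`). The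
substitution `swap` transposes `R`, so also `Θ_a R = R Sᵀ`. Since `K S = Sᵀ K`, the matrix `P = R K`
satisfies `T P = P Θ_b` and `Θ_a P = P S`: it carries an eigenbasis of the first map to one of the
second, with the prescribed coefficients. The product of the claimed inverse with `P` commutes with
`Θ_b` and with the irreducible `S`, hence is scalar (`exists_gram`); one matrix entry fixes the
scalar (`gram_constant`, `nu_mul_prod_lowF`).

Third map. In an eigenbasis of the second map, the `q`-commutator multiplies the off-diagonal
entries of the first map by monomials. Rescaling by `g_M` then gives exactly the coefficient matrix
for `(v, w, u)` (`thirdMat_mul_gMat`). The Askey-Wilson relations say that each map is obtained from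
the other two by the same formula (`isThird_rot`, `isThird_rot_rot`), so this step can be repeated
cyclically. Eigenbases with prescribed coefficients are unique up to a scalar (`basis_unique`);
after one full turn the initial basis returns up to a scalar, and recording the scalars gives `f`,
`g`, `h` (`transition_relations`).

Starting point. An eigenbasis with the coefficients `T` must be extracted from the abstract Leonard
pair (`exists_std`). After normalizing it by the first eigenvector of the second map, row sums, row
sums weighted by eigenvalues, and the diagonal of an Askey-Wilson relation determine the tridiagonal
matrix (`tridiagonal_eq_zero`). -/

/-- The subdiagonal coefficient in the normalized parameters, as a function of `x = q^{2M}`. -/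
def lowF (q r Q u v w x : ℂ) : ℂ :=
  (1 - x) * (1 - u ^ 2 * x * Q) * (v * w * Q * q + u * x) * (v * q + u * w * x) /
    (r * v * w * Q * (q ^ 2 - u ^ 2 * x ^ 2) * (1 - u ^ 2 * x ^ 2))

/-- The superdiagonal coefficient in the normalized parameters, as a function of `x = q^{2M}`,
where `M` is the row. -/
def upF (q r Q u v w x : ℂ) : ℂ :=
  (Q - x) * (1 - u ^ 2 * x) * (1 + u * v * w * x * Q * q) * (w + u * v * x * q) /
    (r * v * w * Q * (1 - u ^ 2 * x ^ 2) * (1 - u ^ 2 * x ^ 2 * q ^ 2))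

/-- The parameters with `𝖻^a = u / r`, `𝖼^a = u⁻¹ / r`, `𝖻^b = v / r`, and so on. -/
def ofBeta (d : ℕ) (q r u v w : ℂ) : Params d :=
  ⟨q, r, u / r, u⁻¹ / r, v / r, v⁻¹ / r, w / r, w⁻¹ / r⟩

/-! ### Nondegeneracy conditions and their symmetries -/

/-- The nondegeneracy conditions on normalized parameters. They are invariant under cyclic shifts
of `(u, v, w)` and under the substitution `swap`. -/
structure Nondeg (d : ℕ) (q r u v w : ℂ) : Prop where
  q_ne : q ≠ 0
  q_pow : ∀ n : ℕ, 0 < n → q ^ n ≠ 1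
  r_ne : r ≠ 0
  u_ne : u ≠ 0
  v_ne : v ≠ 0
  w_ne : w ≠ 0
  u_sq : ∀ M ≤ 2 * d, u ^ 2 * q ^ (2 * M) ≠ 1
  v_sq : ∀ M ≤ 2 * d, v ^ 2 * q ^ (2 * M) ≠ 1
  w_sq : ∀ M ≤ 2 * d, w ^ 2 * q ^ (2 * M) ≠ 1
  uvw : ∀ k < d, u * v * w * q ^ (2 * d) * q ^ (2 * k + 1) + 1 ≠ 0
  uv : ∀ k < d, u * v * q ^ (2 * k + 1) + w ≠ 0
  vw : ∀ k < d, v * w * q ^ (2 * k + 1) + u ≠ 0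
  wu : ∀ k < d, w * u * q ^ (2 * k + 1) + v ≠ 0

lemma pow_even_split {d k : ℕ} (q : ℂ) (hk : k < d) :
    q ^ (2 * d) = q ^ (2 * (d - 1 - k) + 1) * q ^ (2 * k + 1) := by
  rw [← pow_add]; congr 1; omega

namespace Nondeg

variable {d : ℕ} {q r u v w : ℂ}

lemma rot (h : Nondeg d q r u v w) : Nondeg d q r v w u where
  q_ne := h.q_ne
  q_pow := h.q_pow
  r_ne := h.r_ne
  u_ne := h.v_ne
  v_ne := h.w_ne
  w_ne := h.u_ne
  u_sq := h.v_sq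
  v_sq := h.w_sq
  w_sq := h.u_sq
  uvw k hk := by convert h.uvw k hk using 2; ring
  uv := h.vw
  vw := h.wu
  wu := h.uv

/-- Passing to `w⁻¹ q^{-2d}` interchanges the families `uvw` and `uv`, and reverses the index in the
others: `k ↦ d - 1 - k` in `vw` and `wu`, `M ↦ 2d - M` in `w_sq`. -/
lemma swap (h : Nondeg d q r u v w) : Nondeg d q r v u (w⁻¹ * (q ^ (2 * d))⁻¹) where
  q_ne := h.q_ne
  q_pow := h.q_pow
  r_ne := h.r_ne
  u_ne := h.v_ne
  v_ne := h.u_ne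
  w_ne := mul_ne_zero (inv_ne_zero h.w_ne) (inv_ne_zero (pow_ne_zero _ h.q_ne))
  u_sq := h.v_sq
  v_sq := h.u_sq
  w_sq M hM := by
    have hq := h.q_ne
    have hw := h.w_ne
    intro he
    refine h.w_sq (2 * d - M) (by omega) ?_
    have e : q ^ (2 * d) * q ^ (2 * d) = q ^ (2 * (2 * d - M)) * q ^ (2 * M) := by
      rw [← pow_add, ← pow_add]; congr 1; omega
    have h1 : q ^ (2 * M) = w ^ 2 * (q ^ (2 * d) * q ^ (2 * d)) := by
      field_simp at he; rw [he]; ring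
    have h2 : q ^ (2 * M) ≠ 0 := pow_ne_zero _ hq
    rw [e] at h1
    apply mul_right_cancel₀ h2
    linear_combination -h1
  uvw k hk := by
    have hq := h.q_ne
    have hw := h.w_ne
    have := h.uv k hk
    intro he
    apply this
    field_simp at he
    linear_combination he
  uv k hk := by
    have hq := h.q_ne
    have hw := h.w_ne
    have := h.uvw k hk
    intro he
    apply this
    field_simp at he
    linear_combination he
  vw k hk := by
    have hq := h.q_ne
    have hw := h.w_ne
    have := h.vw (d - 1 - k) (by omega)
    intro he
    apply this
    have e := pow_even_split q hk
    have h2 : q ^ (2 * k + 1) ≠ 0 := pow_ne_zero _ hq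
    field_simp at he
    rw [e] at he
    apply mul_right_cancel₀ h2
    linear_combination he
  wu k hk := by
    have hq := h.q_ne
    have hw := h.w_ne
    have := h.wu (d - 1 - k) (by omega)
    intro he
    apply this
    have e := pow_even_split q hk
    have h2 : q ^ (2 * k + 1) ≠ 0 := pow_ne_zero _ hq
    field_simp at he
    rw [e] at he
    apply mul_right_cancel₀ h2
    linear_combination he

lemma x_ne (h : Nondeg d q r u v w) (M : ℕ) : q ^ (2 * M) ≠ 0 := pow_ne_zero _ h.q_ne

/-- The denominators in row `M` involve `u² q^{2m}` with `m = 2M`, `2M + 1`, `2M - 1`, while `u_sq`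
covers only `0 ≤ m ≤ 2d`. So the second is controlled only for `M < d` and the third only for `M >
0`; this is why the end rows need separate treatment throughout. -/
lemma one_sub_ne (h : Nondeg d q r u v w) {M : ℕ} (hM : M ≤ d) :
    1 - u ^ 2 * (q ^ (2 * M)) ^ 2 ≠ 0 := by
  have := h.u_sq (2 * M) (by omega)
  rw [sub_ne_zero, ← pow_mul]
  convert this.symm using 3; ring

lemma one_sub_succ_ne (h : Nondeg d q r u v w) {M : ℕ} (hM : M < d) :
    1 - u ^ 2 * (q ^ (2 * M)) ^ 2 * q ^ 2 ≠ 0 := by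
  have := h.u_sq (2 * M + 1) (by omega)
  rw [sub_ne_zero, ← pow_mul]
  convert this.symm using 1; ring

lemma sq_sub_ne (h : Nondeg d q r u v w) {M : ℕ} (hM : M ≤ d) (h0 : 0 < M) :
    q ^ 2 - u ^ 2 * (q ^ (2 * M)) ^ 2 ≠ 0 := by
  have := h.u_sq (2 * M - 1) (by omega)
  intro he
  apply this
  have hq : q ^ 2 ≠ 0 := pow_ne_zero _ h.q_ne
  have e : (q ^ (2 * M)) ^ 2 = q ^ (2 * (2 * M - 1)) * q ^ 2 := by
    rw [← pow_mul, ← pow_add]; congr 1; omega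
  rw [e] at he
  apply mul_right_cancel₀ hq
  linear_combination -he

lemma pow_sub_ne (h : Nondeg d q r u v w) {M N : ℕ} (hMN : M ≠ N) :
    q ^ (2 * M) ≠ q ^ (2 * N) := by
  intro he
  rcases lt_or_gt_of_ne hMN with hl | hl
  · refine h.q_pow (2 * N - 2 * M) (by omega) ?_
    apply mul_left_cancel₀ (h.x_ne M)
    rw [← pow_add, mul_one, he]; congr 1; omega
  · refine h.q_pow (2 * M - 2 * N) (by omega) ?_
    apply mul_left_cancel₀ (h.x_ne N)
    rw [← pow_add, mul_one, ← he]; congr 1; omega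

lemma one_sub_pow_ne (h : Nondeg d q r u v w) {M : ℕ} (hM : 0 < M) : 1 - q ^ (2 * M) ≠ 0 :=
  sub_ne_zero.2 fun he => h.q_pow (2 * M) (by omega) he.symm

end Nondeg

/-! ### The coefficients in normalized parameters -/

section formulas

variable {d : ℕ} {q r u v w : ℂ}

lemma zpow_two_mul_natCast (q : ℂ) (M : ℕ) : q ^ (2 * (M : ℤ)) = q ^ (2 * M) := by
  exact_mod_cast zpow_natCast q (2 * M)

lemma swap_ofBeta (h : Nondeg d q r u v w) :
    (ofBeta d q r u v w).swap = ofBeta d q r v u (w⁻¹ * (q ^ (2 * d))⁻¹) := by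
  have hQ := h.x_ne d
  have hw := h.w_ne
  have hr := h.r_ne
  simp only [Params.swap, ofBeta, Params.mk.injEq, true_and]
  rw [show (-2 * (d : ℤ)) = -(2 * (d : ℤ)) by ring, zpow_neg, zpow_two_mul_natCast]
  constructor <;> field_simp

lemma theta_ofBeta (M : ℕ) :
    theta q (u / r) (u⁻¹ / r) M = (u * q ^ (2 * M) + u⁻¹ * (q ^ (2 * M))⁻¹) / r := by
  unfold theta
  rw [show (-2 * (M : ℤ)) = -(2 * (M : ℤ)) by ring, zpow_neg, zpow_two_mul_natCast]
  ring

lemma thetaMid_ofBeta : thetaMid d q (u / r) (u⁻¹ / r) = (u * q ^ d + u⁻¹ * (q ^ d)⁻¹) / r := by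
  unfold thetaMid
  rw [zpow_neg, zpow_natCast]
  ring

lemma lower_zero (p : Params d) : p.lower 0 = 0 := by simp [Params.lower]

lemma upper_succ_last (p : Params d) : p.upper (d + 1) = 0 := by
  have : (2 * ((d + 1 : ℕ) : ℤ) - 2 * (d : ℤ) - 2) = 0 := by push_cast; ring
  simp only [Params.upper, this]
  simp

/-- The numerator vanishes, so the value is `0` even when the uncontrolled denominator `q² - u²`
vanishes too. The same holds for `upF_self`. -/
lemma lowF_one (Q : ℂ) : lowF q r Q u v w 1 = 0 := by simp [lowF]

lemma upF_self (Q : ℂ) : upF q r Q u v w Q = 0 := by simp [upF]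

lemma lower_ofBeta (h : Nondeg d q r u v w) {M : ℕ} (hM : M ≤ d) :
    (ofBeta d q r u v w).lower M = lowF q r (q ^ (2 * d)) u v w (q ^ (2 * M)) := by
  rcases Nat.eq_zero_or_pos M with rfl | h0
  · rw [lower_zero, mul_zero, pow_zero, lowF_one]
  have hq := h.q_ne
  have e1 : q ^ (2 - 2 * (d : ℤ)) = q ^ 2 / q ^ (2 * d) := by
    rw [zpow_sub₀ hq, zpow_two_mul_natCast]; rfl
  have e2 : q ^ (2 * (M : ℤ) + 2 * (d : ℤ)) = q ^ (2 * M) * q ^ (2 * d) := by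
    rw [zpow_add₀ hq, zpow_two_mul_natCast, zpow_two_mul_natCast]
  have e3 : q ^ (2 * (d : ℤ) - 1) = q ^ (2 * d) / q := by
    rw [zpow_sub₀ hq, zpow_two_mul_natCast, zpow_one]
  have e4 : q ^ (2 * (M : ℤ) - 2) = q ^ (2 * M) / q ^ 2 := by
    rw [zpow_sub₀ hq, zpow_two_mul_natCast]; rfl
  have e6 : q ^ (4 * (M : ℤ)) = (q ^ (2 * M)) ^ 2 := by
    rw [← zpow_two_mul_natCast, ← zpow_natCast, ← zpow_mul]; congr 1; push_cast; ring
  have e5 : q ^ (4 * (M : ℤ) - 2) = (q ^ (2 * M)) ^ 2 / q ^ 2 := by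
    rw [zpow_sub₀ hq, e6]; rfl
  have hu := h.u_ne
  have hv := h.v_ne
  have hw := h.w_ne
  have hr := h.r_ne
  have hx := h.x_ne M
  have hQ := h.x_ne d
  have d1 := h.sq_sub_ne hM h0
  have d2 := h.one_sub_ne hM
  simp only [Params.lower, ofBeta, e1, e2, e3, e4, e5, e6, zpow_two_mul_natCast]
  unfold lowF
  generalize q ^ (2 * M) = x at *
  generalize q ^ (2 * d) = Q at *
  have d1' : u⁻¹ / r - u / r * (x ^ 2 / q ^ 2) = (q ^ 2 - u ^ 2 * x ^ 2) / (u * r * q ^ 2) := by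
    field_simp
  have d2' : u⁻¹ / r - u / r * x ^ 2 = (1 - u ^ 2 * x ^ 2) / (u * r) := by
    field_simp
  rw [d1', d2']
  field_simp

lemma upper_ofBeta (h : Nondeg d q r u v w) {M : ℕ} (hM : M ≤ d) :
    (ofBeta d q r u v w).upper (M + 1) = upF q r (q ^ (2 * d)) u v w (q ^ (2 * M)) := by
  rcases hM.eq_or_lt with rfl | hM'
  · rw [upper_succ_last, upF_self]
  have hq := h.q_ne
  have e1 : q ^ (2 * ((M + 1 : ℕ) : ℤ) - 2 * (d : ℤ) - 2) = q ^ (2 * M) / q ^ (2 * d) := by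
    rw [show 2 * ((M + 1 : ℕ) : ℤ) - 2 * (d : ℤ) - 2 = 2 * (M : ℤ) - 2 * (d : ℤ) by
      push_cast; ring, zpow_sub₀ hq, zpow_two_mul_natCast, zpow_two_mul_natCast]
  have e2 : q ^ (2 * ((M + 1 : ℕ) : ℤ) - 2) = q ^ (2 * M) := by
    rw [← zpow_two_mul_natCast]; congr 1; push_cast; ring
  have e3 : q ^ (2 * ((M + 1 : ℕ) : ℤ) + 2 * (d : ℤ) - 1) = q ^ (2 * M) * q ^ (2 * d) * q := by
    rw [show 2 * ((M + 1 : ℕ) : ℤ) + 2 * (d : ℤ) - 1 = 2 * (M : ℤ) + 2 * (d : ℤ) + 1 by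
      push_cast; ring, zpow_add₀ hq, zpow_add₀ hq, zpow_two_mul_natCast, zpow_two_mul_natCast,
      zpow_one]
  have e4 : q ^ (2 * ((M + 1 : ℕ) : ℤ) - 1) = q ^ (2 * M) * q := by
    rw [show 2 * ((M + 1 : ℕ) : ℤ) - 1 = 2 * (M : ℤ) + 1 by push_cast; ring, zpow_add₀ hq,
      zpow_two_mul_natCast, zpow_one]
  have e5 : q ^ (4 * ((M + 1 : ℕ) : ℤ) - 4) = (q ^ (2 * M)) ^ 2 := by
    rw [← zpow_two_mul_natCast, ← zpow_natCast, ← zpow_mul]; congr 1; push_cast; ring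
  have e6 : q ^ (4 * ((M + 1 : ℕ) : ℤ) - 2) = (q ^ (2 * M)) ^ 2 * q ^ 2 := by
    rw [show 4 * ((M + 1 : ℕ) : ℤ) - 2 = (4 * ((M + 1 : ℕ) : ℤ) - 4) + 2 by ring,
      zpow_add₀ hq, e5]; rfl
  have hu := h.u_ne
  have hv := h.v_ne
  have hw := h.w_ne
  have hr := h.r_ne
  have hx := h.x_ne M
  have hQ := h.x_ne d
  have d1 := h.one_sub_succ_ne hM'
  have d2 := h.one_sub_ne hM
  simp only [Params.upper, ofBeta, e1, e2, e3, e4, e5, e6]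
  unfold upF
  generalize q ^ (2 * M) = x at *
  generalize q ^ (2 * d) = Q at *
  have d1' : u⁻¹ / r - u / r * (x ^ 2 * q ^ 2) = (1 - u ^ 2 * x ^ 2 * q ^ 2) / (u * r) := by
    field_simp
  have d2' : u⁻¹ / r - u / r * x ^ 2 = (1 - u ^ 2 * x ^ 2) / (u * r) := by
    field_simp
  rw [d1', d2']
  field_simp

/-- Numerator and denominator scale by the same factor `w⁻² Q⁻¹`. The coefficients after `swap` can
therefore be written with the original `w`. -/
lemma lowF_swap (Q : ℂ) (hQ : Q ≠ 0) (hw : w ≠ 0) (x : ℂ) :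
    lowF q r Q v u (w⁻¹ * Q⁻¹) x = lowF q r Q v u w x := by
  unfold lowF
  have e : (1 - x) * (1 - v ^ 2 * x * Q) * (u * (w⁻¹ * Q⁻¹) * Q * q + v * x) *
      (u * q + v * (w⁻¹ * Q⁻¹) * x) = (1 - x) * (1 - v ^ 2 * x * Q) * (u * w * Q * q + v * x) *
      (u * q + v * w * x) * (w⁻¹ ^ 2 * Q⁻¹) := by
    field_simp
  have e2 : r * u * (w⁻¹ * Q⁻¹) * Q * (q ^ 2 - v ^ 2 * x ^ 2) * (1 - v ^ 2 * x ^ 2) =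
      r * u * w * Q * (q ^ 2 - v ^ 2 * x ^ 2) * (1 - v ^ 2 * x ^ 2) * (w⁻¹ ^ 2 * Q⁻¹) := by
    field_simp
  rw [e, e2, mul_div_mul_right _ _ (by positivity)]

lemma upF_swap (Q : ℂ) (hQ : Q ≠ 0) (hw : w ≠ 0) (x : ℂ) :
    upF q r Q v u (w⁻¹ * Q⁻¹) x = upF q r Q v u w x := by
  unfold upF
  have e : (Q - x) * (1 - v ^ 2 * x) * (1 + v * u * (w⁻¹ * Q⁻¹) * x * Q * q) *
      (w⁻¹ * Q⁻¹ + v * u * x * q) = (Q - x) * (1 - v ^ 2 * x) * (1 + v * u * w * x * Q * q) *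
      (w + v * u * x * q) * (w⁻¹ ^ 2 * Q⁻¹) := by
    field_simp
  have e2 : r * u * (w⁻¹ * Q⁻¹) * Q * (1 - v ^ 2 * x ^ 2) * (1 - v ^ 2 * x ^ 2 * q ^ 2) =
      r * u * w * Q * (1 - v ^ 2 * x ^ 2) * (1 - v ^ 2 * x ^ 2 * q ^ 2) * (w⁻¹ ^ 2 * Q⁻¹) := by
    field_simp
  rw [e, e2, mul_div_mul_right _ _ (by positivity)]

end formulas

/-! ### Action of the coefficient matrix on `q`-factorials -/

section recurrence

variable {d : ℕ} {q r u v w : ℂ}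

lemma lowF_ne (h : Nondeg d q r u v w) {M : ℕ} (h0 : 0 < M) (hM : M ≤ d) :
    lowF q r (q ^ (2 * d)) u v w (q ^ (2 * M)) ≠ 0 := by
  have hq := h.q_ne
  have hu := h.u_ne
  have hv := h.v_ne
  have hw := h.w_ne
  have hr := h.r_ne
  have hx := h.x_ne M
  have hQ := h.x_ne d
  have d1 := h.sq_sub_ne hM h0
  have d2 := h.one_sub_ne hM
  have n1 := h.one_sub_pow_ne h0
  have n2 : 1 - u ^ 2 * q ^ (2 * M) * q ^ (2 * d) ≠ 0 := by
    have := h.u_sq (M + d) (by omega)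
    rw [sub_ne_zero, mul_assoc, ← pow_add, ← mul_add]
    exact this.symm
  have n3 : v * w * q ^ (2 * d) * q + u * q ^ (2 * M) ≠ 0 := by
    have := mul_ne_zero (h.vw (d - M) (by omega)) hx
    convert this using 1
    rw [show 2 * d = 2 * (d - M) + 2 * M by omega]
    ring
  have n4 : v * q + u * w * q ^ (2 * M) ≠ 0 := by
    have := mul_ne_zero (h.wu (M - 1) (by omega)) hq
    convert this using 1
    rw [show 2 * M = 2 * (M - 1) + 1 + 1 by omega, pow_succ]
    ring
  unfold lowF
  positivity

lemma upF_ne (h : Nondeg d q r u v w) {M : ℕ} (hM : M < d) :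
    upF q r (q ^ (2 * d)) u v w (q ^ (2 * M)) ≠ 0 := by
  have hq := h.q_ne
  have hu := h.u_ne
  have hv := h.v_ne
  have hw := h.w_ne
  have hr := h.r_ne
  have hx := h.x_ne M
  have hQ := h.x_ne d
  have d1 := h.one_sub_succ_ne hM
  have d2 := h.one_sub_ne hM.le
  have n1 : q ^ (2 * d) - q ^ (2 * M) ≠ 0 := sub_ne_zero.2 (h.pow_sub_ne hM.ne')
  have n2 : 1 - u ^ 2 * q ^ (2 * M) ≠ 0 := by
    have := h.u_sq M (by omega)
    rw [sub_ne_zero]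
    exact this.symm
  have n3 : 1 + u * v * w * q ^ (2 * M) * q ^ (2 * d) * q ≠ 0 := by
    convert h.uvw M hM using 1
    ring
  have n4 : w + u * v * q ^ (2 * M) * q ≠ 0 := by
    convert h.uv M hM using 1
    ring
  unfold upF
  positivity

/-- This is the three-term relation divided by `fac q (u ^ 2) x j`, with `x = q^{2M}` and `y =
q^{2j}`. The factors `1 - x` of `lowF` and `1 - u² x` of `upF` are missing because `fac_lower` and
`fac_raise` absorb them. -/
lemma recurrence_generic (Q x y : ℂ) (hq : q ≠ 0) (hr : r ≠ 0) (hQ : Q ≠ 0)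
    (hv : v ≠ 0) (hw : w ≠ 0) (hx : x ≠ 0) (hy : y ≠ 0)
    (h1 : q ^ 2 - u ^ 2 * x ^ 2 ≠ 0) (h2 : 1 - u ^ 2 * x ^ 2 ≠ 0)
    (h3 : 1 - u ^ 2 * x ^ 2 * q ^ 2 ≠ 0) :
    (1 - u ^ 2 * x * Q) * (v * w * Q * q + u * x) * (v * q + u * w * x) /
        (r * v * w * Q * (q ^ 2 - u ^ 2 * x ^ 2) * (1 - u ^ 2 * x ^ 2)) *
        (-(x - y) * (x - y * q ^ 2) * (1 - u ^ 2 * x / q ^ 2) / x) +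
      ((v + v⁻¹) / r - lowF q r Q u v w x - upF q r Q u v w x -
        (v * (y * q ^ 2) + v⁻¹ * (y * q ^ 2)⁻¹) / r) * ((1 - y / x) * (1 - u ^ 2 * x * y)) +
      (Q - x) * (1 + u * v * w * x * Q * q) * (w + u * v * x * q) /
        (r * v * w * Q * (1 - u ^ 2 * x ^ 2) * (1 - u ^ 2 * x ^ 2 * q ^ 2)) *
        ((1 - 1 / (x * q ^ 2)) * (1 - u ^ 2 * x * y) * (1 - u ^ 2 * x * (y * q ^ 2))) =
      -(1 / (v * r)) * (y * q ^ 2)⁻¹ * (1 + u * v / w * q * y) * (1 + u * v * w * q * Q * y) *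
        (1 - y / Q) * (1 - q ^ 2 * y) := by
  unfold lowF upF
  field_simp
  ring

lemma recurrence_last (x y : ℂ) (hq : q ≠ 0) (hr : r ≠ 0)
    (hv : v ≠ 0) (hw : w ≠ 0) (hx : x ≠ 0) (hy : y ≠ 0)
    (h1 : q ^ 2 - u ^ 2 * x ^ 2 ≠ 0) (h2 : 1 - u ^ 2 * x ^ 2 ≠ 0) :
    (1 - u ^ 2 * x * x) * (v * w * x * q + u * x) * (v * q + u * w * x) /
        (r * v * w * x * (q ^ 2 - u ^ 2 * x ^ 2) * (1 - u ^ 2 * x ^ 2)) *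
        (-(x - y) * (x - y * q ^ 2) * (1 - u ^ 2 * x / q ^ 2) / x) +
      ((v + v⁻¹) / r - lowF q r x u v w x -
        (v * (y * q ^ 2) + v⁻¹ * (y * q ^ 2)⁻¹) / r) * ((1 - y / x) * (1 - u ^ 2 * x * y)) =
      -(1 / (v * r)) * (y * q ^ 2)⁻¹ * (1 + u * v / w * q * y) * (1 + u * v * w * q * x * y) *
        (1 - y / x) * (1 - q ^ 2 * y) := by
  unfold lowF
  field_simp
  ring

lemma recurrence_first (Q : ℂ) (hq : q ≠ 0) (hr : r ≠ 0) (hQ : Q ≠ 0)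
    (hv : v ≠ 0) (hw : w ≠ 0) (h2 : 1 - u ^ 2 ≠ 0) (h3 : 1 - u ^ 2 * q ^ 2 ≠ 0) :
    upF q r Q u v w 1 * ((1 - 1 / q ^ 2) * (1 - u ^ 2 * q ^ 2)) =
      -(1 / (v * r)) * (q ^ 2)⁻¹ * (1 + u * v / w * q) * (1 + u * v * w * q * Q) *
        (1 - 1 / Q) * (1 - q ^ 2) := by
  unfold upF
  simp only [one_pow, mul_one]
  field_simp
  ring

/-- The product `(x⁻¹, a x; q²)_j`. -/
def fac (q a x : ℂ) (j : ℕ) : ℂ := qPoch x⁻¹ (q ^ 2) j * qPoch (a * x) (q ^ 2) j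

/-- The denominators `(b₁, b₂, q^{-2d}, q²; q²)_j` of the `q`-Racah polynomials. -/
def facDen (q Q u v w : ℂ) (j : ℕ) : ℂ :=
  qPoch (-(u * v / w) * q) (q ^ 2) j * qPoch (-(u * v * w) * q * Q) (q ^ 2) j *
    qPoch Q⁻¹ (q ^ 2) j * qPoch (q ^ 2) (q ^ 2) j

lemma qPoch_zero (a Q : ℂ) : qPoch a Q 0 = 1 := by simp [qPoch]

lemma qPoch_succ (a Q : ℂ) (n : ℕ) : qPoch a Q (n + 1) = qPoch a Q n * (1 - a * Q ^ n) := by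
  simp [qPoch, Finset.prod_range_succ]

lemma qPoch_succ' (a Q : ℂ) (n : ℕ) : qPoch a Q (n + 1) = (1 - a) * qPoch (a * Q) Q n := by
  simp only [qPoch, Finset.prod_range_succ', pow_zero, mul_one]
  rw [mul_comm]
  congr 1
  refine Finset.prod_congr rfl fun k _ => ?_
  ring

lemma fac_zero (a x : ℂ) : fac q a x 0 = 1 := by simp [fac, qPoch_zero]

lemma fac_succ (a x : ℂ) (j : ℕ) :
    fac q a x (j + 1) = fac q a x j * ((1 - q ^ (2 * j) / x) * (1 - a * x * q ^ (2 * j))) := by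
  simp only [fac, qPoch_succ, ← pow_mul]
  ring

lemma fac_eq_zero (hq : q ≠ 0) (a : ℂ) {M j : ℕ} (hj : M < j) : fac q a (q ^ (2 * M)) j = 0 := by
  have : qPoch (q ^ (2 * M))⁻¹ (q ^ 2) j = 0 := by
    refine Finset.prod_eq_zero (Finset.mem_range.2 hj) ?_
    rw [← pow_mul, inv_mul_cancel₀ (pow_ne_zero _ hq), sub_self]
  simp [fac, this]

lemma fac_raise (hq : q ≠ 0) (a x : ℂ) (hx : x ≠ 0) (j : ℕ) :
    (1 - a * x) * fac q a (x * q ^ 2) (j + 1) = fac q a x j *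
      ((1 - 1 / (x * q ^ 2)) * (1 - a * x * q ^ (2 * j)) * (1 - a * x * (q ^ (2 * j) * q ^ 2))) := by
  have e1 : qPoch (x * q ^ 2)⁻¹ (q ^ 2) (j + 1) = (1 - 1 / (x * q ^ 2)) * qPoch x⁻¹ (q ^ 2) j := by
    rw [qPoch_succ']
    congr 2
    · rw [one_div]
    · field_simp
  have e2 : (1 - a * x) * qPoch (a * (x * q ^ 2)) (q ^ 2) (j + 1) =
      qPoch (a * x) (q ^ 2) j * (1 - a * x * q ^ (2 * j)) * (1 - a * x * (q ^ (2 * j) * q ^ 2)) := by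
    rw [← mul_assoc a, ← qPoch_succ', qPoch_succ, qPoch_succ, ← pow_mul, ← pow_mul]
    ring
  simp only [fac, e1]
  linear_combination (1 - 1 / (x * q ^ 2)) * qPoch x⁻¹ (q ^ 2) j * e2

lemma fac_lower (hq : q ≠ 0) (a x : ℂ) (hx : x ≠ 0) (j : ℕ) :
    (1 - x) * fac q a (x / q ^ 2) (j + 1) = fac q a x j *
      (-(x - q ^ (2 * j)) * (x - q ^ (2 * j) * q ^ 2) * (1 - a * x / q ^ 2) / x) := by
  have e1 : qPoch (a * (x / q ^ 2)) (q ^ 2) (j + 1) =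
      (1 - a * x / q ^ 2) * qPoch (a * x) (q ^ 2) j := by
    rw [qPoch_succ']
    congr 2
    · rw [mul_div_assoc]
    · field_simp
  have e2 : (1 - x) * qPoch (x / q ^ 2)⁻¹ (q ^ 2) (j + 1) =
      qPoch x⁻¹ (q ^ 2) j * (-(x - q ^ (2 * j)) * (x - q ^ (2 * j) * q ^ 2) / x) := by
    have e3 : (1 - x⁻¹) * qPoch (x / q ^ 2)⁻¹ (q ^ 2) (j + 1) =
        qPoch x⁻¹ (q ^ 2) j * (1 - q ^ (2 * j) / x) * (1 - q ^ (2 * j) * q ^ 2 / x) := by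
      have : (x / q ^ 2)⁻¹ = x⁻¹ * q ^ 2 := by field_simp
      rw [this, ← qPoch_succ', qPoch_succ, qPoch_succ, ← pow_mul, ← pow_mul]
      ring
    have e4 : (1 - x) = -x * (1 - x⁻¹) := by field_simp; ring
    rw [e4, mul_assoc, e3]
    field_simp
  simp only [fac, e1]
  linear_combination (1 - a * x / q ^ 2) * qPoch (a * x) (q ^ 2) j * e2

lemma fac_recurrence_zero {M : ℕ} :
    let x := q ^ (2 * M)
    lowF q r (q ^ (2 * d)) u v w x * fac q (u ^ 2) (q ^ (2 * (M - 1))) 0 +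
      ((v + v⁻¹) / r - lowF q r (q ^ (2 * d)) u v w x - upF q r (q ^ (2 * d)) u v w x) *
        fac q (u ^ 2) x 0 +
      upF q r (q ^ (2 * d)) u v w x * fac q (u ^ 2) (q ^ (2 * (M + 1))) 0 =
      (v + v⁻¹) / r * fac q (u ^ 2) x 0 := by
  simp only [fac_zero]
  ring

/-- The tridiagonal operator in `M` is bidiagonal on the functions `M ↦ fac q (u ^ 2) (q ^ (2 * M))
j`: it sends the one of degree `j + 1` to a multiple of itself plus a multiple of the one of degree
`j`. -/
lemma fac_recurrence_succ (h : Nondeg d q r u v w) {M : ℕ} (hM : M ≤ d) (j : ℕ) :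
    let x := q ^ (2 * M)
    let y := q ^ (2 * j)
    let Q := q ^ (2 * d)
    lowF q r Q u v w x * fac q (u ^ 2) (q ^ (2 * (M - 1))) (j + 1) +
      ((v + v⁻¹) / r - lowF q r Q u v w x - upF q r Q u v w x) * fac q (u ^ 2) x (j + 1) +
      upF q r Q u v w x * fac q (u ^ 2) (q ^ (2 * (M + 1))) (j + 1) =
      (v * (y * q ^ 2) + v⁻¹ * (y * q ^ 2)⁻¹) / r * fac q (u ^ 2) x (j + 1) +
      -(1 / (v * r)) * (y * q ^ 2)⁻¹ * (1 + u * v / w * q * y) * (1 + u * v * w * q * Q * y) *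
        (1 - y / Q) * (1 - q ^ 2 * y) * fac q (u ^ 2) x j := by
  intro x y Q
  have hq := h.q_ne
  have hv := h.v_ne
  have hw := h.w_ne
  have hr := h.r_ne
  have hx : x ≠ 0 := h.x_ne M
  have hy : y ≠ 0 := h.x_ne j
  have hQ : Q ≠ 0 := h.x_ne d
  have d2 : 1 - u ^ 2 * x ^ 2 ≠ 0 := h.one_sub_ne hM
  have exs : q ^ (2 * (M + 1)) = x * q ^ 2 := by simp only [x]; ring
  have eU := fac_raise hq (u ^ 2) x hx j
  have eL := fac_lower hq (u ^ 2) x hx j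
  have eS := fac_succ (q := q) (u ^ 2) x j
  rw [exs]
  have eup : upF q r Q u v w x * fac q (u ^ 2) (x * q ^ 2) (j + 1) =
      (Q - x) * (1 + u * v * w * x * Q * q) * (w + u * v * x * q) /
        (r * v * w * Q * (1 - u ^ 2 * x ^ 2) * (1 - u ^ 2 * x ^ 2 * q ^ 2)) *
        ((1 - 1 / (x * q ^ 2)) * (1 - u ^ 2 * x * y) * (1 - u ^ 2 * x * (y * q ^ 2))) *
        fac q (u ^ 2) x j := by
    unfold upF
    linear_combination (Q - x) * (1 + u * v * w * x * Q * q) * (w + u * v * x * q) /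
        (r * v * w * Q * (1 - u ^ 2 * x ^ 2) * (1 - u ^ 2 * x ^ 2 * q ^ 2)) * eU
  -- In row `0` the truncated index `M - 1` is harmless, as its coefficient vanishes. All factorials
  -- at `x = 1` of positive degree vanish as well, so only `j = 0` has content.
  rcases Nat.eq_zero_or_pos M with rfl | h0
  · have hx1 : x = 1 := by simp [x]
    rcases Nat.eq_zero_or_pos d with rfl | hd
    · have hQ1 : Q = 1 := by simp [Q]
      rcases Nat.eq_zero_or_pos j with rfl | hj
      · have hy1 : y = 1 := by simp [y]
        rw [hx1, hQ1, hy1, lowF_one, upF_self]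
        simp [fac, qPoch]
      · have z1 : fac q (u ^ 2) x j = 0 := fac_eq_zero hq _ hj
        have z2 : fac q (u ^ 2) x (j + 1) = 0 := fac_eq_zero hq _ (by omega)
        rw [z1, z2, hx1, hQ1, lowF_one, upF_self]
        ring
    · rcases Nat.eq_zero_or_pos j with rfl | hj
      · have hy1 : y = 1 := by simp [y]
        have z2 : fac q (u ^ 2) x (0 + 1) = 0 := fac_eq_zero hq _ (by omega)
        have d3 := h.one_sub_succ_ne hd
        have := recurrence_first Q hq hr hQ hv hw (by simpa [hx1] using d2)
          (by simpa using d3)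
        have e5 : fac q (u ^ 2) (x * q ^ 2) (0 + 1) = (1 - 1 / q ^ 2) * (1 - u ^ 2 * q ^ 2) := by
          rw [fac_succ, fac_zero, hx1]; simp
        rw [z2, e5, hx1, hy1, lowF_one, fac_zero]
        linear_combination this
      · have z1 : fac q (u ^ 2) x j = 0 := fac_eq_zero hq _ hj
        have z2 : fac q (u ^ 2) x (j + 1) = 0 := fac_eq_zero hq _ (by omega)
        rw [eup, z1, z2, hx1, lowF_one]
        ring
  have exp : q ^ (2 * (M - 1)) = x / q ^ 2 := by
    rw [eq_div_iff (pow_ne_zero _ hq), ← pow_add]; congr 1; omega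
  have d1 : q ^ 2 - u ^ 2 * x ^ 2 ≠ 0 := h.sq_sub_ne hM h0
  have elo : lowF q r Q u v w x * fac q (u ^ 2) (x / q ^ 2) (j + 1) =
      (1 - u ^ 2 * x * Q) * (v * w * Q * q + u * x) * (v * q + u * w * x) /
        (r * v * w * Q * (q ^ 2 - u ^ 2 * x ^ 2) * (1 - u ^ 2 * x ^ 2)) *
        (-(x - y) * (x - y * q ^ 2) * (1 - u ^ 2 * x / q ^ 2) / x) * fac q (u ^ 2) x j := by
    unfold lowF
    linear_combination (1 - u ^ 2 * x * Q) * (v * w * Q * q + u * x) * (v * q + u * w * x) /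
        (r * v * w * Q * (q ^ 2 - u ^ 2 * x ^ 2) * (1 - u ^ 2 * x ^ 2)) * eL
  rw [exp, elo]
  rcases hM.eq_or_lt with hMd | hM'
  · have hQx : Q = x := by simp only [Q, x, hMd]
    have := recurrence_last (q := q) (u := u) x y hq hr hv hw hx hy d1 d2
    rw [hQx, upF_self, eS]
    linear_combination fac q (u ^ 2) x j * this
  · have d3 : 1 - u ^ 2 * x ^ 2 * q ^ 2 ≠ 0 := h.one_sub_succ_ne hM'
    have := recurrence_generic Q x y hq hr hQ hv hw hx hy d1 d2 d3
    rw [eup, eS]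
    linear_combination fac q (u ^ 2) x j * this

end recurrence

/-! ### The `q`-Racah values as eigenvectors, and their duality -/

section matrices

variable {d : ℕ} {q r u v w : ℂ}

lemma tri_sum (p : Params d) (f : ℕ → ℂ) (M : Fin (d + 1)) :
    ∑ N : Fin (d + 1), p.tri M N * f N =
      p.lower M * f ((M : ℕ) - 1) +
        (theta p.q p.bb p.cb 0 - p.upper (M + 1) - p.lower M) * f M +
        p.upper (M + 1) * f (M + 1) := by
  -- For `M = 0` the truncated `M - 1` coincides with `M`, but its term carries `lower 0 = 0`; for
  -- `M = d` the index `M + 1` leaves the range, but `upper (d + 1) = 0`.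
  let T : ℕ → ℂ := fun n => (if n = (M : ℕ) - 1 then p.lower M * f n else 0) +
        (if n = (M : ℕ) then
          (theta p.q p.bb p.cb 0 - p.upper (M + 1) - p.lower M) * f n else 0) +
        (if n = (M : ℕ) + 1 then p.upper (M + 1) * f n else 0)
  have key : ∀ N : Fin (d + 1), p.tri M N * f N = T N := by
    intro N
    simp only [T]
    simp only [Params.tri, Fin.ext_iff]
    rcases Nat.eq_zero_or_pos (M : ℕ) with h0 | h0
    · simp only [h0, lower_zero]
      by_cases h1 : (N : ℕ) = 0
      · simp [h1]
      · by_cases h2 : (N : ℕ) = 1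
        · simp [h2]
        · have h3 : ¬ (0 : ℕ) = N := fun h => h1 h.symm
          simp [h1, h2, h3]
    · by_cases h1 : (M : ℕ) = N + 1
      · have e1 : (N : ℕ) = M - 1 := by omega
        have e2 : ¬ (N : ℕ) = M := by omega
        have e3 : ¬ (N : ℕ) = M + 1 := by omega
        rw [if_pos h1, if_pos e1, if_neg e2, if_neg e3]
        ring
      · have e1 : ¬ (N : ℕ) = M - 1 := by omega
        rw [if_neg h1, if_neg e1]
        by_cases h2 : (N : ℕ) = M + 1
        · have e2 : ¬ (N : ℕ) = M := by omega
          rw [if_pos h2, if_neg e2, if_pos h2, h2]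
          ring
        · rw [if_neg h2, if_neg h2]
          by_cases h3 : (N : ℕ) = M
          · rw [if_pos h3.symm, if_pos h3]
            ring
          · rw [if_neg (fun h => h3 h.symm), if_neg h3]
            ring
  rw [Finset.sum_congr rfl fun N _ => key N, Fin.sum_univ_eq_sum_range T (d + 1)]
  simp only [T, Finset.sum_add_distrib, Finset.sum_ite_eq', Finset.mem_range]
  have hM := M.isLt
  rw [if_pos (by omega), if_pos hM]
  by_cases hd : (M : ℕ) + 1 < d + 1
  · rw [if_pos hd]
  · rw [if_neg hd, show (M : ℕ) = d by omega, upper_succ_last]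
    ring

/-- The `q`-Racah polynomial in the normalized parameters, as a sum over `0 ≤ j ≤ d`. -/
def racahSum (d : ℕ) (q u v w : ℂ) (M N : ℕ) : ℂ :=
  ∑ j ∈ Finset.range (d + 1), fac q (u ^ 2) (q ^ (2 * M)) j * fac q (v ^ 2) (q ^ (2 * N)) j /
    facDen q (q ^ (2 * d)) u v w j * q ^ (2 * j)

lemma zpow_neg_two_mul (q : ℂ) (M : ℕ) : q ^ (-2 * (M : ℤ)) = (q ^ (2 * M))⁻¹ := by
  rw [show (-2 * (M : ℤ)) = -(2 * (M : ℤ)) by ring, zpow_neg, zpow_two_mul_natCast]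

lemma ratio_sq (hr : r ≠ 0) (hu : u ≠ 0) : u / r / (u⁻¹ / r) = u ^ 2 := by
  field_simp

lemma racah_ofBeta (h : Nondeg d q r u v w) {M : ℕ} (hM : M ≤ d) (N : ℕ) :
    (ofBeta d q r u v w).racah M N = racahSum d q u v w M N := by
  have hq := h.q_ne
  have hu := h.u_ne
  have hv := h.v_ne
  have hw := h.w_ne
  have hr := h.r_ne
  have e1 : -(u / r * (w⁻¹ / r) / (v⁻¹ / r)) * r * q = -(u * v / w) * q := by
    field_simp
  have e2 : -(v / r * (w / r) / (u⁻¹ / r)) * r * q ^ (2 * (d : ℤ) + 1) =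
      -(u * v * w) * q * q ^ (2 * d) := by
    rw [zpow_add₀ hq, zpow_two_mul_natCast, zpow_one]
    field_simp
  simp only [Params.racah, ofBeta, e1, e2, ratio_sq hr hu, ratio_sq hr hv, zpow_two_mul_natCast,
    zpow_neg_two_mul]
  have hsub : Finset.range (M + 1) ⊆ Finset.range (d + 1) := by
    intro j hj
    simp only [Finset.mem_range] at *
    omega
  rw [racahSum, ← Finset.sum_subset hsub]
  · refine Finset.sum_congr rfl fun j _ => ?_
    simp only [fac, facDen, ← pow_mul]
    ring
  · intro j _ hj
    rw [fac_eq_zero hq _ (by simpa [Nat.lt_succ_iff] using hj)]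
    ring

lemma facDen_succ (Q : ℂ) (j : ℕ) : facDen q Q u v w (j + 1) = facDen q Q u v w j *
    ((1 + u * v / w * q * q ^ (2 * j)) * (1 + u * v * w * q * Q * q ^ (2 * j)) *
      (1 - q ^ (2 * j) / Q) * (1 - q ^ 2 * q ^ (2 * j))) := by
  simp only [facDen, qPoch_succ, ← pow_mul]
  ring

lemma facDen_factor_ne (h : Nondeg d q r u v w) {j : ℕ} (hj : j < d) :
    (1 + u * v / w * q * q ^ (2 * j)) * (1 + u * v * w * q * q ^ (2 * d) * q ^ (2 * j)) *
      (1 - q ^ (2 * j) / q ^ (2 * d)) * (1 - q ^ 2 * q ^ (2 * j)) ≠ 0 := by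
  have hw := h.w_ne
  have hQ := h.x_ne d
  have n1 : 1 + u * v / w * q * q ^ (2 * j) ≠ 0 := by
    have := div_ne_zero (h.uv j hj) hw
    convert this using 1
    field_simp
    ring
  have n2 : 1 + u * v * w * q * q ^ (2 * d) * q ^ (2 * j) ≠ 0 := by
    convert h.uvw j hj using 1
    ring
  have n3 : 1 - q ^ (2 * j) / q ^ (2 * d) ≠ 0 := by
    rw [sub_ne_zero]
    intro he
    rw [eq_div_iff hQ, one_mul] at he
    exact h.pow_sub_ne hj.ne' he
  have n4 : 1 - q ^ 2 * q ^ (2 * j) ≠ 0 := by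
    convert h.one_sub_pow_ne (Nat.succ_pos j) using 2
    rw [← pow_add]; congr 1; omega
  positivity

lemma facDen_ne (h : Nondeg d q r u v w) {j : ℕ} (hj : j ≤ d) :
    facDen q (q ^ (2 * d)) u v w j ≠ 0 := by
  induction j with
  | zero => simp [facDen, qPoch_zero]
  | succ j ih =>
    rw [facDen_succ]
    exact mul_ne_zero (ih (by omega)) (facDen_factor_ne h (by omega))

/-- The substitution exchanges the first two factors of `facDen` and the two numerator factorials.
Summing up to `d` instead of `M` makes the whole expression symmetric. -/
lemma racahSum_swap (h : Nondeg d q r u v w) (M N : ℕ) :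
    racahSum d q v u (w⁻¹ * (q ^ (2 * d))⁻¹) N M = racahSum d q u v w M N := by
  have hw := h.w_ne
  have hQ := h.x_ne d
  refine Finset.sum_congr rfl fun j _ => ?_
  have e1 : -(v * u / (w⁻¹ * (q ^ (2 * d))⁻¹)) * q = -(u * v * w) * q * q ^ (2 * d) := by
    field_simp
  have e2 : -(v * u * (w⁻¹ * (q ^ (2 * d))⁻¹)) * q * q ^ (2 * d) = -(u * v / w) * q := by
    field_simp
  simp only [facDen, e1, e2]
  ring

/-- Apply the bidiagonal action termwise. The ratio of consecutive expansion coefficients turns the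
lower-degree contribution into `(Θ N - Θ j) F j G j`; adding `Θ j F j G j` from the diagonal
contribution leaves `Θ N F j G j`. -/
lemma racahSum_recurrence (h : Nondeg d q r u v w) {M N : ℕ} (hM : M ≤ d) (hN : N ≤ d) :
    lowF q r (q ^ (2 * d)) u v w (q ^ (2 * M)) * racahSum d q u v w (M - 1) N +
      ((v + v⁻¹) / r - upF q r (q ^ (2 * d)) u v w (q ^ (2 * M)) -
        lowF q r (q ^ (2 * d)) u v w (q ^ (2 * M))) * racahSum d q u v w M N +
      upF q r (q ^ (2 * d)) u v w (q ^ (2 * M)) * racahSum d q u v w (M + 1) N =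
    (v * q ^ (2 * N) + v⁻¹ * (q ^ (2 * N))⁻¹) / r * racahSum d q u v w M N := by
  have hq := h.q_ne
  have hv := h.v_ne
  have hr := h.r_ne
  have hx := h.x_ne N
  set Q := q ^ (2 * d) with hQdef
  have hQ : Q ≠ 0 := h.x_ne d
  set F : ℕ → ℂ := fun j => fac q (u ^ 2) (q ^ (2 * M)) j
  set G : ℕ → ℂ := fun j => fac q (v ^ 2) (q ^ (2 * N)) j / facDen q Q u v w j * q ^ (2 * j)
  set Θ : ℕ → ℂ := fun j => (v * q ^ (2 * j) + v⁻¹ * (q ^ (2 * j))⁻¹) / r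
  set C : ℕ → ℂ := fun j => lowF q r Q u v w (q ^ (2 * M)) * fac q (u ^ 2) (q ^ (2 * (M - 1))) j +
    ((v + v⁻¹) / r - lowF q r Q u v w (q ^ (2 * M)) - upF q r Q u v w (q ^ (2 * M))) * F j +
    upF q r Q u v w (q ^ (2 * M)) * fac q (u ^ 2) (q ^ (2 * (M + 1))) j
  have hR : ∀ L, racahSum d q u v w L N =
      ∑ j ∈ Finset.range (d + 1), fac q (u ^ 2) (q ^ (2 * L)) j * G j := fun L =>
    Finset.sum_congr rfl fun j _ => by simp only [G]; ring
  have hC0 : C 0 * G 0 = Θ 0 * F 0 * G 0 := by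
    have := fac_recurrence_zero (d := d) (q := q) (r := r) (u := u) (v := v) (w := w) (M := M)
    simp only at this
    simp only [C, F, Θ]
    rw [this]
    simp
  have hC : ∀ j < d, C (j + 1) * G (j + 1) = Θ (j + 1) * F (j + 1) * G (j + 1) +
      (Θ N - Θ j) * F j * G j := by
    intro j hj
    have := fac_recurrence_succ h hM j
    simp only at this
    have hy := h.x_ne j
    have hD := facDen_ne h hj.le
    have hD' := facDen_factor_ne h hj
    have e : q ^ (2 * (j + 1)) = q ^ (2 * j) * q ^ 2 := by ring
    simp only [C, F]
    rw [this, add_mul]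
    simp only [Θ, e]
    congr 1
    simp only [G, fac_succ, facDen_succ, e]
    rw [← hQdef] at hD hD'
    generalize hP : (1 + u * v / w * q * q ^ (2 * j)) * (1 + u * v * w * q * Q * q ^ (2 * j)) *
      (1 - q ^ (2 * j) / Q) * (1 - q ^ 2 * q ^ (2 * j)) = P at *
    have e7 : -(1 / (v * r)) * (q ^ (2 * j) * q ^ 2)⁻¹ * (1 + u * v / w * q * q ^ (2 * j)) *
      (1 + u * v * w * q * Q * q ^ (2 * j)) * (1 - q ^ (2 * j) / Q) * (1 - q ^ 2 * q ^ (2 * j)) =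
      -(1 / (v * r)) * (q ^ (2 * j) * q ^ 2)⁻¹ * P := by rw [← hP]; ring
    rw [e7]
    generalize q ^ (2 * j) = y at *
    generalize q ^ (2 * N) = x at *
    field_simp
    ring
  -- The shifted sum lacks its term `j = d`. That term is zero: either `N = d`, or the terminating
  -- factorial in `N` vanishes.
  have hlast : (Θ N - Θ d) * F d * G d = 0 := by
    rcases hN.eq_or_lt with rfl | hN'
    · simp
    · have : G d = 0 := by
        simp only [G]
        rw [fac_eq_zero hq _ hN']
        simp
      rw [this, mul_zero]
  rw [hR, hR, hR]
  have hsum : ∑ j ∈ Finset.range (d + 1), C j * G j =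
      Θ N * ∑ j ∈ Finset.range (d + 1), F j * G j := by
    rw [Finset.sum_range_succ', hC0, Finset.sum_congr rfl fun j hj => hC j (Finset.mem_range.1 hj),
      Finset.sum_add_distrib]
    have s1 := Finset.sum_range_succ' (fun j => Θ j * F j * G j) d
    have s2 := Finset.sum_range_succ (fun j => (Θ N - Θ j) * F j * G j) d
    rw [hlast, add_zero] at s2
    rw [← s2, Finset.mul_sum]
    have s3 : ∑ j ∈ Finset.range (d + 1), (Θ N - Θ j) * F j * G j =
      ∑ j ∈ Finset.range (d + 1), Θ N * (F j * G j) -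
      ∑ j ∈ Finset.range (d + 1), Θ j * F j * G j := by
      rw [← Finset.sum_sub_distrib]
      exact Finset.sum_congr rfl fun j _ => by ring
    rw [s3, s1]
    ring
  rw [← hsum, Finset.mul_sum, Finset.mul_sum, Finset.mul_sum, ← Finset.sum_add_distrib,
    ← Finset.sum_add_distrib]
  refine Finset.sum_congr rfl fun j _ => ?_
  simp only [C, F]
  ring

/-- The matrix of values of the `q`-Racah polynomials. -/
def racahMat (p : Params d) : Matrix (Fin (d + 1)) (Fin (d + 1)) ℂ := fun M N => p.racah M N

/-- The diagonal matrix with entries `𝖻 q^{2M} + 𝖼 q^{-2M}`. -/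
def thetaMat (d : ℕ) (q b c : ℂ) : Matrix (Fin (d + 1)) (Fin (d + 1)) ℂ :=
  Matrix.diagonal fun M => theta q b c M

lemma tri_mul_racahMat (h : Nondeg d q r u v w) :
    (ofBeta d q r u v w).tri * racahMat (ofBeta d q r u v w) =
      racahMat (ofBeta d q r u v w) * thetaMat d q (v / r) (v⁻¹ / r) := by
  ext M N
  have hM : (M : ℕ) ≤ d := Nat.lt_succ_iff.1 M.isLt
  have hN : (N : ℕ) ≤ d := Nat.lt_succ_iff.1 N.isLt
  rw [thetaMat, Matrix.mul_diagonal, Matrix.mul_apply]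
  have e : ∀ L : Fin (d + 1), racahMat (ofBeta d q r u v w) L N = racahSum d q u v w L N :=
    fun L => racah_ofBeta h (Nat.lt_succ_iff.1 L.isLt) N
  simp only [e]
  rw [tri_sum _ (fun n => racahSum d q u v w n N), lower_ofBeta h hM, upper_ofBeta h hM,
    theta_ofBeta, mul_comm (racahSum d q u v w M N)]
  have := racahSum_recurrence h hM hN
  rw [← this]
  have e0 : theta (ofBeta d q r u v w).q (ofBeta d q r u v w).bb (ofBeta d q r u v w).cb 0 =
      (v + v⁻¹) / r := by
    simp only [ofBeta]
    rw [theta_ofBeta]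
    simp
  rw [e0]

lemma racahMat_swap (h : Nondeg d q r u v w) :
    racahMat (ofBeta d q r u v w).swap = (racahMat (ofBeta d q r u v w)).transpose := by
  ext M N
  rw [Matrix.transpose_apply, swap_ofBeta h]
  simp only [racahMat]
  rw [racah_ofBeta h.swap (Nat.lt_succ_iff.1 M.isLt), racah_ofBeta h (Nat.lt_succ_iff.1 N.isLt),
    racahSum_swap h]

end matrices

/-! ### The weights -/

section weights

variable {d : ℕ} {q r u v w : ℂ}

lemma qPoch_ne_zero {a Q : ℂ} {n : ℕ} (h : ∀ k < n, 1 - a * Q ^ k ≠ 0) : qPoch a Q n ≠ 0 :=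
  Finset.prod_ne_zero_iff.2 fun k hk => h k (Finset.mem_range.1 hk)

lemma weight_zero (h : Nondeg d q r u v w) : (ofBeta d q r u v w).weight 0 = 1 := by
  have hv := h.v_ne
  have hr := h.r_ne
  have h1 : 1 - v ^ 2 ≠ 0 := by
    have := h.v_sq 0 (by omega)
    rw [sub_ne_zero]
    simpa using this.symm
  simp only [Params.weight, qPoch_zero, ofBeta, ratio_sq hr hv]
  simp [h1]

lemma weight_ofBeta (h : Nondeg d q r u v w) (N : ℕ) : (ofBeta d q r u v w).weight N =
    (qPoch (-(u * v * w) * q * q ^ (2 * d)) (q ^ 2) N * qPoch (-(u * v / w) * q) (q ^ 2) N *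
      qPoch (v ^ 2) (q ^ 2) N * qPoch (q ^ (2 * d))⁻¹ (q ^ 2) N) /
    (qPoch (q ^ 2) (q ^ 2) N * qPoch (-(v * w / u) * q) (q ^ 2) N *
      qPoch (-(v / (u * w)) * q / q ^ (2 * d)) (q ^ 2) N *
      qPoch (v ^ 2 * (q ^ 2 * q ^ (2 * d))) (q ^ 2) N) *
    ((1 - v ^ 2 * (q ^ (2 * N)) ^ 2) / ((u ^ 2) ^ N * (1 - v ^ 2))) := by
  have hq := h.q_ne
  have hu := h.u_ne
  have hv := h.v_ne
  have hw := h.w_ne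
  have hr := h.r_ne
  have e1 : -(u / r * (w⁻¹ / r) / (v⁻¹ / r)) * r * q = -(u * v / w) * q := by
    field_simp
  have e2 : -(v / r * (w / r) / (u⁻¹ / r)) * r * q ^ (2 * (d : ℤ) + 1) =
      -(u * v * w) * q * q ^ (2 * d) := by
    rw [zpow_add₀ hq, zpow_two_mul_natCast, zpow_one]
    field_simp
  have e3 : -(v / r * (w / r) / (u / r)) * r * q = -(v * w / u) * q := by
    field_simp
  have e4 : -(u⁻¹ / r * (w⁻¹ / r) / (v⁻¹ / r)) * r * q ^ (1 - 2 * (d : ℤ)) =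
      -(v / (u * w)) * q / q ^ (2 * d) := by
    rw [zpow_sub₀ hq, zpow_two_mul_natCast, zpow_one]
    field_simp
  have e5 : q ^ (2 * (d : ℤ) + 2) = q ^ 2 * q ^ (2 * d) := by
    rw [zpow_add₀ hq, zpow_two_mul_natCast, mul_comm]; rfl
  have e6 : q ^ (4 * (N : ℤ)) = (q ^ (2 * N)) ^ 2 := by
    rw [← zpow_two_mul_natCast, ← zpow_natCast, ← zpow_mul]; congr 1; push_cast; ring
  simp only [Params.weight, ofBeta, e1, e2, e3, e4, e5, e6, ratio_sq hr hu, ratio_sq hr hv,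
    zpow_neg_two_mul]

lemma one_add_vw_ne (h : Nondeg d q r u v w) {k : ℕ} (hk : k < d) :
    1 + v * w / u * q * q ^ (2 * k) ≠ 0 := by
  have hu := h.u_ne
  have := div_ne_zero (h.vw k hk) hu
  convert this using 1
  field_simp
  ring

lemma one_add_v_ne (h : Nondeg d q r u v w) {k : ℕ} (hk : k < d) :
    1 + v / (u * w) * q / q ^ (2 * d) * q ^ (2 * k) ≠ 0 := by
  have hu := h.u_ne
  have hw := h.w_ne
  have hq := h.q_ne
  have hQ := h.x_ne d
  have hx := h.x_ne k
  have := div_ne_zero (h.wu (d - 1 - k) (by omega)) (mul_ne_zero (mul_ne_zero hw hu)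
    (pow_ne_zero (2 * (d - 1 - k) + 1) hq))
  convert this using 1
  have e := pow_even_split q hk
  rw [e]
  have h1 : q ^ (2 * (d - 1 - k) + 1) ≠ 0 := pow_ne_zero _ hq
  have h2 : q ^ (2 * k + 1) = q ^ (2 * k) * q := pow_succ _ _
  rw [h2]
  field_simp

lemma weight_den_ne (h : Nondeg d q r u v w) {N : ℕ} (hN : N ≤ d) :
    qPoch (q ^ 2) (q ^ 2) N ≠ 0 ∧ qPoch (-(v * w / u) * q) (q ^ 2) N ≠ 0 ∧
      qPoch (-(v / (u * w)) * q / q ^ (2 * d)) (q ^ 2) N ≠ 0 ∧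
      qPoch (v ^ 2 * (q ^ 2 * q ^ (2 * d))) (q ^ 2) N ≠ 0 := by
  refine ⟨qPoch_ne_zero fun k hk => ?_, qPoch_ne_zero fun k hk => ?_,
    qPoch_ne_zero fun k hk => ?_, qPoch_ne_zero fun k hk => ?_⟩
  · convert h.one_sub_pow_ne (Nat.succ_pos k) using 2
    rw [← pow_mul, ← pow_add]; congr 1; omega
  · convert one_add_vw_ne h (hk.trans_le hN) using 1
    rw [← pow_mul]
    ring
  · convert one_add_v_ne h (hk.trans_le hN) using 1
    rw [← pow_mul]
    ring
  · rw [sub_ne_zero]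
    convert (h.v_sq (1 + d + k) (by omega)).symm using 1
    rw [← pow_mul]
    ring

/-- Detailed balance: the quotient of consecutive weights equals the quotient of opposite
off-diagonal entries of the dual matrix, so the weights symmetrize it. -/
lemma weight_succ (h : Nondeg d q r u v w) {N : ℕ} (hN : N < d) :
    (ofBeta d q r u v w).weight N * upF q r (q ^ (2 * d)) v u w (q ^ (2 * N)) =
      (ofBeta d q r u v w).weight (N + 1) *
        lowF q r (q ^ (2 * d)) v u w (q ^ (2 * (N + 1))) := by
  have hq := h.q_ne
  have hu := h.u_ne
  have hv := h.v_ne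
  have hw := h.w_ne
  have hr := h.r_ne
  have hx := h.x_ne N
  have hQ := h.x_ne d
  have h0 : 1 - v ^ 2 ≠ 0 := by
    have := h.v_sq 0 (by omega)
    rw [sub_ne_zero]
    simpa using this.symm
  obtain ⟨p1, p2, p3, p4⟩ := weight_den_ne h hN.le
  have n1 : 1 - q ^ 2 * q ^ (2 * N) ≠ 0 := by
    convert h.one_sub_pow_ne (Nat.succ_pos N) using 2
    rw [← pow_add]; congr 1; omega
  have n2 := one_add_vw_ne h hN
  have n3 := one_add_v_ne h hN
  have n4 : 1 - v ^ 2 * (q ^ 2 * q ^ (2 * d)) * q ^ (2 * N) ≠ 0 := by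
    rw [sub_ne_zero]
    convert (h.v_sq (1 + d + N) (by omega)).symm using 1
    ring
  have m1 := h.rot.one_sub_ne hN.le
  have m2 := h.rot.one_sub_succ_ne hN
  have m4 := h.rot.one_sub_ne (Nat.succ_le_of_lt hN)
  have m3 : u * w * q ^ (2 * d) * q + v * (q ^ (2 * N) * q ^ 2) ≠ 0 := by
    have := mul_ne_zero (mul_ne_zero (mul_ne_zero n3 (mul_ne_zero hu hw)) hq) hQ
    intro he
    apply this
    field_simp
    linear_combination he
  have m5 : u * q + v * w * (q ^ (2 * N) * q ^ 2) ≠ 0 := by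
    have := mul_ne_zero (mul_ne_zero n2 hu) hq
    intro he
    apply this
    field_simp
    linear_combination he
  have e : q ^ (2 * (N + 1)) = q ^ (2 * N) * q ^ 2 := by ring
  have e' : ∀ (a : ℂ) (k : ℕ), (a ^ 2) ^ k = a ^ (2 * k) := fun a k => (pow_mul a 2 k).symm
  simp only [weight_ofBeta h, qPoch_succ, e' q, e' u, e]
  rw [Nat.succ_eq_add_one, e] at m4
  unfold upF lowF
  generalize qPoch (q ^ 2) (q ^ 2) N = P1 at *
  generalize qPoch (-(v * w / u) * q) (q ^ 2) N = P2 at *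
  generalize qPoch (-(v / (u * w)) * q / q ^ (2 * d)) (q ^ 2) N = P3 at *
  generalize qPoch (v ^ 2 * (q ^ 2 * q ^ (2 * d))) (q ^ 2) N = P4 at *
  generalize qPoch (-(u * v * w) * q * q ^ (2 * d)) (q ^ 2) N = P5 at *
  generalize qPoch (-(u * v / w) * q) (q ^ 2) N = P6 at *
  generalize qPoch (v ^ 2) (q ^ 2) N = P7 at *
  generalize qPoch (q ^ (2 * d))⁻¹ (q ^ 2) N = P8 at *
  rw [show u ^ (2 * (N + 1)) = u ^ (2 * N) * u ^ 2 by ring]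
  have hU : u ^ (2 * N) ≠ 0 := pow_ne_zero _ hu
  generalize u ^ (2 * N) = U at *
  generalize q ^ (2 * N) = x at *
  generalize q ^ (2 * d) = Q at *
  have a1 : 1 - -(u * v * w) * q * Q * x = 1 + v * u * w * x * Q * q := by ring
  have a2 : 1 - -(u * v / w) * q * x = (w + v * u * x * q) / w := by field_simp; ring
  have a3 : 1 - Q⁻¹ * x = (Q - x) / Q := by field_simp
  have a4 : 1 - -(v * w / u) * q * x = (u * q + v * w * (x * q ^ 2)) / (u * q) := by
    field_simp; ring
  have a5 : 1 - -(v / (u * w)) * q / Q * x =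
      (u * w * Q * q + v * (x * q ^ 2)) / (u * w * Q * q) := by
    field_simp; ring
  have a6 : q ^ 2 - v ^ 2 * (x * q ^ 2) ^ 2 = q ^ 2 * (1 - v ^ 2 * x ^ 2 * q ^ 2) := by ring
  have a7 : 1 - v ^ 2 * (q ^ 2 * Q) * x = 1 - v ^ 2 * (x * q ^ 2) * Q := by ring
  have a8 : 1 - q ^ 2 * x = 1 - x * q ^ 2 := by ring
  rw [a1, a2, a3, a4, a5, a6, a7, a8]
  rw [a7] at n4
  rw [a8] at n1
  generalize hA : u * q + v * w * (x * q ^ 2) = A at *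
  generalize hB : u * w * Q * q + v * (x * q ^ 2) = B at *
  generalize hC : 1 - v ^ 2 * (x * q ^ 2) * Q = C at *
  generalize hD : 1 - x * q ^ 2 = D at *
  generalize hE : 1 - v ^ 2 * x ^ 2 * q ^ 2 = E at *
  generalize hF : 1 - v ^ 2 * x ^ 2 = F at *
  generalize hG : 1 - v ^ 2 * (x * q ^ 2) ^ 2 = G at *
  generalize hH : 1 + v * u * w * x * Q * q = H at *
  generalize hI : w + v * u * x * q = I at *
  generalize hJ : 1 - v ^ 2 = J at *
  field_simp

end weights

/-! ### Intertwining relations and orthogonality -/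

section orthogonality

open Matrix

variable {d : ℕ} {q r u v w : ℂ}

lemma tri_lower (p : Params d) {M N : Fin (d + 1)} (h : (M : ℕ) = N + 1) :
    p.tri M N = p.lower M := by
  simp [Params.tri, h]

lemma tri_upper (p : Params d) {M N : Fin (d + 1)} (h : (N : ℕ) = M + 1) :
    p.tri M N = p.upper N := by
  have : ¬ (M : ℕ) = N + 1 := by omega
  rw [Params.tri, if_neg this, if_pos h]

lemma tri_diag (p : Params d) (M : Fin (d + 1)) :
    p.tri M M = theta p.q p.bb p.cb 0 - p.upper (M + 1) - p.lower M := by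
  simp [Params.tri]

lemma tri_far (p : Params d) {M N : Fin (d + 1)} (h1 : (M : ℕ) ≠ N + 1) (h2 : (N : ℕ) ≠ M + 1)
    (h3 : M ≠ N) : p.tri M N = 0 := by
  rw [Params.tri, if_neg h1, if_neg h2, if_neg h3]

lemma swap_lower (h : Nondeg d q r u v w) {M : ℕ} (hM : M ≤ d) :
    (ofBeta d q r u v w).swap.lower M = lowF q r (q ^ (2 * d)) v u w (q ^ (2 * M)) := by
  rw [swap_ofBeta h, lower_ofBeta h.swap hM, lowF_swap _ (h.x_ne d) h.w_ne]

lemma swap_upper (h : Nondeg d q r u v w) {M : ℕ} (hM : M ≤ d) :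
    (ofBeta d q r u v w).swap.upper (M + 1) = upF q r (q ^ (2 * d)) v u w (q ^ (2 * M)) := by
  rw [swap_ofBeta h, upper_ofBeta h.swap hM, upF_swap _ (h.x_ne d) h.w_ne]

lemma swap_swap (h : Nondeg d q r u v w) :
    (ofBeta d q r u v w).swap.swap = ofBeta d q r u v w := by
  have hw := h.w_ne
  have hQ := h.x_ne d
  rw [swap_ofBeta h, swap_ofBeta h.swap]
  congr 1
  field_simp

lemma tri_irred (h : Nondeg d q r u v w) : IsIrredTridiagonal (ofBeta d q r u v w).tri := by
  refine ⟨fun i j hij => tri_far _ (by omega) (by omega) (by rintro rfl; omega),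
    fun i j hij => ?_⟩
  have hi := i.isLt
  have hj := j.isLt
  rcases hij with hij | hij
  · rw [tri_upper _ hij.symm, ← hij, upper_ofBeta h (by omega)]
    exact upF_ne h (by omega)
  · rw [tri_lower _ hij.symm, lower_ofBeta h (by omega)]
    exact lowF_ne h (by omega) (by omega)

lemma swap_tri_irred (h : Nondeg d q r u v w) :
    IsIrredTridiagonal (ofBeta d q r u v w).swap.tri := by
  rw [swap_ofBeta h]
  exact tri_irred h.swap

/-- The diagonal matrix of the weights. -/
def weightMat (p : Params d) : Matrix (Fin (d + 1)) (Fin (d + 1)) ℂ :=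
  diagonal fun N => p.weight N

lemma trans_eq (p : Params d) : p.trans = racahMat p * weightMat p := by
  ext M N
  rw [weightMat, mul_diagonal, mul_comm]
  rfl

lemma transInv_eq (p : Params d) :
    p.transInv = p.nu⁻¹ • ((racahMat p)ᵀ * weightMat p.swap) := by
  ext N M
  rw [Matrix.smul_apply, weightMat, mul_diagonal, smul_eq_mul, transpose_apply, mul_comm _ (p.swap.weight M),
    ← mul_assoc]
  rfl

lemma weightMat_mul_swap_tri (h : Nondeg d q r u v w) :
    weightMat (ofBeta d q r u v w) * (ofBeta d q r u v w).swap.tri =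
      (ofBeta d q r u v w).swap.triᵀ * weightMat (ofBeta d q r u v w) := by
  ext M N
  rw [weightMat, diagonal_mul, mul_diagonal, transpose_apply]
  have hM := M.isLt
  have hN := N.isLt
  by_cases h1 : (M : ℕ) = N + 1
  · have := weight_succ h (N := N) (by omega)
    rw [tri_lower _ h1, tri_upper _ h1, h1, swap_lower h (by omega), swap_upper h (by omega),
      ← this, mul_comm]
  by_cases h2 : (N : ℕ) = M + 1
  · have := weight_succ h (N := M) (by omega)
    rw [tri_lower _ h2, tri_upper _ h2, h2, swap_lower h (by omega), swap_upper h (by omega),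
      this, mul_comm]
  by_cases h3 : M = N
  · rw [h3, mul_comm]
  · rw [tri_far _ h1 h2 h3, tri_far _ h2 h1 (Ne.symm h3)]
    ring

lemma weightMat_swap_mul_tri (h : Nondeg d q r u v w) :
    weightMat (ofBeta d q r u v w).swap * (ofBeta d q r u v w).tri =
      (ofBeta d q r u v w).triᵀ * weightMat (ofBeta d q r u v w).swap := by
  have := weightMat_mul_swap_tri h.swap
  rwa [← swap_ofBeta h, swap_swap h] at this

lemma swap_tri_mul_racahMat_transpose (h : Nondeg d q r u v w) :
    (ofBeta d q r u v w).swap.tri * (racahMat (ofBeta d q r u v w))ᵀ =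
      (racahMat (ofBeta d q r u v w))ᵀ * thetaMat d q (u / r) (u⁻¹ / r) := by
  have := tri_mul_racahMat h.swap
  rwa [← swap_ofBeta h, racahMat_swap h] at this

lemma thetaMat_transpose (b c : ℂ) : (thetaMat d q b c)ᵀ = thetaMat d q b c := by
  simp [thetaMat]

lemma thetaMat_mul_racahMat (h : Nondeg d q r u v w) :
    thetaMat d q (u / r) (u⁻¹ / r) * racahMat (ofBeta d q r u v w) =
      racahMat (ofBeta d q r u v w) * (ofBeta d q r u v w).swap.triᵀ := by
  have := congrArg transpose (swap_tri_mul_racahMat_transpose h)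
  rw [transpose_mul, transpose_mul, transpose_transpose, thetaMat_transpose] at this
  exact this.symm

lemma weightMat_commute (p : Params d) (b c : ℂ) :
    weightMat p * thetaMat d q b c = thetaMat d q b c * weightMat p := by
  simp only [weightMat, thetaMat, diagonal_mul_diagonal]
  congr 1
  ext i
  ring

lemma tri_mul_trans (h : Nondeg d q r u v w) :
    (ofBeta d q r u v w).tri * (ofBeta d q r u v w).trans =
      (ofBeta d q r u v w).trans * thetaMat d q (v / r) (v⁻¹ / r) := by
  rw [trans_eq, ← mul_assoc, tri_mul_racahMat h, mul_assoc, mul_assoc, weightMat_commute]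

lemma thetaMat_mul_trans (h : Nondeg d q r u v w) :
    thetaMat d q (u / r) (u⁻¹ / r) * (ofBeta d q r u v w).trans =
      (ofBeta d q r u v w).trans * (ofBeta d q r u v w).swap.tri := by
  rw [trans_eq, ← mul_assoc, thetaMat_mul_racahMat h, mul_assoc, mul_assoc,
    weightMat_mul_swap_tri h]

lemma theta_injective (h : Nondeg d q r u v w) {M N : ℕ} (hM : M ≤ d) (hN : N ≤ d)
    (he : theta q (u / r) (u⁻¹ / r) M = theta q (u / r) (u⁻¹ / r) N) : M = N := by
  by_contra hMN
  have hu := h.u_ne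
  have hr := h.r_ne
  have hx := h.x_ne M
  have hy := h.x_ne N
  rw [theta_ofBeta, theta_ofBeta] at he
  have h1 := sub_ne_zero.2 (h.pow_sub_ne hMN)
  have h2 : u ^ 2 * (q ^ (2 * M) * q ^ (2 * N)) - 1 ≠ 0 := by
    rw [sub_ne_zero, ← pow_add, ← mul_add]
    exact h.u_sq (M + N) (by omega)
  apply mul_ne_zero h1 h2
  generalize q ^ (2 * M) = x at *
  generalize q ^ (2 * N) = y at *
  field_simp at he
  linear_combination he

/-- Commuting with a diagonal matrix of simple spectrum forces `E` to be diagonal; the nonzero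
superdiagonal of `S` then makes neighbouring diagonal entries equal. -/
lemma eq_smul_one_of_commute {θ : Fin (d + 1) → ℂ} (hθ : Function.Injective θ)
    {E S : Matrix (Fin (d + 1)) (Fin (d + 1)) ℂ} (hS : IsIrredTridiagonal S)
    (h1 : diagonal θ * E = E * diagonal θ) (h2 : S * E = E * S) : ∃ c : ℂ, E = c • 1 := by
  have hdiag : ∀ i j, i ≠ j → E i j = 0 := by
    intro i j hij
    have := congrFun (congrFun h1 i) j
    rw [diagonal_mul, mul_diagonal] at this
    have h3 : (θ i - θ j) * E i j = 0 := by linear_combination this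
    exact (mul_eq_zero.1 h3).resolve_left (sub_ne_zero.2 fun h => hij (hθ h))
  have hE : E = diagonal fun i => E i i := by
    ext i j
    by_cases hij : i = j
    · rw [hij, diagonal_apply_eq]
    · rw [diagonal_apply_ne _ hij, hdiag i j hij]
  have hstep : ∀ i j : Fin (d + 1), (i : ℕ) + 1 = j → E j j = E i i := by
    intro i j hij
    have h3 := congrFun (congrFun h2 i) j
    have e1 : (S * E) i j = S i j * E j j := by conv_lhs => rw [hE, mul_diagonal]
    have e2 : (E * S) i j = E i i * S i j := by conv_lhs => rw [hE, diagonal_mul]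
    have h4 := hS.2 i j (Or.inl hij)
    apply mul_right_cancel₀ h4
    rw [← e2, ← h3, e1, mul_comm]
  have hall : ∀ n (hn : n < d + 1), E ⟨n, hn⟩ ⟨n, hn⟩ = E 0 0 := by
    intro n
    induction n with
    | zero => intro _; rfl
    | succ n ih => intro hn; rw [hstep ⟨n, by omega⟩ ⟨n + 1, hn⟩ rfl, ih]
  refine ⟨E 0 0, ?_⟩
  ext i j
  by_cases hij : i = j
  · subst hij
    rw [Matrix.smul_apply, one_apply_eq, smul_eq_mul, mul_one]
    exact hall i i.isLt
  · rw [Matrix.smul_apply, one_apply_ne hij, hdiag i j hij, smul_zero]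

/-- Moving `Θ_b` or `S` through the three factors uses one intertwining relation per factor. -/
lemma exists_gram (h : Nondeg d q r u v w) : ∃ c : ℂ,
    (racahMat (ofBeta d q r u v w))ᵀ * weightMat (ofBeta d q r u v w).swap *
      (ofBeta d q r u v w).trans = c • 1 := by
  have hθ : Function.Injective fun M : Fin (d + 1) => theta q (v / r) (v⁻¹ / r) M :=
    fun M N he => Fin.ext (theta_injective h.rot (Nat.lt_succ_iff.1 M.isLt)
      (Nat.lt_succ_iff.1 N.isLt) he)
  refine eq_smul_one_of_commute hθ (swap_tri_irred h) ?_ ?_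
  · have e : thetaMat d q (v / r) (v⁻¹ / r) * (racahMat (ofBeta d q r u v w))ᵀ = (racahMat (ofBeta d q r u v w))ᵀ * (ofBeta d q r u v w).triᵀ := by
      have := congrArg transpose (tri_mul_racahMat h)
      rw [transpose_mul, transpose_mul, thetaMat_transpose] at this
      exact this.symm
    change thetaMat d q (v / r) (v⁻¹ / r) * _ = _ * thetaMat d q (v / r) (v⁻¹ / r)
    rw [← mul_assoc, ← mul_assoc, e, mul_assoc (racahMat (ofBeta d q r u v w))ᵀ, ← weightMat_swap_mul_tri h,
      mul_assoc, mul_assoc, mul_assoc, tri_mul_trans h, mul_assoc]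
  · rw [← mul_assoc, ← mul_assoc, swap_tri_mul_racahMat_transpose h, mul_assoc (racahMat (ofBeta d q r u v w))ᵀ,
      ← weightMat_commute, mul_assoc, mul_assoc, thetaMat_mul_trans h, mul_assoc, mul_assoc]

/-- The vectors `∏_{h=1}^{j} (S - θ_h) e_0`. -/
def krylov (S : Matrix (Fin (d + 1)) (Fin (d + 1)) ℂ) (θ : ℕ → ℂ) : ℕ → Fin (d + 1) → ℂ
  | 0 => Pi.single 0 1
  | j + 1 => S *ᵥ krylov S θ j - θ (j + 1) • krylov S θ j

/-- Each application of `S` reaches at most one index further, and the leading entry picks up one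
subdiagonal entry; the shifts by `θ` do not affect it. -/
lemma krylov_spec {S : Matrix (Fin (d + 1)) (Fin (d + 1)) ℂ} (hS : IsIrredTridiagonal S)
    (θ l : ℕ → ℂ) (hl : ∀ M N : Fin (d + 1), (M : ℕ) = N + 1 → S M N = l M) (j : ℕ) (hj : j ≤ d) :
    (∀ N : Fin (d + 1), j < (N : ℕ) → krylov S θ j N = 0) ∧
      ∀ N : Fin (d + 1), (N : ℕ) = j → krylov S θ j N = ∏ k ∈ Finset.range j, l (k + 1) := by
  induction j with
  | zero =>
    refine ⟨fun N hN => ?_, fun N hN => ?_⟩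
    · have : N ≠ 0 := by rintro rfl; simp at hN
      simp [krylov, this]
    · have : N = 0 := Fin.ext (by simpa using hN)
      simp [krylov, this]
  | succ j ih =>
    obtain ⟨ih1, ih2⟩ := ih (by omega)
    refine ⟨fun N hN => ?_, fun N hN => ?_⟩
    · simp only [krylov, Pi.sub_apply, Pi.smul_apply, ih1 N (by omega), smul_zero, sub_zero]
      rw [mulVec, dotProduct]
      refine Finset.sum_eq_zero fun L _ => ?_
      by_cases hL : j < (L : ℕ)
      · rw [ih1 L hL, mul_zero]
      · rw [hS.1 N L (Or.inr (by omega)), zero_mul]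
    · simp only [krylov, Pi.sub_apply, Pi.smul_apply, ih1 N (by omega), smul_zero, sub_zero]
      have hjd : j < d + 1 := by omega
      rw [mulVec, dotProduct, Finset.sum_eq_single (⟨j, hjd⟩ : Fin (d + 1))]
      · rw [ih2 ⟨j, hjd⟩ rfl, hl N ⟨j, hjd⟩ hN, Finset.prod_range_succ, hN, mul_comm]
      · intro L _ hL
        have hL' : (L : ℕ) ≠ j := fun h => hL (Fin.ext h)
        by_cases hLj : j < (L : ℕ)
        · rw [ih1 L hLj, mul_zero]
        · rw [hS.1 N L (Or.inr (by omega)), zero_mul]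
      · intro hn
        exact absurd (Finset.mem_univ _) hn

lemma racah_zero_left (p : Params d) (N : ℕ) : p.racah 0 N = 1 := by
  simp [Params.racah, phi43, qPoch_zero]

lemma racah_zero_right (h : Nondeg d q r u v w) {M : ℕ} (hM : M ≤ d) :
    (ofBeta d q r u v w).racah M 0 = 1 := by
  rw [racah_ofBeta h hM, ← racahSum_swap h, ← racah_ofBeta h.swap (Nat.zero_le d)]
  exact racah_zero_left _ _

/-- The intertwining `Θ_a P = P S` converts polynomials in `S` into polynomials in `Θ_a`, and the
zeroth column of `P` consists of ones. -/
lemma trans_mulVec_krylov (h : Nondeg d q r u v w) (j : ℕ) (M : Fin (d + 1)) :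
    ((ofBeta d q r u v w).trans *ᵥ krylov (ofBeta d q r u v w).swap.tri
      (theta q (u / r) (u⁻¹ / r)) j) M =
      ∏ k ∈ Finset.range j,
        (theta q (u / r) (u⁻¹ / r) M - theta q (u / r) (u⁻¹ / r) (k + 1)) := by
  induction j generalizing M with
  | zero =>
    simp only [krylov, mulVec_single_one, Finset.range_zero, Finset.prod_empty]
    change (ofBeta d q r u v w).weight 0 * (ofBeta d q r u v w).racah M 0 = 1
    rw [weight_zero h, racah_zero_right h (Nat.lt_succ_iff.1 M.isLt), one_mul]
  | succ j ih =>
    rw [krylov, mulVec_sub, mulVec_mulVec, ← thetaMat_mul_trans h, ← mulVec_mulVec, mulVec_smul,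
      Pi.sub_apply, Pi.smul_apply, thetaMat, mulVec_diagonal, ih, Finset.prod_range_succ,
      smul_eq_mul]
    ring

/-- Evaluate the scalar matrix on the vector `∏_{h=1}^{d} (S - θ_h) e_0` and compare last entries.
Its last entry is the product of the subdiagonal of `S`, while its image under `P` is supported at
index `0`, where the remaining factors are `1`. Thus no summation formula is needed. -/
lemma gram_constant (h : Nondeg d q r u v w) {c : ℂ}
    (hc : (racahMat (ofBeta d q r u v w))ᵀ * weightMat (ofBeta d q r u v w).swap *
      (ofBeta d q r u v w).trans = c • 1) :
    c * ∏ k ∈ Finset.range d, lowF q r (q ^ (2 * d)) v u w (q ^ (2 * (k + 1))) =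
      ∏ k ∈ Finset.range d,
        (theta q (u / r) (u⁻¹ / r) 0 - theta q (u / r) (u⁻¹ / r) (k + 1)) := by
  set p := ofBeta d q r u v w with hp
  set s := krylov p.swap.tri (theta q (u / r) (u⁻¹ / r)) d with hs
  have h1 : (((racahMat p)ᵀ * weightMat p.swap * p.trans) *ᵥ s) (Fin.last d) =
      c * s (Fin.last d) := by
    rw [hc, smul_mulVec, one_mulVec]
    rfl
  have h2 := (krylov_spec (swap_tri_irred h) (theta q (u / r) (u⁻¹ / r)) p.swap.lower
    (fun M N hMN => tri_lower _ hMN) d le_rfl).2 (Fin.last d) rfl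
  rw [← hs] at h2
  have h3 : ∏ k ∈ Finset.range d, p.swap.lower (k + 1) =
      ∏ k ∈ Finset.range d, lowF q r (q ^ (2 * d)) v u w (q ^ (2 * (k + 1))) :=
    Finset.prod_congr rfl fun k hk =>
      swap_lower h (Nat.succ_le_of_lt (Finset.mem_range.1 hk))
  rw [h2, h3] at h1
  rw [← h1, ← mulVec_mulVec, mulVec, dotProduct, Finset.sum_eq_single (0 : Fin (d + 1))]
  · rw [trans_mulVec_krylov h, weightMat, mul_diagonal, transpose_apply]
    have e1 : racahMat p 0 (Fin.last d) = 1 := racah_zero_left p _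
    have e2 : p.swap.weight ((0 : Fin (d + 1)) : ℕ) = 1 := by
      rw [hp, swap_ofBeta h]
      exact weight_zero h.swap
    rw [e1, e2]
    simp
  · intro M _ hM
    rw [trans_mulVec_krylov h, Finset.prod_eq_zero (i := (M : ℕ) - 1), mul_zero]
    · have := M.isLt
      have h0 : (M : ℕ) ≠ 0 := fun h => hM (Fin.ext h)
      rw [Finset.mem_range]
      omega
    · have h0 : (M : ℕ) ≠ 0 := fun h => hM (Fin.ext h)
      rw [Nat.sub_add_cancel (Nat.pos_of_ne_zero h0), sub_self]
  · intro hn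
    exact absurd (Finset.mem_univ _) hn

end orthogonality

/-! ### Evaluation of the normalization constant -/

section normalization

open Matrix

variable {d : ℕ} {q r u v w : ℂ}

lemma one_add_u_ne (h : Nondeg d q r u v w) {k : ℕ} (hk : k < d) :
    1 + u / (v * w) * q / q ^ (2 * d) * q ^ (2 * k) ≠ 0 := by
  have := one_add_v_ne h.rot.rot hk
  rwa [mul_comm w v] at this

lemma nu_ofBeta (h : Nondeg d q r u v w) : (ofBeta d q r u v w).nu =
    ((∏ k ∈ Finset.range d, (1 - u ^ 2 * q ^ 2 * q ^ (2 * k))) *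
      ∏ k ∈ Finset.range d, (1 - v ^ 2 * q ^ 2 * q ^ (2 * k))) /
    ((∏ _k ∈ Finset.range d, (-(u * v * w) * q * q ^ (2 * d))) *
      (∏ k ∈ Finset.range d, (1 + u / (v * w) * q / q ^ (2 * d) * q ^ (2 * k))) *
      ∏ k ∈ Finset.range d, (1 + v / (u * w) * q / q ^ (2 * d) * q ^ (2 * k))) := by
  have hq := h.q_ne
  have hu := h.u_ne
  have hv := h.v_ne
  have hw := h.w_ne
  have hr := h.r_ne
  have e1 : -(u / r * (w⁻¹ / r) / (v / r)) * r * q ^ (1 - 2 * (d : ℤ)) =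
      -(u / (v * w) * q / q ^ (2 * d)) := by
    rw [zpow_sub₀ hq, zpow_two_mul_natCast, zpow_one]
    field_simp
  have e2 : -(v / r * (w / r) / (u⁻¹ / r)) * r * q ^ (2 * (d : ℤ) + 1) =
      -(u * v * w) * q * q ^ (2 * d) := by
    rw [zpow_add₀ hq, zpow_two_mul_natCast, zpow_one]
    field_simp
  have e4 : -(u⁻¹ / r * (w⁻¹ / r) / (v⁻¹ / r)) * r * q ^ (1 - 2 * (d : ℤ)) =
      -(v / (u * w) * q / q ^ (2 * d)) := by
    rw [zpow_sub₀ hq, zpow_two_mul_natCast, zpow_one]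
    field_simp
  have e' : ∀ k : ℕ, (q ^ 2) ^ k = q ^ (2 * k) := fun k => (pow_mul q 2 k).symm
  simp only [Params.nu, ofBeta, e1, e2, e4, ratio_sq hr hu, ratio_sq hr hv, qPoch, e']
  simp only [Finset.prod_const, Finset.card_range, neg_mul, sub_neg_eq_add]

lemma prod_double_range (f : ℕ → ℂ) (d : ℕ) :
    ∏ k ∈ Finset.range d, (f (2 * k) * f (2 * k + 1)) =
      (∏ k ∈ Finset.range d, f k) * ∏ k ∈ Finset.range d, f (d + k) := by
  rw [← Finset.prod_range_add, ← two_mul]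
  induction d with
  | zero => simp
  | succ d ih => rw [Finset.prod_range_succ, ih, show 2 * (d + 1) = 2 * d + 1 + 1 by ring,
      Finset.prod_range_succ, Finset.prod_range_succ, mul_assoc]

lemma theta_zero_sub (h : Nondeg d q r u v w) (k : ℕ) :
    theta q (u / r) (u⁻¹ / r) 0 - theta q (u / r) (u⁻¹ / r) (k + 1) =
      -(1 / (r * u * q ^ (2 * (k + 1)))) * (1 - q ^ (2 * (k + 1))) *
        (1 - u ^ 2 * q ^ 2 * q ^ (2 * k)) := by
  have hu := h.u_ne
  have hr := h.r_ne
  have hx := h.x_ne (k + 1)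
  rw [theta_ofBeta, theta_ofBeta, mul_zero, pow_zero]
  have e : u ^ 2 * q ^ 2 * q ^ (2 * k) = u ^ 2 * q ^ (2 * (k + 1)) := by ring
  rw [e]
  generalize q ^ (2 * (k + 1)) = x at *
  field_simp
  ring

lemma nu_ne_zero (h : Nondeg d q r u v w) : (ofBeta d q r u v w).nu ≠ 0 := by
  rw [nu_ofBeta h]
  have hs : ∀ a : ℂ, (∀ M ≤ 2 * d, a ^ 2 * q ^ (2 * M) ≠ 1) →
      ∏ k ∈ Finset.range d, (1 - a ^ 2 * q ^ 2 * q ^ (2 * k)) ≠ 0 := by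
    intro a ha
    refine Finset.prod_ne_zero_iff.2 fun k hk => ?_
    have := ha (k + 1) (by have := Finset.mem_range.1 hk; omega)
    rw [sub_ne_zero]
    convert this.symm using 1
    ring
  refine div_ne_zero (mul_ne_zero (hs u h.u_sq) (hs v h.v_sq))
    (mul_ne_zero (mul_ne_zero ?_ ?_) ?_) <;> refine Finset.prod_ne_zero_iff.2 fun k hk => ?_
  · exact mul_ne_zero (mul_ne_zero (neg_ne_zero.2 (mul_ne_zero (mul_ne_zero h.u_ne h.v_ne) h.w_ne))
      h.q_ne) (h.x_ne d)
  · exact one_add_u_ne h (Finset.mem_range.1 hk)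
  · exact one_add_v_ne h (Finset.mem_range.1 hk)

lemma nu_mul_prod_lowF (h : Nondeg d q r u v w) :
    (ofBeta d q r u v w).nu *
      ∏ k ∈ Finset.range d, lowF q r (q ^ (2 * d)) v u w (q ^ (2 * (k + 1))) =
    ∏ k ∈ Finset.range d,
      (theta q (u / r) (u⁻¹ / r) 0 - theta q (u / r) (u⁻¹ / r) (k + 1)) := by
  have hq := h.q_ne
  have hu := h.u_ne
  have hv := h.v_ne
  have hw := h.w_ne
  have hr := h.r_ne
  have hQ := h.x_ne d
  set Q := q ^ (2 * d) with hQdef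
  -- The two denominators of `lowF` at `x = q^{2(k+1)}` are, up to `q²`, consecutive members of the
  -- sequence `1 - v² q² q^{2m}`, namely `m = 2k` and `m = 2k + 1`. Multiplying over `k` gives all
  -- `m < 2d`; the upper half cancels against the numerators and the lower half belongs to `ν₀`.
  have hterm : ∀ k ∈ Finset.range d, lowF q r Q v u w (q ^ (2 * (k + 1))) *
      ((1 - v ^ 2 * q ^ 2 * q ^ (2 * (2 * k))) * (1 - v ^ 2 * q ^ 2 * q ^ (2 * (2 * k + 1)))) =
      (1 - q ^ (2 * (k + 1))) * (1 - v ^ 2 * q ^ 2 * q ^ (2 * (d + k))) *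
        (1 + v / (u * w) * q / Q * q ^ (2 * k)) * (1 + u / (v * w) / (q ^ (2 * k) * q)) *
        (v * w / r) * (q ^ (2 * (k + 1)) / q) := by
    intro k hk
    have hk' := Finset.mem_range.1 hk
    have d1 := h.rot.sq_sub_ne (Nat.succ_le_of_lt hk') (Nat.succ_pos k)
    have d2 := h.rot.one_sub_ne (Nat.succ_le_of_lt hk')
    have hy := h.x_ne k
    rw [Nat.succ_eq_add_one] at d1 d2
    have e1 : q ^ (2 * (k + 1)) = q ^ (2 * k) * q ^ 2 := by ring
    have e2 : q ^ (2 * (2 * k)) = (q ^ (2 * k)) ^ 2 := by ring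
    have e3 : q ^ (2 * (2 * k + 1)) = (q ^ (2 * k)) ^ 2 * q ^ 2 := by ring
    have e4 : q ^ (2 * (d + k)) = Q * q ^ (2 * k) := by rw [hQdef]; ring
    rw [e1] at d1 d2
    rw [e1, e2, e3, e4]
    unfold lowF
    generalize q ^ (2 * k) = y at *
    have a1 : 1 - v ^ 2 * q ^ 2 * y ^ 2 = (q ^ 2 - v ^ 2 * (y * q ^ 2) ^ 2) / q ^ 2 := by
      field_simp
    have a2 : 1 - v ^ 2 * q ^ 2 * (y ^ 2 * q ^ 2) = 1 - v ^ 2 * (y * q ^ 2) ^ 2 := by ring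
    rw [a1, a2]
    generalize hA : q ^ 2 - v ^ 2 * (y * q ^ 2) ^ 2 = A at *
    generalize hB : 1 - v ^ 2 * (y * q ^ 2) ^ 2 = B at *
    field_simp
    ring
  have hprod := Finset.prod_congr rfl hterm
  simp only [Finset.prod_mul_distrib (s := Finset.range d)] at hprod
  have hdouble := prod_double_range (fun k => 1 - v ^ 2 * q ^ 2 * q ^ (2 * k)) d
  simp only [Finset.prod_mul_distrib] at hdouble
  -- This and the next identity reverse the order of the factors, `k ↦ d - 1 - k`.
  have hC : ∏ k ∈ Finset.range d, (1 + u / (v * w) / (q ^ (2 * k) * q)) =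
      ∏ k ∈ Finset.range d, (1 + u / (v * w) * q / Q * q ^ (2 * k)) := by
    rw [← Finset.prod_range_reflect]
    refine Finset.prod_congr rfl fun k hk => ?_
    have hk' := Finset.mem_range.1 hk
    have e := pow_even_split q hk'
    have e2 : q ^ (2 * k + 1) = q ^ (2 * k) * q := pow_succ _ _
    have e3 : q ^ (2 * (d - 1 - k) + 1) = q ^ (2 * (d - 1 - k)) * q := pow_succ _ _
    rw [hQdef, e, e2, e3]
    have hy := h.x_ne k
    have hz := h.x_ne (d - 1 - k)
    congr 1
    field_simp
  have hX : ∏ k ∈ Finset.range d, (q ^ (2 * (k + 1)) / q) =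
      ∏ k ∈ Finset.range d, (q * Q / q ^ (2 * (k + 1))) := by
    rw [← Finset.prod_range_reflect]
    refine Finset.prod_congr rfl fun k hk => ?_
    have hk' := Finset.mem_range.1 hk
    have hy := h.x_ne (k + 1)
    rw [div_eq_div_iff hq hy, hQdef, ← pow_add]
    have : q * q ^ (2 * d) * q = q ^ (2 * d + 2) := by ring
    rw [this]
    congr 1
    omega
  have hJ : ∏ k ∈ Finset.range d, (1 - v ^ 2 * q ^ 2 * q ^ (2 * (d + k))) ≠ 0 := by
    refine Finset.prod_ne_zero_iff.2 fun k hk => ?_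
    have := h.v_sq (d + k + 1) (by have := Finset.mem_range.1 hk; omega)
    rw [sub_ne_zero]
    convert this.symm using 1
    ring
  have hθ : (∏ k ∈ Finset.range d,
      (theta q (u / r) (u⁻¹ / r) 0 - theta q (u / r) (u⁻¹ / r) (k + 1))) *
      ∏ _k ∈ Finset.range d, (-(u * v * w) * q * Q) =
      (∏ _k ∈ Finset.range d, v * w / r) * (∏ k ∈ Finset.range d, (q * Q / q ^ (2 * (k + 1)))) *
      (∏ k ∈ Finset.range d, (1 - q ^ (2 * (k + 1)))) *
      ∏ k ∈ Finset.range d, (1 - u ^ 2 * q ^ 2 * q ^ (2 * k)) := by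
    rw [← Finset.prod_mul_distrib, ← Finset.prod_mul_distrib, ← Finset.prod_mul_distrib,
      ← Finset.prod_mul_distrib]
    refine Finset.prod_congr rfl fun k _ => ?_
    have hy := h.x_ne (k + 1)
    rw [theta_zero_sub h]
    field_simp
  have hden := nu_ne_zero h
  rw [nu_ofBeta h] at hden ⊢
  rw [← hQdef] at hden ⊢
  rw [hdouble] at hprod
  have hlow : (∏ k ∈ Finset.range d, lowF q r Q v u w (q ^ (2 * (k + 1)))) *
      ∏ k ∈ Finset.range d, (1 - v ^ 2 * q ^ 2 * q ^ (2 * k)) =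
      (∏ k ∈ Finset.range d, (1 - q ^ (2 * (k + 1)))) *
      (∏ k ∈ Finset.range d, (1 + v / (u * w) * q / Q * q ^ (2 * k))) *
      (∏ k ∈ Finset.range d, (1 + u / (v * w) * q / Q * q ^ (2 * k))) *
      (∏ _k ∈ Finset.range d, v * w / r) *
      ∏ k ∈ Finset.range d, (q * Q / q ^ (2 * (k + 1))) := by
    apply mul_right_cancel₀ hJ
    rw [mul_assoc, hprod, hC, hX]
    ring
  have hne := (div_ne_zero_iff.1 hden).2
  rw [div_mul_eq_mul_div, div_eq_iff hne]
  linear_combination (∏ k ∈ Finset.range d, (1 - u ^ 2 * q ^ 2 * q ^ (2 * k))) * hlow -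
    (∏ k ∈ Finset.range d, (1 + v / (u * w) * q / Q * q ^ (2 * k))) *
      (∏ k ∈ Finset.range d, (1 + u / (v * w) * q / Q * q ^ (2 * k))) * hθ

lemma transInv_mul_trans (h : Nondeg d q r u v w) :
    (ofBeta d q r u v w).transInv * (ofBeta d q r u v w).trans = 1 := by
  obtain ⟨c, hc⟩ := exists_gram h
  have h1 := gram_constant h hc
  rw [← nu_mul_prod_lowF h] at h1
  have h2 : ∏ k ∈ Finset.range d, lowF q r (q ^ (2 * d)) v u w (q ^ (2 * (k + 1))) ≠ 0 := by
    refine Finset.prod_ne_zero_iff.2 fun k hk => ?_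
    have := lowF_ne h.swap (Nat.succ_pos k) (Nat.succ_le_of_lt (Finset.mem_range.1 hk))
    rwa [lowF_swap _ (h.x_ne d) h.w_ne] at this
  have h3 := mul_right_cancel₀ h2 h1
  rw [transInv_eq, smul_mul, hc, h3, smul_smul, inv_mul_cancel₀ (nu_ne_zero h), one_smul]

lemma trans_mul_transInv (h : Nondeg d q r u v w) :
    (ofBeta d q r u v w).trans * (ofBeta d q r u v w).transInv = 1 :=
  mul_eq_one_comm.1 (transInv_mul_trans h)

end normalization

/-! ### The third map in an eigenbasis of the second -/

section commutator

open Matrix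

variable {d : ℕ} {q r u v w : ℂ}

/-- Here `s = q^d`, which enters through `ω`. The versions for the first and last rows drop the
coefficient whose denominator may vanish there, and with it one hypothesis. -/
lemma commutator_diag_generic (Q s x : ℂ) (hq : q ≠ 0) (hr : r ≠ 0) (hs : s ≠ 0)
    (hu : u ≠ 0) (hv : v ≠ 0) (hw : w ≠ 0) (hx : x ≠ 0) (hQ : Q = s ^ 2) (hk : q ^ 2 + 1 ≠ 0)
    (h1 : q ^ 2 - v ^ 2 * x ^ 2 ≠ 0) (h2 : 1 - v ^ 2 * x ^ 2 ≠ 0)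
    (h3 : 1 - v ^ 2 * x ^ 2 * q ^ 2 ≠ 0) :
    r / (q + q⁻¹) * (((v * x + v⁻¹ * x⁻¹) / r) *
      ((u + u⁻¹) / r - upF q r Q v u w x - lowF q r Q v u w x) -
      ((u * s + u⁻¹ * s⁻¹) / r * ((v * s + v⁻¹ * s⁻¹) / r) -
        1 / r * (s * q + s⁻¹ * q⁻¹) * ((w * s + w⁻¹ * s⁻¹) / r))) =
    (w + w⁻¹) / r - upF q r Q v w u x - lowF q r Q v w u x := by
  have h3' : 1 - q ^ 2 * v ^ 2 * x ^ 2 ≠ 0 := by convert h3 using 1; ring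
  have h4 : q + q⁻¹ = (q ^ 2 + 1) / q := by field_simp
  rw [h4]
  unfold lowF upF
  subst hQ
  field_simp
  ring

lemma commutator_diag_first (Q s : ℂ) (hq : q ≠ 0) (hr : r ≠ 0) (hs : s ≠ 0)
    (hu : u ≠ 0) (hv : v ≠ 0) (hw : w ≠ 0) (hQ : Q = s ^ 2) (hk : q ^ 2 + 1 ≠ 0)
    (h2 : 1 - v ^ 2 ≠ 0) (h3 : 1 - v ^ 2 * q ^ 2 ≠ 0) :
    r / (q + q⁻¹) * (((v + v⁻¹) / r) * ((u + u⁻¹) / r - upF q r Q v u w 1) -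
      ((u * s + u⁻¹ * s⁻¹) / r * ((v * s + v⁻¹ * s⁻¹) / r) -
        1 / r * (s * q + s⁻¹ * q⁻¹) * ((w * s + w⁻¹ * s⁻¹) / r))) =
    (w + w⁻¹) / r - upF q r Q v w u 1 := by
  have h3' : 1 - q ^ 2 * v ^ 2 ≠ 0 := by convert h3 using 1; ring
  have h4 : q + q⁻¹ = (q ^ 2 + 1) / q := by field_simp
  rw [h4]
  unfold upF
  simp only [one_pow, mul_one]
  subst hQ
  field_simp
  ring

lemma commutator_diag_last (s : ℂ) (hq : q ≠ 0) (hr : r ≠ 0) (hs : s ≠ 0)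
    (hu : u ≠ 0) (hv : v ≠ 0) (hw : w ≠ 0) (hk : q ^ 2 + 1 ≠ 0)
    (h1 : q ^ 2 - v ^ 2 * (s ^ 2) ^ 2 ≠ 0) (h2 : 1 - v ^ 2 * (s ^ 2) ^ 2 ≠ 0) :
    r / (q + q⁻¹) * (((v * s ^ 2 + v⁻¹ * (s ^ 2)⁻¹) / r) *
      ((u + u⁻¹) / r - lowF q r (s ^ 2) v u w (s ^ 2)) -
      ((u * s + u⁻¹ * s⁻¹) / r * ((v * s + v⁻¹ * s⁻¹) / r) -
        1 / r * (s * q + s⁻¹ * q⁻¹) * ((w * s + w⁻¹ * s⁻¹) / r))) =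
    (w + w⁻¹) / r - lowF q r (s ^ 2) v w u (s ^ 2) := by
  have h4 : q + q⁻¹ = (q ^ 2 + 1) / q := by field_simp
  have h1' : q ^ 2 - v ^ 2 * s ^ 4 ≠ 0 := by convert h1 using 1; ring
  have h2' : 1 - v ^ 2 * s ^ 4 ≠ 0 := by convert h2 using 1; ring
  rw [h4]
  unfold lowF
  field_simp
  ring

lemma Nondeg.sq_sub_one_ne (h : Nondeg d q r u v w) : q ^ 2 - 1 ≠ 0 :=
  sub_ne_zero.2 (h.q_pow 2 (by norm_num))

lemma Nondeg.sq_add_one_ne (h : Nondeg d q r u v w) : q ^ 2 + 1 ≠ 0 := by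
  intro he
  refine h.q_pow 4 (by norm_num) ?_
  linear_combination (q ^ 2 - 1) * he

lemma omega_ofBeta (hq : q ≠ 0) : (ofBeta d q r u v w).omega = -(q - q⁻¹) ^ 2 *
    ((u * q ^ d + u⁻¹ * (q ^ d)⁻¹) / r * ((v * q ^ d + v⁻¹ * (q ^ d)⁻¹) / r) -
      1 / r * (q ^ d * q + (q ^ d)⁻¹ * q⁻¹) * ((w * q ^ d + w⁻¹ * (q ^ d)⁻¹) / r)) := by
  have e1 : q ^ ((d : ℤ) + 1) = q ^ d * q := by rw [zpow_add₀ hq, zpow_natCast, zpow_one]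
  have e2 : q ^ (-(d : ℤ) - 1) = (q ^ d)⁻¹ * q⁻¹ := by
    rw [show -(d : ℤ) - 1 = -((d : ℤ) + 1) by ring, _root_.zpow_neg, e1, mul_inv]
  simp only [Params.omega, ofBeta, thetaMid_ofBeta, e1, e2]

lemma commutator_diag (h : Nondeg d q r u v w) {M : ℕ} (hM : M ≤ d) :
    let x := q ^ (2 * M)
    let Q := q ^ (2 * d)
    r / (q + q⁻¹) * (((v * x + v⁻¹ * x⁻¹) / r) *
      ((u + u⁻¹) / r - upF q r Q v u w x - lowF q r Q v u w x) +
      (ofBeta d q r u v w).omega / (q - q⁻¹) ^ 2) =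
    (w + w⁻¹) / r - upF q r Q v w u x - lowF q r Q v w u x := by
  intro x Q
  have hq := h.q_ne
  have hu := h.u_ne
  have hv := h.v_ne
  have hw := h.w_ne
  have hr := h.r_ne
  have hk := h.sq_add_one_ne
  have hk' := h.sq_sub_one_ne
  have hQ : Q = (q ^ d) ^ 2 := by simp only [Q]; ring
  have hs : q ^ d ≠ 0 := pow_ne_zero _ hq
  have hq1 : q - q⁻¹ ≠ 0 := by
    have : q - q⁻¹ = (q ^ 2 - 1) / q := by field_simp
    rw [this]
    exact div_ne_zero hk' hq
  have hom : (ofBeta d q r u v w).omega / (q - q⁻¹) ^ 2 =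
      -((u * q ^ d + u⁻¹ * (q ^ d)⁻¹) / r * ((v * q ^ d + v⁻¹ * (q ^ d)⁻¹) / r) -
      1 / r * (q ^ d * q + (q ^ d)⁻¹ * q⁻¹) * ((w * q ^ d + w⁻¹ * (q ^ d)⁻¹) / r)) := by
    rw [omega_ofBeta hq, div_eq_iff (pow_ne_zero 2 hq1)]
    ring
  rw [hom, ← sub_eq_add_neg]
  rcases Nat.eq_zero_or_pos M with rfl | h0
  · have hx1 : x = 1 := by simp [x]
    rw [hx1, lowF_one, lowF_one, sub_zero, sub_zero, inv_one, mul_one, mul_one]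
    rcases Nat.eq_zero_or_pos d with rfl | hd
    · have hQ1 : Q = 1 := by simp [Q]
      rw [hQ1, upF_self, upF_self]
      have h4 : q + q⁻¹ = (q ^ 2 + 1) / q := by field_simp
      simp only [pow_zero, inv_one, mul_one, one_mul, sub_zero]
      rw [h4]
      field_simp
      ring
    · exact commutator_diag_first Q (q ^ d) hq hr hs hu hv hw hQ hk
        (by simpa using h.rot.one_sub_ne (Nat.zero_le d)) (by simpa using h.rot.one_sub_succ_ne hd)
  have d1 : q ^ 2 - v ^ 2 * x ^ 2 ≠ 0 := h.rot.sq_sub_ne hM h0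
  have d2 : 1 - v ^ 2 * x ^ 2 ≠ 0 := h.rot.one_sub_ne hM
  rcases hM.eq_or_lt with hMd | hM'
  · have hxQ : x = Q := by simp only [Q, x, hMd]
    rw [hxQ, hQ] at d1 d2
    rw [hxQ, upF_self, upF_self, sub_zero, sub_zero, hQ]
    exact commutator_diag_last (q ^ d) hq hr hs hu hv hw hk d1 d2
  · exact commutator_diag_generic Q (q ^ d) x hq hr hs hu hv hw (h.x_ne M) hQ hk d1 d2
      (h.rot.one_sub_succ_ne hM')

lemma gFactor_zero (p : Params d) (g₀ : ℂ) : p.gFactor g₀ 0 = g₀ := by simp [Params.gFactor]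

lemma gFactor_succ (h : Nondeg d q r u v w) (g₀ : ℂ) (k : ℕ) :
    (ofBeta d q r u v w).gFactor g₀ (k + 1) = (ofBeta d q r u v w).gFactor g₀ k *
      (q * v * q ^ (2 * k) * (u + q * v * w * q ^ (2 * k)) /
        (w + q * u * v * q ^ (2 * k))) := by
  have hq := h.q_ne
  have hu := h.u_ne
  have hv := h.v_ne
  have hw := h.w_ne
  have hr := h.r_ne
  have hx := h.x_ne k
  simp only [Params.gFactor, Finset.prod_range_succ]
  rw [← mul_assoc]
  congr 1
  have e6 : q ^ (4 * (k : ℤ)) = (q ^ (2 * k)) ^ 2 := by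
    rw [← zpow_two_mul_natCast, ← zpow_natCast, ← _root_.zpow_mul]; congr 1; push_cast; ring
  simp only [ofBeta, e6, zpow_neg_two_mul, zpow_two_mul_natCast, ratio_sq hr hv]
  generalize q ^ (2 * k) = y at *
  have e7 : v⁻¹ / r * y⁻¹ + r * q * (u⁻¹ / r) * (w / r) =
      (u + q * v * w * y) / (r * u * v * y) := by
    field_simp
  have e8 : v / r * y + r * q⁻¹ * (u⁻¹ / r) * (w / r) = (w + q * u * v * y) / (r * u * q) := by
    field_simp
    ring
  rw [e7, e8]
  field_simp

lemma gFactor_num_ne (h : Nondeg d q r u v w) {k : ℕ} (hk : k < d) :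
    u + q * v * w * q ^ (2 * k) ≠ 0 := by
  convert h.vw k hk using 1
  ring

lemma gFactor_den_ne (h : Nondeg d q r u v w) {k : ℕ} (hk : k < d) :
    w + q * u * v * q ^ (2 * k) ≠ 0 := by
  convert h.uv k hk using 1
  ring

lemma gFactor_ne_zero (h : Nondeg d q r u v w) {g₀ : ℂ} (hg : g₀ ≠ 0) {k : ℕ} (hk : k ≤ d) :
    (ofBeta d q r u v w).gFactor g₀ k ≠ 0 := by
  induction k with
  | zero => rwa [gFactor_zero]
  | succ k ih =>
    rw [gFactor_succ h]
    have := h.q_ne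
    have := h.v_ne
    have := h.x_ne k
    have := gFactor_num_ne h (Nat.lt_of_succ_le hk)
    have := gFactor_den_ne h (Nat.lt_of_succ_le hk)
    have := ih (by omega)
    positivity

lemma gFactor_eq_mul (p : Params d) (g₀ : ℂ) (k : ℕ) : p.gFactor g₀ k = g₀ * p.gFactor 1 k := by
  simp [Params.gFactor]

/-- Exchanging `u` and `w` changes only one linear factor of the coefficient. The quotient of the
two versions of that factor, times the monomial from the commutator, is the ratio `g_{k+1} / g_k`.
-/
lemma lowF_commutator (h : Nondeg d q r u v w) {k : ℕ} (hk : k < d) :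
    let y := q ^ (2 * k)
    let Q := q ^ (2 * d)
    v * y * q * lowF q r Q v u w (y * q ^ 2) =
      q * v * y * (u + q * v * w * y) / (w + q * u * v * y) *
        lowF q r Q v w u (y * q ^ 2) := by
  intro y Q
  have hq := h.q_ne
  have hu := h.u_ne
  have hv := h.v_ne
  have hw := h.w_ne
  have hr := h.r_ne
  have hy : y ≠ 0 := h.x_ne k
  have hQ : Q ≠ 0 := h.x_ne d
  have n1 : w + q * u * v * y ≠ 0 := gFactor_den_ne h hk
  have e : q ^ (2 * (k + 1)) = y * q ^ 2 := by simp only [y]; ring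
  have d1 := h.rot.sq_sub_ne (Nat.succ_le_of_lt hk) (Nat.succ_pos k)
  have d2 := h.rot.one_sub_ne (Nat.succ_le_of_lt hk)
  rw [Nat.succ_eq_add_one, e] at d1 d2
  unfold lowF
  generalize hA : q ^ 2 - v ^ 2 * (y * q ^ 2) ^ 2 = A at *
  generalize hB : 1 - v ^ 2 * (y * q ^ 2) ^ 2 = B at *
  generalize hE : w + q * u * v * y = E at *
  field_simp
  subst hE
  ring

lemma upF_commutator (h : Nondeg d q r u v w) {k : ℕ} (hk : k < d) :
    let y := q ^ (2 * k)
    let Q := q ^ (2 * d)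
    v⁻¹ * y⁻¹ * q⁻¹ * upF q r Q v u w y *
      (q * v * y * (u + q * v * w * y) / (w + q * u * v * y)) = upF q r Q v w u y := by
  intro y Q
  have hq := h.q_ne
  have hu := h.u_ne
  have hv := h.v_ne
  have hw := h.w_ne
  have hr := h.r_ne
  have hy : y ≠ 0 := h.x_ne k
  have hQ : Q ≠ 0 := h.x_ne d
  have n1 : w + q * u * v * y ≠ 0 := gFactor_den_ne h hk
  have d1 : 1 - v ^ 2 * y ^ 2 * q ^ 2 ≠ 0 := h.rot.one_sub_succ_ne hk
  have d2 : 1 - v ^ 2 * y ^ 2 ≠ 0 := h.rot.one_sub_ne hk.le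
  unfold upF
  generalize hA : 1 - v ^ 2 * y ^ 2 * q ^ 2 = A at *
  generalize hB : 1 - v ^ 2 * y ^ 2 = B at *
  generalize hE : w + q * u * v * y = E at *
  field_simp
  subst hE
  ring

/-- The matrix of the third map in an eigenbasis `|θ^b⟩`, when the matrix of the first map is `S`. -/
def thirdMat (p : Params d) (S : Matrix (Fin (d + 1)) (Fin (d + 1)) ℂ) :
    Matrix (Fin (d + 1)) (Fin (d + 1)) ℂ :=
  (p.r₀ / (p.q ^ 2 - p.q ^ (-2 : ℤ))) •
      (p.q • (thetaMat d p.q p.bb p.cb * S) - p.q⁻¹ • (S * thetaMat d p.q p.bb p.cb)) +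
    (p.r₀ * p.omega / ((p.q - p.q⁻¹) * (p.q ^ 2 - p.q ^ (-2 : ℤ)))) • 1

lemma thirdMat_apply_ne (p : Params d) (S : Matrix (Fin (d + 1)) (Fin (d + 1)) ℂ)
    {M N : Fin (d + 1)} (hMN : M ≠ N) : thirdMat p S M N =
      p.r₀ / (p.q ^ 2 - p.q ^ (-2 : ℤ)) *
        (p.q * theta p.q p.bb p.cb M - p.q⁻¹ * theta p.q p.bb p.cb N) * S M N := by
  simp only [thirdMat, thetaMat, Matrix.add_apply, Matrix.smul_apply, Matrix.sub_apply,
    diagonal_mul, mul_diagonal, one_apply_ne hMN, smul_eq_mul]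
  ring

lemma thirdMat_apply_eq (p : Params d) (S : Matrix (Fin (d + 1)) (Fin (d + 1)) ℂ)
    (M : Fin (d + 1)) : thirdMat p S M M =
      p.r₀ / (p.q ^ 2 - p.q ^ (-2 : ℤ)) * (p.q - p.q⁻¹) * theta p.q p.bb p.cb M * S M M +
      p.r₀ * p.omega / ((p.q - p.q⁻¹) * (p.q ^ 2 - p.q ^ (-2 : ℤ))) := by
  simp only [thirdMat, thetaMat, Matrix.add_apply, Matrix.smul_apply, Matrix.sub_apply,
    diagonal_mul, mul_diagonal, one_apply_eq, smul_eq_mul]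
  ring

lemma zpow_neg_two' (q : ℂ) : q ^ (-2 : ℤ) = (q ^ 2)⁻¹ := by
  rw [_root_.zpow_neg]; rfl

/-- The combination `q θ_{k+1} - q⁻¹ θ_k` kills the `q^{-2k}` part of the eigenvalues. The surviving
monomial is nonzero, so commutation preserves irreducibility; `theta_commutator_upper` is the mirror
case. -/
lemma theta_commutator_lower (h : Nondeg d q r u v w) (k : ℕ) :
    r / (q ^ 2 - q ^ (-2 : ℤ)) * (q * theta q (v / r) (v⁻¹ / r) (k + 1) -
      q⁻¹ * theta q (v / r) (v⁻¹ / r) k) = v * q ^ (2 * k) * q := by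
  have hq := h.q_ne
  have hv := h.v_ne
  have hr := h.r_ne
  have hy := h.x_ne k
  have hk := h.sq_add_one_ne
  have hk' := h.sq_sub_one_ne
  have e : q ^ 2 - (q ^ 2)⁻¹ = (q ^ 2 + 1) * (q ^ 2 - 1) / q ^ 2 := by
    field_simp
    ring
  rw [theta_ofBeta, theta_ofBeta, zpow_neg_two', e, show q ^ (2 * (k + 1)) = q ^ (2 * k) * q ^ 2 by
    ring]
  generalize q ^ (2 * k) = y at *
  field_simp
  ring

lemma theta_commutator_upper (h : Nondeg d q r u v w) (k : ℕ) :
    r / (q ^ 2 - q ^ (-2 : ℤ)) * (q * theta q (v / r) (v⁻¹ / r) k -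
      q⁻¹ * theta q (v / r) (v⁻¹ / r) (k + 1)) = v⁻¹ * (q ^ (2 * k))⁻¹ * q⁻¹ := by
  have hq := h.q_ne
  have hv := h.v_ne
  have hr := h.r_ne
  have hy := h.x_ne k
  have hk := h.sq_add_one_ne
  have hk' := h.sq_sub_one_ne
  have e : q ^ 2 - (q ^ 2)⁻¹ = (q ^ 2 + 1) * (q ^ 2 - 1) / q ^ 2 := by
    field_simp
    ring
  rw [theta_ofBeta, theta_ofBeta, zpow_neg_two', e, show q ^ (2 * (k + 1)) = q ^ (2 * k) * q ^ 2 by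
    ring]
  generalize q ^ (2 * k) = y at *
  field_simp
  ring

/-- The diagonal matrix of the factors `g_M`, with `g₀ = 1`. -/
def gMat (p : Params d) : Matrix (Fin (d + 1)) (Fin (d + 1)) ℂ := diagonal fun M => p.gFactor 1 M

lemma theta_zero_ofBeta : theta q (v / r) (v⁻¹ / r) 0 = (v + v⁻¹) / r := by
  rw [theta_ofBeta]
  simp

lemma thirdMat_mul_gMat (h : Nondeg d q r u v w) :
    thirdMat (ofBeta d q r u v w) (ofBeta d q r u v w).swap.tri * gMat (ofBeta d q r u v w) =
      gMat (ofBeta d q r u v w) * (ofBeta d q r v w u).tri := by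
  have hq := h.q_ne
  have hr := h.r_ne
  ext M N
  rw [gMat, mul_diagonal, diagonal_mul]
  have hM := M.isLt
  have hN := N.isLt
  by_cases h1 : (M : ℕ) = N + 1
  · have hMN : M ≠ N := by rintro rfl; omega
    have e1 := theta_commutator_lower h N
    have e2 := lowF_commutator h (k := N) (by omega)
    have e : q ^ (2 * ((N : ℕ) + 1)) = q ^ (2 * (N : ℕ)) * q ^ 2 := by ring
    simp only at e2
    rw [thirdMat_apply_ne _ _ hMN, tri_lower _ h1, tri_lower _ h1, h1, swap_lower h (by omega),
      lower_ofBeta h.rot (by omega), gFactor_succ h, e]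
    simp only [ofBeta] at e1 ⊢
    rw [e1, e2]
    ring
  by_cases h2 : (N : ℕ) = M + 1
  · have hMN : M ≠ N := by rintro rfl; omega
    have e1 := theta_commutator_upper h M
    have e2 := upF_commutator h (k := M) (by omega)
    simp only at e2
    rw [thirdMat_apply_ne _ _ hMN, tri_upper _ h2, tri_upper _ h2, h2, swap_upper h (by omega),
      upper_ofBeta h.rot (by omega), gFactor_succ h, ← e2]
    simp only [ofBeta] at e1 ⊢
    rw [e1]
    ring
  by_cases h3 : M = N
  · subst h3
    rw [mul_comm]
    congr 1
    have e1 := commutator_diag h (M := M) (by omega)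
    simp only at e1
    have e2 : theta (ofBeta d q r u v w).swap.q (ofBeta d q r u v w).swap.bb
      (ofBeta d q r u v w).swap.cb 0 = (u + u⁻¹) / r := theta_zero_ofBeta
    have e3 : theta (ofBeta d q r v w u).q (ofBeta d q r v w u).bb (ofBeta d q r v w u).cb 0 =
      (w + w⁻¹) / r := theta_zero_ofBeta
    rw [thirdMat_apply_eq, tri_diag, tri_diag, swap_lower h (by omega), swap_upper h (by omega),
      lower_ofBeta h.rot (by omega), upper_ofBeta h.rot (by omega), e2, e3, ← e1]
    have hk := h.sq_add_one_ne
    have hk' := h.sq_sub_one_ne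
    have e4 : q ^ 2 - q ^ (-2 : ℤ) = (q - q⁻¹) * (q + q⁻¹) := by
      rw [zpow_neg_two']
      field_simp
      ring
    have e5 : q - q⁻¹ ≠ 0 := by
      have : q - q⁻¹ = (q ^ 2 - 1) / q := by field_simp
      rw [this]
      exact div_ne_zero hk' hq
    have e6 : q + q⁻¹ ≠ 0 := by
      have : q + q⁻¹ = (q ^ 2 + 1) / q := by field_simp
      rw [this]
      exact div_ne_zero hk hq
    generalize (ofBeta d q r u v w).omega = ω
    simp only [ofBeta, e4, theta_ofBeta]
    generalize q - q⁻¹ = A at *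
    generalize q + q⁻¹ = B at *
    field_simp
  · rw [thirdMat_apply_ne _ _ h3, tri_far _ h1 h2 h3, tri_far _ h1 h2 h3]
    ring

end commutator

/-! ### Changes of basis and uniqueness of eigenbases -/

section bases

open Matrix

variable {d : ℕ} {q r u v w : ℂ} {V : Type*} [AddCommGroup V] [Module ℂ V]

lemma toMatrix_eq_iff {n : ℕ} (v : Module.Basis (Fin n) ℂ V) (A : Module.End ℂ V)
    (S : Matrix (Fin n) (Fin n) ℂ) :
    LinearMap.toMatrix v v A = S ↔ ∀ N, A (v N) = ∑ M, S M N • v M := by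
  constructor
  · rintro rfl N
    simp only [LinearMap.toMatrix_apply]
    exact (v.sum_repr (A (v N))).symm
  · intro h
    ext M N
    rw [LinearMap.toMatrix_apply, h N]
    simp [Finsupp.single_apply]

lemma sum_smul_apply {n : ℕ} {v : Module.Basis (Fin n) ℂ V} {A : Module.End ℂ V}
    {S : Matrix (Fin n) (Fin n) ℂ} (h : LinearMap.toMatrix v v A = S) (x : Fin n → ℂ) :
    A (∑ N, x N • v N) = ∑ M, (S *ᵥ x) M • v M := by
  rw [toMatrix_eq_iff] at h
  simp only [map_sum, map_smul, h, Finset.smul_sum, mulVec, dotProduct, Finset.sum_smul, smul_smul]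
  rw [Finset.sum_comm]
  refine Finset.sum_congr rfl fun M _ => Finset.sum_congr rfl fun N _ => ?_
  rw [mul_comm]

lemma exists_basis_of_inverse {n : ℕ} (v : Module.Basis (Fin n) ℂ V)
    {P P' : Matrix (Fin n) (Fin n) ℂ} (h1 : P * P' = 1) (h2 : P' * P = 1) :
    ∃ v' : Module.Basis (Fin n) ℂ V, (∀ N, v' N = ∑ M, P M N • v M) ∧
      (∀ M, v M = ∑ N, P' N M • v' N) ∧
      ∀ (A : Module.End ℂ V) (S : Matrix (Fin n) (Fin n) ℂ),
        LinearMap.toMatrix v v A * P = P * S → LinearMap.toMatrix v' v' A = S := by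
  let e : V ≃ₗ[ℂ] V := LinearEquiv.ofLinearMap (Matrix.toLin v v P) (Matrix.toLin v v P')
    (by rw [← Matrix.toLin_mul, h1, Matrix.toLin_one])
    (by rw [← Matrix.toLin_mul, h2, Matrix.toLin_one])
  have hv' : ∀ N, v.map e N = ∑ M, P M N • v M := fun N => by
    rw [Module.Basis.map_apply]
    exact Matrix.toLin_self v v P N
  refine ⟨v.map e, hv', fun M => ?_, fun A S hS => ?_⟩
  · simp only [hv', Finset.smul_sum, smul_smul]
    rw [Finset.sum_comm]
    simp only [← Finset.sum_smul]
    have : ∀ L, ∑ N, P' N M * P L N = (1 : Matrix (Fin n) (Fin n) ℂ) L M := by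
      intro L
      rw [← h1, mul_apply]
      exact Finset.sum_congr rfl fun N _ => mul_comm _ _
    simp [this, one_apply]
  · rw [toMatrix_eq_iff]
    intro N
    rw [hv', sum_smul_apply (rfl : LinearMap.toMatrix v v A = _)]
    have e1 : ∀ M, (LinearMap.toMatrix v v A *ᵥ fun L => P L N) M = (P * S) M N := by
      intro M
      rw [← hS]
      rfl
    simp only [e1, hv', mul_apply, Finset.smul_sum, smul_smul, Finset.sum_smul]
    rw [Finset.sum_comm]
    refine Finset.sum_congr rfl fun M _ => Finset.sum_congr rfl fun L _ => ?_
    rw [mul_comm]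

lemma exists_basis_of_diagonal {n : ℕ} (v : Module.Basis (Fin n) ℂ V) {x : Fin n → ℂ}
    (hx : ∀ M, x M ≠ 0) :
    ∃ v' : Module.Basis (Fin n) ℂ V, (∀ N, v' N = x N • v N) ∧
      ∀ (A : Module.End ℂ V) (S : Matrix (Fin n) (Fin n) ℂ),
        LinearMap.toMatrix v v A * diagonal x = diagonal x * S →
          LinearMap.toMatrix v' v' A = S := by
  obtain ⟨v', h1, -, h3⟩ := exists_basis_of_inverse v (P := diagonal x) (P' := diagonal x⁻¹)
    (by rw [diagonal_mul_diagonal, ← diagonal_one]; congr 1; ext i; simp [hx i])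
    (by rw [diagonal_mul_diagonal, ← diagonal_one]; congr 1; ext i; simp [hx i])
  refine ⟨v', fun N => ?_, h3⟩
  rw [h1, Finset.sum_eq_single N]
  · rw [diagonal_apply_eq]
  · intro M _ hM
    rw [diagonal_apply_ne _ hM, zero_smul]
  · intro hn
    exact absurd (Finset.mem_univ _) hn

/-- The change-of-basis matrix commutes with both the diagonal and the irreducible tridiagonal
matrix, hence is scalar. -/
lemma basis_unique {X Y : Module.End ℂ V} {θ : Fin (d + 1) → ℂ} (hθ : Function.Injective θ)
    {T : Matrix (Fin (d + 1)) (Fin (d + 1)) ℂ} (hT : IsIrredTridiagonal T)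
    {v v' : Module.Basis (Fin (d + 1)) ℂ V}
    (h1 : LinearMap.toMatrix v v X = diagonal θ) (h2 : LinearMap.toMatrix v v Y = T)
    (h1' : LinearMap.toMatrix v' v' X = diagonal θ) (h2' : LinearMap.toMatrix v' v' Y = T) :
    ∃ κ : ℂ, κ ≠ 0 ∧ ∀ M, v' M = κ • v M := by
  have hE : ∀ A : Module.End ℂ V,
      LinearMap.toMatrix v v A * v.toMatrix v' = v.toMatrix v' * LinearMap.toMatrix v' v' A := by
    intro A
    rw [linearMap_toMatrix_mul_basis_toMatrix, basis_toMatrix_mul_linearMap_toMatrix]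
  have e1 := hE X
  have e2 := hE Y
  rw [h1, h1'] at e1
  rw [h2, h2'] at e2
  obtain ⟨κ, hκ⟩ := eq_smul_one_of_commute hθ hT e1 e2
  have hv : ∀ M, v' M = κ • v M := by
    intro M
    have := v.sum_toMatrix_smul_self v' M
    rw [← this, hκ, Finset.sum_eq_single M]
    · simp
    · intro L _ hL
      simp [one_apply_ne hL]
    · intro hn
      exact absurd (Finset.mem_univ _) hn
  refine ⟨κ, ?_, hv⟩
  rintro rfl
  have := v'.ne_zero 0
  rw [hv 0, zero_smul] at this
  exact this rfl

/-- `Z` is obtained from `X` and `Y` like the third map of a triple from the first two. -/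
def IsThird (p : Params d) (X Y Z : Module.End ℂ V) : Prop :=
  Z = (p.r₀ / (p.q ^ 2 - p.q ^ (-2 : ℤ))) • qComm p.q Y X +
    (p.r₀ * p.omega / ((p.q - p.q⁻¹) * (p.q ^ 2 - p.q ^ (-2 : ℤ)))) • (1 : Module.End ℂ V)

lemma IsThird.toMatrix {p : Params d} {X Y Z : Module.End ℂ V} (h : IsThird p X Y Z)
    {v : Module.Basis (Fin (d + 1)) ℂ V} {S : Matrix (Fin (d + 1)) (Fin (d + 1)) ℂ}
    (hX : LinearMap.toMatrix v v X = S)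
    (hY : LinearMap.toMatrix v v Y = thetaMat d p.q p.bb p.cb) :
    LinearMap.toMatrix v v Z = thirdMat p S := by
  rw [h, thirdMat, qComm, ← hX, ← hY]
  simp only [map_add, map_sub, map_smul, LinearMap.toMatrix_mul, LinearMap.toMatrix_one]

lemma thirdMat_irred (h : Nondeg d q r u v w) {S : Matrix (Fin (d + 1)) (Fin (d + 1)) ℂ}
    (hS : IsIrredTridiagonal S) : IsIrredTridiagonal (thirdMat (ofBeta d q r u v w) S) := by
  have hq := h.q_ne
  have hv := h.v_ne
  refine ⟨fun i j hij => ?_, fun i j hij => ?_⟩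
  · have : i ≠ j := by rintro rfl; omega
    rw [thirdMat_apply_ne _ _ this, hS.1 i j hij, mul_zero]
  · have : i ≠ j := by rintro rfl; omega
    rw [thirdMat_apply_ne _ _ this]
    refine mul_ne_zero ?_ (hS.2 i j hij)
    rcases hij with hij | hij
    · have e := theta_commutator_upper h i
      have := h.x_ne i
      simp only [ofBeta]
      rw [← hij, e]
      positivity
    · have e := theta_commutator_lower h j
      have := h.x_ne j
      simp only [ofBeta]
      rw [← hij, e]
      positivity

/-- `v` is an eigenbasis of `X`, for the eigenvalues `θ^a_M`, on which `Y` acts with the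
coefficients `A^{(b,a)}_{M,N}`. -/
def IsStd (p : Params d) (X Y : Module.End ℂ V) (v : Module.Basis (Fin (d + 1)) ℂ V) : Prop :=
  LinearMap.toMatrix v v X = thetaMat d p.q p.ba p.ca ∧ LinearMap.toMatrix v v Y = p.tri

/-- `v` is an eigenbasis of `Y`, for the eigenvalues `θ^b_M`, on which `X` acts with the
coefficients `A^{(a,b)}_{M,N}`. -/
def IsDual (p : Params d) (X Y : Module.End ℂ V) (v : Module.Basis (Fin (d + 1)) ℂ V) : Prop :=
  LinearMap.toMatrix v v Y = thetaMat d p.q p.bb p.cb ∧ LinearMap.toMatrix v v X = p.swap.tri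

lemma theta_injective_fin (h : Nondeg d q r u v w) :
    Function.Injective fun M : Fin (d + 1) => theta q (u / r) (u⁻¹ / r) M :=
  fun M N he => Fin.ext (theta_injective h (Nat.lt_succ_iff.1 M.isLt)
    (Nat.lt_succ_iff.1 N.isLt) he)

lemma IsStd.unique (h : Nondeg d q r u v w) {X Y : Module.End ℂ V}
    {v₁ v₂ : Module.Basis (Fin (d + 1)) ℂ V} (h1 : IsStd (ofBeta d q r u v w) X Y v₁)
    (h2 : IsStd (ofBeta d q r u v w) X Y v₂) : ∃ κ : ℂ, κ ≠ 0 ∧ ∀ M, v₂ M = κ • v₁ M :=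
  basis_unique (theta_injective_fin h) (tri_irred h) h1.1 h1.2 h2.1 h2.2

lemma IsDual.unique (h : Nondeg d q r u v w) {X Y : Module.End ℂ V}
    {v₁ v₂ : Module.Basis (Fin (d + 1)) ℂ V} (h1 : IsDual (ofBeta d q r u v w) X Y v₁)
    (h2 : IsDual (ofBeta d q r u v w) X Y v₂) : ∃ κ : ℂ, κ ≠ 0 ∧ ∀ M, v₂ M = κ • v₁ M :=
  basis_unique (theta_injective_fin h.rot) (swap_tri_irred h) h1.1 h1.2 h2.1 h2.2

lemma IsStd.exists_dual (h : Nondeg d q r u v w) {X Y : Module.End ℂ V}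
    {va : Module.Basis (Fin (d + 1)) ℂ V} (ha : IsStd (ofBeta d q r u v w) X Y va) :
    ∃ vb, IsDual (ofBeta d q r u v w) X Y vb ∧
      (∀ N, vb N = ∑ M, (ofBeta d q r u v w).trans M N • va M) ∧
      ∀ M, va M = ∑ N, (ofBeta d q r u v w).transInv N M • vb N := by
  obtain ⟨vb, h1, h2, h3⟩ := exists_basis_of_inverse va (trans_mul_transInv h)
    (transInv_mul_trans h)
  refine ⟨vb, ⟨h3 _ _ ?_, h3 _ _ ?_⟩, h1, h2⟩
  · rw [ha.2]
    exact tri_mul_trans h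
  · rw [ha.1]
    exact thetaMat_mul_trans h

/-- This is the cyclic step: after rescaling, an eigenbasis of the second map plays for `(Y, Z)` the
role that the initial eigenbasis played for `(X, Y)`. -/
lemma IsDual.exists_rot (h : Nondeg d q r u v w) {X Y Z : Module.End ℂ V}
    (hZ : IsThird (ofBeta d q r u v w) X Y Z)
    {vb : Module.Basis (Fin (d + 1)) ℂ V} (hb : IsDual (ofBeta d q r u v w) X Y vb) :
    ∃ vb', IsStd (ofBeta d q r v w u) Y Z vb' ∧
      ∀ M, vb' M = (ofBeta d q r u v w).gFactor 1 M • vb M := by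
  obtain ⟨vb', h1, h2⟩ := exists_basis_of_diagonal vb
    (x := fun M : Fin (d + 1) => (ofBeta d q r u v w).gFactor 1 M)
    fun M => gFactor_ne_zero h one_ne_zero (Nat.lt_succ_iff.1 M.isLt)
  refine ⟨vb', ⟨h2 _ _ ?_, h2 _ _ ?_⟩, h1⟩
  · rw [hb.1]
    simp only [ofBeta, thetaMat, diagonal_mul_diagonal]
    congr 1
    ext i
    rw [mul_comm]
  · rw [hZ.toMatrix hb.2 hb.1]
    exact thirdMat_mul_gMat h

end bases

/-! ### One full turn around the triple -/

section triples

open Matrix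

variable {d : ℕ} {q r u v w : ℂ} {V : Type*} [AddCommGroup V] [Module ℂ V]

lemma hFactor_ofBeta : (ofBeta d q r u v w).hFactor = (ofBeta d q r v w u).gFactor := rfl

/-- The rescaling on the last leg acts on the eigenbasis of the first map, which is the target
there, so it enters inverted: `f` is `f₀` divided by the `g`-factor of `(w, u, v)`. -/
lemma fFactor_mul_gFactor (h : Nondeg d q r u v w) (f₀ : ℂ) {k : ℕ} (hk : k ≤ d) :
    (ofBeta d q r u v w).fFactor f₀ k * (ofBeta d q r w u v).gFactor 1 k = f₀ := by
  induction k with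
  | zero => simp [Params.fFactor, Params.gFactor]
  | succ k ih =>
    have hq := h.q_ne
    have hu := h.u_ne
    have hv := h.v_ne
    have hw := h.w_ne
    have hr := h.r_ne
    have hx := h.x_ne k
    have n1 := gFactor_num_ne h.rot.rot (Nat.lt_of_succ_le hk)
    have n2 := gFactor_den_ne h (Nat.lt_of_succ_le hk)
    have e1 : q ^ (-2 * (k : ℤ) - 2) = (q ^ (2 * k) * q ^ 2)⁻¹ := by
      rw [show -2 * (k : ℤ) - 2 = -(2 * (k : ℤ) + 2) by ring, _root_.zpow_neg, zpow_add₀ hq,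
        zpow_two_mul_natCast]
      rfl
    have e2 : (ofBeta d q r u v w).fFactor f₀ (k + 1) = (ofBeta d q r u v w).fFactor f₀ k *
        ((v + q * u * w * q ^ (2 * k)) /
          (q * u * q ^ (2 * k) * (w + q * u * v * q ^ (2 * k)))) := by
      simp only [Params.fFactor, Finset.prod_range_succ]
      rw [← mul_assoc]
      congr 1
      simp only [ofBeta, e1, zpow_two_mul_natCast]
      generalize q ^ (2 * k) = y at *
      have e7 : u⁻¹ / r * (y * q ^ 2)⁻¹ + r * q⁻¹ * (v⁻¹ / r) * (w / r) =
          (v + q * u * w * y) / (r * u * v * y * q ^ 2) := by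
        field_simp
      have e8 : u / r * y + r * q⁻¹ * (v⁻¹ / r) * (w / r) =
          (w + q * u * v * y) / (r * v * q) := by
        field_simp
        ring
      rw [e7, e8]
      field_simp
    rw [e2, gFactor_succ h.rot.rot, mul_mul_mul_comm, ih (by omega)]
    have n1' : v + q * w * u * q ^ (2 * k) ≠ 0 := by
      convert h.wu k (Nat.lt_of_succ_le hk) using 1
      ring
    rw [show v + q * u * w * q ^ (2 * k) = v + q * w * u * q ^ (2 * k) by ring]
    generalize v + q * w * u * q ^ (2 * k) = B at *
    generalize w + q * u * v * q ^ (2 * k) = C at *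
    field_simp

lemma IsStd.exists_eigenbases (h : Nondeg d q r u v w) {X Y Z : Module.End ℂ V}
    (hZ : IsThird (ofBeta d q r u v w) X Y Z)
    {va : Module.Basis (Fin (d + 1)) ℂ V} (ha : IsStd (ofBeta d q r u v w) X Y va) :
    ∃ vb vb' vc, IsDual (ofBeta d q r u v w) X Y vb ∧ IsStd (ofBeta d q r v w u) Y Z vb' ∧
      IsDual (ofBeta d q r v w u) Y Z vc := by
  obtain ⟨vb, hb, -, -⟩ := ha.exists_dual h
  obtain ⟨vb', hb', -⟩ := hb.exists_rot h hZ
  obtain ⟨vc, hc, -, -⟩ := hb'.exists_dual h.rot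
  exact ⟨vb, vb', vc, hb, hb', hc⟩

lemma IsDual.irred (h : Nondeg d q r u v w) {X Y Z : Module.End ℂ V}
    (hZ : IsThird (ofBeta d q r u v w) X Y Z)
    {vb : Module.Basis (Fin (d + 1)) ℂ V} (hb : IsDual (ofBeta d q r u v w) X Y vb) :
    (LinearMap.toMatrix vb vb Y).IsDiag ∧ IsIrredTridiagonal (LinearMap.toMatrix vb vb X) ∧
      IsIrredTridiagonal (LinearMap.toMatrix vb vb Z) := by
  refine ⟨?_, ?_, ?_⟩
  · rw [hb.1]
    exact isDiag_diagonal _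
  · rw [hb.2]
    exact swap_tri_irred h
  · rw [hZ.toMatrix hb.2 hb.1]
    exact thirdMat_irred h (swap_tri_irred h)

/-- The relations between eigenbases of a triple of maps. -/
theorem transition_relations (h : Nondeg d q r u v w) {X Y Z : Module.End ℂ V}
    (hZ : IsThird (ofBeta d q r u v w) X Y Z) (hX : IsThird (ofBeta d q r v w u) Y Z X)
    (hY : IsThird (ofBeta d q r w u v) Z X Y)
    {va vb₀ vc : Module.Basis (Fin (d + 1)) ℂ V} (ha : IsStd (ofBeta d q r u v w) X Y va)
    (hb : IsDual (ofBeta d q r u v w) X Y vb₀) (hc : IsDual (ofBeta d q r v w u) Y Z vc) :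
    ∃ (κ : ℂ) (g₀ : ℂ), κ ≠ 0 ∧ g₀ ≠ 0 ∧ ∀ f₀ : ℂ, f₀ ≠ 0 → ∃ h₀ : ℂ, h₀ ≠ 0 ∧
      ∀ vb : Fin (d + 1) → V, (∀ M : Fin (d + 1), vb M = κ • vb₀ M) →
      ∀ f g k : ℕ → ℂ, f = (ofBeta d q r u v w).fFactor f₀ →
        g = (ofBeta d q r u v w).gFactor g₀ →
        k = (ofBeta d q r u v w).hFactor h₀ →
        (∀ N : Fin (d + 1), vb N = ∑ M : Fin (d + 1), (ofBeta d q r u v w).trans M N • va M) ∧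
        (∀ M : Fin (d + 1),
          va M = ∑ N : Fin (d + 1), (ofBeta d q r u v w).transInv N M • vb N) ∧
        (∀ N : Fin (d + 1),
          vc N = ∑ M : Fin (d + 1), (g M * (ofBeta d q r v w u).trans M N) • vb M) ∧
        (∀ M : Fin (d + 1),
          vb M = ∑ N : Fin (d + 1), ((g M)⁻¹ * (ofBeta d q r v w u).transInv N M) • vc N) ∧
        (∀ N : Fin (d + 1),
          va N = ∑ M : Fin (d + 1), ((f N)⁻¹ * k M * (ofBeta d q r w u v).trans M N) • vc M) ∧
        (∀ M : Fin (d + 1),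
          vc M = ∑ N : Fin (d + 1), (f N * (k M)⁻¹ * (ofBeta d q r w u v).transInv N M) • va N) := by
  -- Alternate transition and rescaling from `va` once around the triple, comparing with the given
  -- basis at each stage. The discrepancies are `κ` at the second basis, `μ` at the third, and `ρ`
  -- on returning to `va`.
  obtain ⟨vb₁, hb₁, ab, ba⟩ := ha.exists_dual h
  obtain ⟨κ, hκ, eb⟩ := hb.unique h hb₁
  obtain ⟨vb₂, hb₂, gb⟩ := hb₁.exists_rot h hZ
  obtain ⟨vc₁, hc₁, bc, cb⟩ := hb₂.exists_dual h.rot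
  obtain ⟨μ, hμ, ec⟩ := hc₁.unique h.rot hc
  obtain ⟨vc₂, hc₂, gc⟩ := hc.exists_rot h.rot hX
  obtain ⟨va₁, ha₁, ca, ac⟩ := hc₂.exists_dual h.rot.rot
  obtain ⟨va₂, ha₂, ga⟩ := ha₁.exists_rot h.rot.rot hY
  obtain ⟨ρ, hρ, ea⟩ := ha.unique h ha₂
  -- Only the quotient `h_M / f_N` enters the last leg, so `f₀` is free, and closing the turn forces
  -- `h₀ / f₀ = ρ⁻¹`.
  refine ⟨κ, μ, hκ, hμ, fun f₀ hf₀ => ⟨f₀ / ρ, div_ne_zero hf₀ hρ, ?_⟩⟩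
  rintro vb hvb f g k hf hg hk
  have hvb₁ : ∀ M, vb M = vb₁ M := fun M => by rw [hvb, eb]
  have hle : ∀ M : Fin (d + 1), (M : ℕ) ≤ d := fun M => Nat.lt_succ_iff.1 M.isLt
  have hg1 : ∀ M : Fin (d + 1), (ofBeta d q r u v w).gFactor 1 M ≠ 0 := fun M =>
    gFactor_ne_zero h one_ne_zero (hle M)
  have hg2 : ∀ M : Fin (d + 1), (ofBeta d q r v w u).gFactor 1 M ≠ 0 := fun M =>
    gFactor_ne_zero h.rot one_ne_zero (hle M)
  have hg3 : ∀ M : Fin (d + 1), (ofBeta d q r w u v).gFactor 1 M ≠ 0 := fun M =>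
    gFactor_ne_zero h.rot.rot one_ne_zero (hle M)
  have hgM : ∀ M : Fin (d + 1), g M = μ * (ofBeta d q r u v w).gFactor 1 M := fun M => by
    rw [hg, gFactor_eq_mul]
  have hkM : ∀ M : Fin (d + 1), k M = f₀ / ρ * (ofBeta d q r v w u).gFactor 1 M := fun M => by
    rw [hk, hFactor_ofBeta, gFactor_eq_mul]
  have hfM : ∀ M : Fin (d + 1), f M = f₀ * ((ofBeta d q r w u v).gFactor 1 M)⁻¹ := fun M => by
    rw [hf, eq_mul_inv_iff_mul_eq₀ (hg3 M), fFactor_mul_gFactor h f₀ (hle M)]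
  have hva : ∀ M, va₁ M = (ρ * ((ofBeta d q r w u v).gFactor 1 M)⁻¹) • va M := fun M => by
    rw [mul_comm, ← smul_smul, ← ea, ga, smul_smul, inv_mul_cancel₀ (hg3 M), one_smul]
  refine ⟨fun N => ?_, fun M => ?_, fun N => ?_, fun M => ?_, fun N => ?_, fun M => ?_⟩
  · rw [hvb₁, ab]
  · rw [ba]
    exact Finset.sum_congr rfl fun N _ => by rw [hvb₁]
  · rw [ec, bc, Finset.smul_sum]
    refine Finset.sum_congr rfl fun M _ => ?_
    rw [gb, hvb₁, hgM, smul_smul, smul_smul]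
    congr 1
    ring
  · have e : vb M = ((ofBeta d q r u v w).gFactor 1 M)⁻¹ • vb₂ M := by
      rw [hvb₁, gb, smul_smul, inv_mul_cancel₀ (hg1 M), one_smul]
    rw [e, cb, Finset.smul_sum]
    refine Finset.sum_congr rfl fun N _ => ?_
    rw [ec, hgM, smul_smul, smul_smul]
    congr 1
    have := hg1 M
    field_simp
  · have e : va N = (ρ⁻¹ * (ofBeta d q r w u v).gFactor 1 N) • va₁ N := by
      have := hg3 N
      rw [hva, smul_smul]
      rw [show ρ⁻¹ * (ofBeta d q r w u v).gFactor 1 N *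
        (ρ * ((ofBeta d q r w u v).gFactor 1 N)⁻¹) = 1 by field_simp, one_smul]
    rw [e, ca, Finset.smul_sum]
    refine Finset.sum_congr rfl fun M _ => ?_
    rw [gc, hkM, hfM, smul_smul, smul_smul]
    congr 1
    have := hg3 N
    field_simp
  · have e : vc M = ((ofBeta d q r v w u).gFactor 1 M)⁻¹ • vc₂ M := by
      rw [gc, smul_smul, inv_mul_cancel₀ (hg2 M), one_smul]
    rw [e, ac, Finset.smul_sum]
    refine Finset.sum_congr rfl fun N _ => ?_
    rw [hva, hkM, hfM, smul_smul, smul_smul]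
    congr 1
    have := hg2 M
    have := hg3 N
    field_simp

end triples

/-! ### Sums and diagonal entries that determine the tridiagonal matrix -/

section uniqueness

open Matrix

variable {d : ℕ} {q r u v w : ℂ} {V : Type*} [AddCommGroup V] [Module ℂ V]

lemma askeyWilson_diag_generic (Q s x : ℂ) (hq : q ≠ 0) (hr : r ≠ 0) (hs : s ≠ 0)
    (hu : u ≠ 0) (hv : v ≠ 0) (hw : w ≠ 0) (hx : x ≠ 0) (hQ : Q = s ^ 2)
    (h1 : q ^ 2 - u ^ 2 * x ^ 2 ≠ 0) (h2 : 1 - u ^ 2 * x ^ 2 ≠ 0)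
    (h3 : 1 - u ^ 2 * x ^ 2 * q ^ 2 ≠ 0) :
    ((2 - q ^ 2 - q⁻¹ ^ 2) * ((u * x + u⁻¹ * x⁻¹) / r) ^ 2 + (q ^ 2 - q⁻¹ ^ 2) ^ 2 / r ^ 2) *
      ((v + v⁻¹) / r - upF q r Q u v w x - lowF q r Q u v w x) =
    -(q - q⁻¹) ^ 2 * ((u * s + u⁻¹ * s⁻¹) / r * ((v * s + v⁻¹ * s⁻¹) / r) -
      1 / r * (s * q + s⁻¹ * q⁻¹) * ((w * s + w⁻¹ * s⁻¹) / r)) * ((u * x + u⁻¹ * x⁻¹) / r) +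
    (q + q⁻¹) / r * (-(q - q⁻¹) ^ 2 * ((u * s + u⁻¹ * s⁻¹) / r * ((w * s + w⁻¹ * s⁻¹) / r) -
      1 / r * (s * q + s⁻¹ * q⁻¹) * ((v * s + v⁻¹ * s⁻¹) / r))) := by
  have h3' : 1 - q ^ 2 * u ^ 2 * x ^ 2 ≠ 0 := by convert h3 using 1; ring
  unfold lowF upF
  subst hQ
  field_simp
  ring

/-- The coefficient of the diagonal entries in the Askey-Wilson relation. -/
def awCoeff (q r u x : ℂ) : ℂ :=
  (2 - q ^ 2 - q⁻¹ ^ 2) * ((u * x + u⁻¹ * x⁻¹) / r) ^ 2 + (q ^ 2 - q⁻¹ ^ 2) ^ 2 / r ^ 2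

/-- The coefficient factors into two of the denominators of `lowF` and `upF`. The Askey-Wilson
relation thus determines every interior diagonal entry, but can say nothing about the first if `u² =
q²`, or the last if `u² q^{4d+2} = 1`. -/
lemma awCoeff_ne (h : Nondeg d q r u v w) (M : ℕ)
    (h1 : q ^ 2 - u ^ 2 * (q ^ (2 * M)) ^ 2 ≠ 0) (h3 : 1 - u ^ 2 * (q ^ (2 * M)) ^ 2 * q ^ 2 ≠ 0) :
    awCoeff q r u (q ^ (2 * M)) ≠ 0 := by
  have hq := h.q_ne
  have hu := h.u_ne
  have hr := h.r_ne
  have hx := h.x_ne M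
  have hk := h.sq_sub_one_ne
  have e : awCoeff q r u (q ^ (2 * M)) = -((q ^ 2 - 1) ^ 2 * (q ^ 2 - u ^ 2 * (q ^ (2 * M)) ^ 2) *
      (1 - u ^ 2 * (q ^ (2 * M)) ^ 2 * q ^ 2)) /
      (q ^ 4 * r ^ 2 * u ^ 2 * (q ^ (2 * M)) ^ 2) := by
    unfold awCoeff
    field_simp
    ring
  rw [e]
  exact div_ne_zero (neg_ne_zero.2 (mul_ne_zero (mul_ne_zero (pow_ne_zero 2 hk) h1) h3))
    (by positivity)

lemma tri_diag_askeyWilson (h : Nondeg d q r u v w) (M : Fin (d + 1))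
    (h1 : q ^ 2 - u ^ 2 * (q ^ (2 * (M : ℕ))) ^ 2 ≠ 0)
    (h3 : 1 - u ^ 2 * (q ^ (2 * (M : ℕ))) ^ 2 * q ^ 2 ≠ 0) :
    awCoeff q r u (q ^ (2 * (M : ℕ))) * (ofBeta d q r u v w).tri M M =
      (ofBeta d q r u v w).omega * theta q (u / r) (u⁻¹ / r) M +
        (q + q⁻¹) / r * (ofBeta d q r u w v).omega := by
  have hM : (M : ℕ) ≤ d := Nat.lt_succ_iff.1 M.isLt
  have e2 : theta (ofBeta d q r u v w).q (ofBeta d q r u v w).bb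
    (ofBeta d q r u v w).cb 0 = (v + v⁻¹) / r := theta_zero_ofBeta
  rw [tri_diag, lower_ofBeta h hM, upper_ofBeta h hM, e2, omega_ofBeta h.q_ne,
    omega_ofBeta h.q_ne, theta_ofBeta]
  exact askeyWilson_diag_generic _ (q ^ d) _ h.q_ne h.r_ne (pow_ne_zero _ h.q_ne) h.u_ne h.v_ne
    h.w_ne (h.x_ne M) (by ring) h1 (h.one_sub_ne hM) h3

lemma tri_sum_one (p : Params d) (M : Fin (d + 1)) :
    ∑ N, p.tri M N = theta p.q p.bb p.cb 0 := by
  have := tri_sum p (fun _ => 1) M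
  simp only [mul_one] at this
  rw [this]
  ring

/-- `θ_N - θ_0` is proportional to the factorial of degree `1`, so this is the bidiagonal action in
its lowest nontrivial degree. -/
lemma tri_sum_theta (h : Nondeg d q r u v w) : ∃ φ : ℂ, ∀ M : Fin (d + 1),
    ∑ N : Fin (d + 1), (ofBeta d q r u v w).tri M N *
      (theta q (u / r) (u⁻¹ / r) N - theta q (u / r) (u⁻¹ / r) 0) =
    theta q (v / r) (v⁻¹ / r) 1 *
      (theta q (u / r) (u⁻¹ / r) M - theta q (u / r) (u⁻¹ / r) 0) + φ := by
  have hu := h.u_ne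
  have hr := h.r_ne
  have hθ : ∀ N : ℕ, theta q (u / r) (u⁻¹ / r) N - theta q (u / r) (u⁻¹ / r) 0 =
      -(u⁻¹ / r) * fac q (u ^ 2) (q ^ (2 * N)) 1 := by
    intro N
    have hx := h.x_ne N
    rw [theta_zero_ofBeta, theta_ofBeta, ← zero_add 1, fac_succ, fac_zero]
    simp only [mul_zero, pow_zero]
    generalize q ^ (2 * N) = x at *
    field_simp
    ring
  refine ⟨-(u⁻¹ / r) * (-(1 / (v * r)) * (q ^ 2)⁻¹ * (1 + u * v / w * q) *
    (1 + u * v * w * q * q ^ (2 * d)) * (1 - 1 / q ^ (2 * d)) * (1 - q ^ 2)), fun M => ?_⟩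
  have hM : (M : ℕ) ≤ d := Nat.lt_succ_iff.1 M.isLt
  have e2 : theta (ofBeta d q r u v w).q (ofBeta d q r u v w).bb
    (ofBeta d q r u v w).cb 0 = (v + v⁻¹) / r := theta_zero_ofBeta
  have := fac_recurrence_succ h hM 0
  simp only [mul_zero, pow_zero, zero_add, one_mul, mul_one, fac_zero] at this
  rw [tri_sum (ofBeta d q r u v w) (fun N => theta q (u / r) (u⁻¹ / r) N -
    theta q (u / r) (u⁻¹ / r) 0), lower_ofBeta h hM, upper_ofBeta h hM, e2, theta_ofBeta (u := v)]
  simp only [hθ, mul_one]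
  linear_combination -(u⁻¹ / r) * this

/-- Taking `c = θ a` removes one of the two remaining terms and isolates the entry at `b`; the roles
are then exchanged. -/
lemma row_eq_zero {θ δ : Fin (d + 1) → ℂ} (hθ : Function.Injective θ)
    (hδ : ∀ c : ℂ, ∑ N, δ N * (θ N - c) = 0) {a b : Fin (d + 1)} (hab : a ≠ b)
    (hs : ∀ N, N ≠ a → N ≠ b → δ N = 0) : δ = 0 := by
  have key : ∀ a b : Fin (d + 1), a ≠ b → (∀ N, N ≠ a → N ≠ b → δ N = 0) → δ b = 0 := by
    intro a b hab hs
    have := hδ (θ a)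
    rw [Finset.sum_eq_single b] at this
    · exact (mul_eq_zero.1 this).resolve_right (sub_ne_zero.2 fun h => hab (hθ h).symm)
    · intro N _ hN
      by_cases hNa : N = a
      · rw [hNa, sub_self, mul_zero]
      · rw [hs N hNa hN, zero_mul]
    · intro hn
      exact absurd (Finset.mem_univ _) hn
  funext N
  by_cases ha : N = a
  · rw [ha]
    exact key b a hab.symm fun N h1 h2 => hs N h2 h1
  · by_cases hb : N = b
    · rw [hb]
      exact key a b hab hs
    · exact hs N ha hb

lemma const_eq_zero {θ δ : Fin (d + 1) → ℂ} {ε : ℂ}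
    (hδ : ∀ c : ℂ, ∑ N, δ N * (θ N - c) = ε) {a : Fin (d + 1)}
    (hs : ∀ N, N ≠ a → δ N = 0) : ε = 0 := by
  rw [← hδ (θ a)]
  refine Finset.sum_eq_zero fun N _ => ?_
  by_cases ha : N = a
  · rw [ha, sub_self, mul_zero]
  · rw [hs N ha, zero_mul]

/-- A tridiagonal matrix is determined by its row sums and the sums weighted with `θ^a`, if the
diagonal entries satisfy the Askey-Wilson relation. -/
lemma tridiagonal_eq_zero (h : Nondeg d q r u v w) (hd : 0 < d)
    {Δ : Matrix (Fin (d + 1)) (Fin (d + 1)) ℂ} {ε : ℂ}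
    (htri : ∀ i j : Fin (d + 1), ((i : ℕ) + 1 < j ∨ (j : ℕ) + 1 < i) → Δ i j = 0)
    (hsum : ∀ M, ∀ c : ℂ, ∑ N : Fin (d + 1), Δ M N * (theta q (u / r) (u⁻¹ / r) N - c) = ε)
    (hdiag : ∀ M : Fin (d + 1), q ^ 2 - u ^ 2 * (q ^ (2 * (M : ℕ))) ^ 2 ≠ 0 →
      1 - u ^ 2 * (q ^ (2 * (M : ℕ))) ^ 2 * q ^ 2 ≠ 0 → Δ M M = 0) : Δ = 0 := by
  have hθ := theta_injective_fin h
  have hd0 : (0 : ℕ) < d + 1 := by omega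
  have hd1 : 1 < d + 1 := by omega
  have hdd : d < d + 1 := by omega
  have hdp : d - 1 < d + 1 := by omega
  -- The two exceptional cases at the end rows exclude each other, since together they would give
  -- `q^{4d+4} = 1`. So at least one end row has zero diagonal entry, hence a single possible entry,
  -- and choosing `c` as its eigenvalue gives `ε = 0`.
  have hε : ε = 0 := by
    by_cases hq2 : q ^ 2 - u ^ 2 = 0
    · have hlast : 1 - u ^ 2 * (q ^ (2 * d)) ^ 2 * q ^ 2 ≠ 0 := by
        rw [← sub_eq_zero.1 hq2, sub_ne_zero]
        convert (h.q_pow (4 * d + 4) (by omega)).symm using 1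
        ring
      have h0 := hdiag ⟨d, hdd⟩ (h.sq_sub_ne le_rfl hd) hlast
      refine const_eq_zero (hsum ⟨d, hdd⟩) (a := ⟨d - 1, hdp⟩) fun N hN => ?_
      by_cases hNd : N = ⟨d, hdd⟩
      · rw [hNd, h0]
      · have h1 : (N : ℕ) ≠ d - 1 := fun h => hN (Fin.ext h)
        have h2 : (N : ℕ) ≠ d := fun h => hNd (Fin.ext h)
        have := N.isLt
        exact htri _ _ (Or.inr (by simp only; omega))
    · have h0 := hdiag ⟨0, hd0⟩ (by simpa using hq2) (h.one_sub_succ_ne hd)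
      refine const_eq_zero (hsum ⟨0, hd0⟩) (a := ⟨1, hd1⟩) fun N hN => ?_
      by_cases hNd : N = ⟨0, hd0⟩
      · rw [hNd, h0]
      · have h1 : (N : ℕ) ≠ 1 := fun h => hN (Fin.ext h)
        have h2 : (N : ℕ) ≠ 0 := fun h => hNd (Fin.ext h)
        exact htri _ _ (Or.inl (by simp only; omega))
  subst hε
  -- Every row now has at most two possible entries: an end row has only two positions, and an
  -- interior row has lost its diagonal.
  have hrow : ∀ M : Fin (d + 1), Δ M = 0 := by
    intro M
    have hM := M.isLt
    rcases Nat.eq_zero_or_pos (M : ℕ) with h0 | h0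
    · refine row_eq_zero hθ (hsum M) (a := ⟨0, hd0⟩) (b := ⟨1, hd1⟩) (by simp) fun N h1 h2 => ?_
      have h1' : (N : ℕ) ≠ 0 := fun h => h1 (Fin.ext h)
      have h2' : (N : ℕ) ≠ 1 := fun h => h2 (Fin.ext h)
      exact htri _ _ (Or.inl (by omega))
    · rcases (Nat.lt_succ_iff.1 hM).eq_or_lt with hMd | hMd
      · refine row_eq_zero hθ (hsum M) (a := ⟨d, hdd⟩) (b := ⟨d - 1, hdp⟩)
          (by simp only [ne_eq, Fin.mk.injEq]; omega) fun N h1 h2 => ?_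
        have h1' : (N : ℕ) ≠ d := fun h => h1 (Fin.ext h)
        have h2' : (N : ℕ) ≠ d - 1 := fun h => h2 (Fin.ext h)
        have := N.isLt
        exact htri _ _ (Or.inr (by omega))
      · have hMM := hdiag M (h.sq_sub_ne hMd.le h0) (h.one_sub_succ_ne hMd)
        refine row_eq_zero hθ (hsum M) (a := ⟨M - 1, by omega⟩) (b := ⟨M + 1, by omega⟩)
          (by simp only [ne_eq, Fin.mk.injEq]; omega) fun N h1 h2 => ?_
        by_cases hNM : N = M
        · rw [hNM, hMM]
        · have h1' : (N : ℕ) ≠ M - 1 := fun h => h1 (Fin.ext h)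
          have h2' : (N : ℕ) ≠ M + 1 := fun h => h2 (Fin.ext h)
          have h3' : (N : ℕ) ≠ M := fun h => hNM (Fin.ext h)
          exact htri _ _ (by omega)
  ext M N
  rw [hrow M]
  rfl

end uniqueness

/-! ### Extracting the starting basis, and cyclicity of the third map -/

section existence

open Matrix

variable {d : ℕ} {q r u v w : ℂ} {V : Type*} [AddCommGroup V] [Module ℂ V]

lemma sum_smul_injective {n : ℕ} (b : Module.Basis (Fin n) ℂ V) {x y : Fin n → ℂ}
    (h : ∑ M, x M • b M = ∑ M, y M • b M) : x = y := by
  have hx := b.repr_sum_self x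
  rw [h, b.repr_sum_self y] at hx
  exact hx.symm

/-- A coordinate functional of the eigenbasis `e` is an eigenfunctional of `X`. If it vanished on `f
0`, the nonzero subdiagonal of `X` in `f` would make it vanish successively on every `f n`. -/
lemma repr_ne_zero {X : Module.End ℂ V} {θ : Fin (d + 1) → ℂ}
    {e f : Module.Basis (Fin (d + 1)) ℂ V} (he : LinearMap.toMatrix e e X = diagonal θ)
    (hf : IsIrredTridiagonal (LinearMap.toMatrix f f X)) (M : Fin (d + 1)) :
    e.repr (f 0) M ≠ 0 := by
  intro h0
  have hξ : ∀ z, e.coord M (X z) = θ M * e.coord M z := by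
    intro z
    have hz : z = ∑ N, e.repr z N • e N := (e.sum_repr z).symm
    conv_lhs => rw [hz, sum_smul_apply he]
    rw [Module.Basis.coord_apply, e.repr_sum_self, mulVec_diagonal, Module.Basis.coord_apply]
  have hall : ∀ n (hn : n < d + 1), e.coord M (f ⟨n, hn⟩) = 0 := by
    intro n
    induction n using Nat.strong_induction_on with
    | _ n ih =>
      intro hn
      rcases Nat.eq_zero_or_pos n with rfl | hpos
      · exact h0
      · have hm : n - 1 < d + 1 := by omega
        have h1 := (toMatrix_eq_iff f X _).1 rfl ⟨n - 1, hm⟩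
        have h2 := hξ (f ⟨n - 1, hm⟩)
        rw [ih (n - 1) (by omega) hm, mul_zero, h1, map_sum, Finset.sum_eq_single ⟨n, hn⟩] at h2
        · rw [map_smul, smul_eq_mul] at h2
          refine (mul_eq_zero.1 h2).resolve_left (hf.2 _ _ (Or.inr ?_))
          simp only
          omega
        · intro L _ hL
          have hL' : (L : ℕ) ≠ n := fun h => hL (Fin.ext h)
          rw [map_smul, smul_eq_mul]
          by_cases hLn : (L : ℕ) < n
          · rw [ih L hLn L.isLt, mul_zero]
          · rw [hf.1 L ⟨n - 1, hm⟩ (Or.inr (by simp only; omega)), zero_mul]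
        · intro hne
          exact absurd (Finset.mem_univ _) hne
  have hz : e.coord M = 0 := f.ext fun N => by rw [hall N N.isLt]; rfl
  have := congrArg (fun g => g (e M)) hz
  simp at this

/-- Rescale the eigenbasis of `X` so that the first eigenvector `f 0` of `Y` becomes the sum of the
basis vectors. The matrix of `Y` then shares with the explicit one its row sums, its weighted row
sums up to a constant, and the diagonal Askey-Wilson equation, which together force equality. -/
lemma exists_std (h : Nondeg d q r u v w) {X Y : Module.End ℂ V}
    (hpair : IsLeonardPair d X Y (theta q (u / r) (u⁻¹ / r)) (theta q (v / r) (v⁻¹ / r)))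
    (haw : qComm q⁻¹ X (qComm q X Y) = (-(q ^ 2 - q ^ (-2 : ℤ)) ^ 2 / r ^ 2) • Y +
      (ofBeta d q r u v w).omega • X +
      ((q + q⁻¹) / r * (ofBeta d q r u w v).omega) • (1 : Module.End ℂ V)) :
    ∃ va, IsStd (ofBeta d q r u v w) X Y va := by
  obtain ⟨⟨e, heX, heY⟩, f, hfY, hfX⟩ := hpair
  have hx := repr_ne_zero heX hfX
  set x : Fin (d + 1) → ℂ := fun M => e.repr (f 0) M
  obtain ⟨va, hva, hmat⟩ := exists_basis_of_diagonal e hx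
  set B := LinearMap.toMatrix e e Y
  set T : Matrix (Fin (d + 1)) (Fin (d + 1)) ℂ := fun M N => (x M)⁻¹ * B M N * x N with hT
  have hX : LinearMap.toMatrix va va X = thetaMat d q (u / r) (u⁻¹ / r) := by
    refine hmat _ _ ?_
    rw [heX, thetaMat, diagonal_mul_diagonal, diagonal_mul_diagonal]
    congr 1
    ext i
    rw [mul_comm]
  have hY : LinearMap.toMatrix va va Y = T := by
    refine hmat _ _ ?_
    ext M N
    have := hx M
    rw [mul_diagonal, diagonal_mul, hT]
    change B M N * x N = x M * ((x M)⁻¹ * B M N * x N)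
    rw [mul_assoc (x M)⁻¹, mul_inv_cancel_left₀ this]
  have hTtri : ∀ i j : Fin (d + 1), ((i : ℕ) + 1 < j ∨ (j : ℕ) + 1 < i) → T i j = 0 := by
    intro i j hij
    change (x i)⁻¹ * B i j * x j = 0
    rw [heY.1 i j hij]
    ring
  have hf0 : f 0 = ∑ M, (1 : ℂ) • va M := by
    rw [← e.sum_repr (f 0)]
    exact Finset.sum_congr rfl fun M _ => by rw [hva, one_smul]
  have hYf := (toMatrix_eq_iff f Y _).1 hfY
  have hYf' : ∀ N, Y (f N) = theta q (v / r) (v⁻¹ / r) N • f N := by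
    intro N
    rw [hYf N, Finset.sum_eq_single N]
    · rw [diagonal_apply_eq]
    · intro M _ hM
      rw [diagonal_apply_ne _ hM, zero_smul]
    · intro hn
      exact absurd (Finset.mem_univ _) hn
  have hsum1 : ∀ M, ∑ N, T M N = theta q (v / r) (v⁻¹ / r) 0 := by
    have h1 : Y (f 0) = theta q (v / r) (v⁻¹ / r) 0 • f 0 := hYf' 0
    rw [hf0, sum_smul_apply hY, Finset.smul_sum] at h1
    simp only [smul_smul] at h1
    have h2 := sum_smul_injective va h1
    intro M
    have h3 := congrFun h2 M
    simpa [mulVec, dotProduct] using h3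
  have htri1 : ∀ M, ∑ N, (ofBeta d q r u v w).tri M N = theta q (v / r) (v⁻¹ / r) 0 :=
    tri_sum_one (ofBeta d q r u v w)
  refine ⟨va, hX, hY.trans ?_⟩
  -- For `d = 0` the only entry is its own row sum; the general argument needs a second column.
  rcases Nat.eq_zero_or_pos d with rfl | hd
  · ext M N
    obtain rfl : M = 0 := Fin.ext (by omega)
    obtain rfl : N = 0 := Fin.ext (by omega)
    have e : ∀ g : Fin (0 + 1) → ℂ, ∑ N, g N = g 0 := fun g => Fin.sum_univ_one g
    exact ((e _).symm.trans (hsum1 0)).trans ((e _).symm.trans (htri1 0)).symm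
  have hsum2 : ∃ φ : ℂ, ∀ M : Fin (d + 1), ∑ N : Fin (d + 1), T M N *
      (theta q (u / r) (u⁻¹ / r) N - theta q (u / r) (u⁻¹ / r) 0) =
      theta q (v / r) (v⁻¹ / r) 1 *
        (theta q (u / r) (u⁻¹ / r) M - theta q (u / r) (u⁻¹ / r) 0) + φ := by
    set S := LinearMap.toMatrix f f X
    set θ := theta q (u / r) (u⁻¹ / r)
    set θ' := theta q (v / r) (v⁻¹ / r)
    have hXf : X (f 0) = ∑ L, S L 0 • f L := (toMatrix_eq_iff f X S).1 rfl 0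
    -- `X (f 0)` lies in the span of `f 0` and `f 1`, so `Y - θ'_1` sends it to a multiple of `f 0`.
    -- In the rescaled basis this becomes the weighted row-sum identity, with a constant involving
    -- the unknown `S 0 0`; that constant is therefore left unspecified.
    have h1 : Y (X (f 0)) - θ' 1 • X (f 0) = (S 0 0 * (θ' 0 - θ' 1)) • f 0 := by
      rw [hXf, map_sum, Finset.smul_sum, ← Finset.sum_sub_distrib, Finset.sum_eq_single 0]
      · rw [map_smul, hYf', smul_smul, smul_smul, ← sub_smul]
        congr 1
        simp only [Fin.val_zero]
        ring
      · intro L _ hL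
        rw [map_smul, hYf', smul_smul, smul_smul, ← sub_smul]
        have hL0 : (L : ℕ) ≠ 0 := fun h => hL (Fin.ext h)
        by_cases hL1 : (L : ℕ) = 1
        · rw [hL1, mul_comm, sub_self, zero_smul]
        · rw [hfX.1 L 0 (Or.inr (by simp only [Fin.val_zero]; omega))]
          simp
      · intro hn
        exact absurd (Finset.mem_univ _) hn
    have hXva : X (f 0) = ∑ M : Fin (d + 1), θ M • va M := by
      rw [hf0, sum_smul_apply hX]
      refine Finset.sum_congr rfl fun M _ => ?_
      rw [thetaMat, mulVec_diagonal, mul_one]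
    have h0 : Y (f 0) = θ' 0 • f 0 := hYf' 0
    have hu1 : X (f 0) - θ 0 • f 0 = ∑ M : Fin (d + 1), (θ M - θ 0) • va M := by
      rw [hXva, hf0, Finset.smul_sum, ← Finset.sum_sub_distrib]
      exact Finset.sum_congr rfl fun M _ => by rw [one_smul, sub_smul]
    have hYu : Y (X (f 0) - θ 0 • f 0) = ∑ M : Fin (d + 1),
        (θ' 1 * (θ M - θ 0) + (S 0 0 - θ 0) * (θ' 0 - θ' 1)) • va M := by
      have e1 : Y (X (f 0) - θ 0 • f 0) = θ' 1 • (X (f 0) - θ 0 • f 0) +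
          ((S 0 0 - θ 0) * (θ' 0 - θ' 1)) • f 0 := by
        rw [map_sub, map_smul, h0, sub_eq_iff_eq_add.1 h1]
        module
      rw [e1, hu1, hf0, Finset.smul_sum, Finset.smul_sum, ← Finset.sum_add_distrib]
      refine Finset.sum_congr rfl fun M _ => ?_
      module
    rw [hu1, sum_smul_apply hY] at hYu
    have h2 := sum_smul_injective va hYu
    exact ⟨_, fun M => congrFun h2 M⟩
  have hdiag : ∀ M : Fin (d + 1), awCoeff q r u (q ^ (2 * (M : ℕ))) * T M M =
      (ofBeta d q r u v w).omega * theta q (u / r) (u⁻¹ / r) M +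
        (q + q⁻¹) / r * (ofBeta d q r u w v).omega := by
    intro M
    have h1 := congrArg (fun A => LinearMap.toMatrix va va A M M) haw
    simp only [qComm, map_add, map_sub, map_smul, LinearMap.toMatrix_mul, LinearMap.toMatrix_one,
      hX, hY, thetaMat, Matrix.add_apply, Matrix.sub_apply, Matrix.smul_apply, diagonal_mul,
      mul_diagonal, diagonal_apply_eq, one_apply_eq, smul_eq_mul, mul_one, inv_inv] at h1
    have hq := h.q_ne
    have hr := h.r_ne
    rw [zpow_neg_two'] at h1
    have h2 : awCoeff q r u (q ^ (2 * (M : ℕ))) * T M M =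
        (2 - q ^ 2 - q⁻¹ ^ 2) * theta q (u / r) (u⁻¹ / r) M ^ 2 * T M M +
        (q ^ 2 - (q ^ 2)⁻¹) ^ 2 / r ^ 2 * T M M := by
      rw [awCoeff, theta_ofBeta, inv_pow]
      ring
    rw [h2]
    have h3 : (2 - q ^ 2 - q⁻¹ ^ 2) = (q⁻¹ - q) * (q - q⁻¹) := by
      field_simp
      ring
    rw [h3]
    linear_combination h1
  obtain ⟨φ, hφ⟩ := hsum2
  obtain ⟨ψ, hψ⟩ := tri_sum_theta h
  have hΔ := tridiagonal_eq_zero h hd (Δ := T - (ofBeta d q r u v w).tri) (ε := φ - ψ)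
    (fun i j hij => by rw [Matrix.sub_apply, hTtri i j hij, (tri_irred h).1 i j hij, sub_zero])
    (fun M c => by
      have e1 := hφ M
      have e2 := hψ M
      have e3 := hsum1 M
      have e4 := htri1 M
      have e5 : ∑ N : Fin (d + 1), (T - (ofBeta d q r u v w).tri) M N *
          (theta q (u / r) (u⁻¹ / r) N - c) =
          ∑ N : Fin (d + 1), T M N *
            (theta q (u / r) (u⁻¹ / r) N - theta q (u / r) (u⁻¹ / r) 0) -
          ∑ N : Fin (d + 1), (ofBeta d q r u v w).tri M N *
            (theta q (u / r) (u⁻¹ / r) N - theta q (u / r) (u⁻¹ / r) 0) +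
          (theta q (u / r) (u⁻¹ / r) 0 - c) *
            (∑ N, T M N - ∑ N, (ofBeta d q r u v w).tri M N) := by
        rw [← Finset.sum_sub_distrib, ← Finset.sum_sub_distrib, Finset.mul_sum,
          ← Finset.sum_add_distrib]
        refine Finset.sum_congr rfl fun N _ => ?_
        rw [Matrix.sub_apply]
        ring
      rw [e5, e1, e2, e3, e4]
      ring)
    (fun M h1 h3 => by
      have e1 := hdiag M
      have e2 := tri_diag_askeyWilson h M h1 h3
      rw [Matrix.sub_apply, sub_eq_zero]
      exact mul_left_cancel₀ (awCoeff_ne h M h1 h3) (e1.trans e2.symm))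
  exact sub_eq_zero.1 hΔ

lemma omega_symm : (ofBeta d q r u v w).omega = (ofBeta d q r v u w).omega := by
  simp only [Params.omega, ofBeta]
  ring

/-- Since `[Z, Y]_q = -[Y, Z]_{q⁻¹}`, substituting the definition of `Z` produces the double
commutator of the Askey-Wilson relation. Its `X` term comes out with coefficient `1`, and the `Y`
terms cancel because of the identity component in `Z`. -/
lemma isThird_rot (h : Nondeg d q r u v w) {X Y Z : Module.End ℂ V}
    (hZ : IsThird (ofBeta d q r u v w) X Y Z)
    (haw : qComm q⁻¹ Y (qComm q Y X) = (-(q ^ 2 - q ^ (-2 : ℤ)) ^ 2 / r ^ 2) • X +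
      (ofBeta d q r u v w).omega • Y +
      ((q + q⁻¹) / r * (ofBeta d q r v w u).omega) • (1 : Module.End ℂ V)) :
    IsThird (ofBeta d q r v w u) Y Z X := by
  have hq := h.q_ne
  have hr := h.r_ne
  have hk := h.sq_add_one_ne
  have hk' := h.sq_sub_one_ne
  have e1 : q ^ 2 - q ^ (-2 : ℤ) = (q ^ 2 + 1) * (q ^ 2 - 1) / q ^ 2 := by
    rw [zpow_neg_two']
    field_simp
    ring
  have e2 : q - q⁻¹ = (q ^ 2 - 1) / q := by field_simp
  unfold IsThird at hZ ⊢
  generalize (ofBeta d q r u v w).omega = ω at *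
  generalize (ofBeta d q r v w u).omega = ω' at *
  simp only [ofBeta] at hZ ⊢
  rw [e1] at hZ haw
  rw [e1]
  rw [e2] at hZ ⊢
  rw [hZ]
  simp only [qComm, mul_add, add_mul, mul_sub, sub_mul, smul_mul_assoc, mul_smul_comm, mul_assoc,
    one_mul, mul_one, smul_add, smul_sub, smul_smul, inv_inv] at haw ⊢
  generalize Y * (Y * X) = A1 at *
  generalize Y * (X * Y) = A2 at *
  generalize X * (Y * Y) = A3 at *
  linear_combination (norm := (match_scalars <;> field_simp <;> ring))
    (r / ((q ^ 2 + 1) * (q ^ 2 - 1) / q ^ 2)) ^ 2 • haw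

/-- The same substitution in `[X, Z]_q`, now with the other Askey-Wilson relation; it applies
because the nested commutators with `q` and `q⁻¹` may be taken in either order. -/
lemma isThird_rot_rot (h : Nondeg d q r u v w) {X Y Z : Module.End ℂ V}
    (hZ : IsThird (ofBeta d q r u v w) X Y Z)
    (haw : qComm q⁻¹ X (qComm q X Y) = (-(q ^ 2 - q ^ (-2 : ℤ)) ^ 2 / r ^ 2) • Y +
      (ofBeta d q r u v w).omega • X +
      ((q + q⁻¹) / r * (ofBeta d q r u w v).omega) • (1 : Module.End ℂ V)) :
    IsThird (ofBeta d q r w u v) Z X Y := by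
  have hq := h.q_ne
  have hr := h.r_ne
  have hk := h.sq_add_one_ne
  have hk' := h.sq_sub_one_ne
  have e1 : q ^ 2 - q ^ (-2 : ℤ) = (q ^ 2 + 1) * (q ^ 2 - 1) / q ^ 2 := by
    rw [zpow_neg_two']
    field_simp
    ring
  have e2 : q - q⁻¹ = (q ^ 2 - 1) / q := by field_simp
  rw [omega_symm (u := u) (v := w)] at haw
  unfold IsThird at hZ ⊢
  generalize (ofBeta d q r u v w).omega = ω at *
  generalize (ofBeta d q r w u v).omega = ω' at *
  simp only [ofBeta] at hZ ⊢
  rw [e1] at hZ haw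
  rw [e1]
  rw [e2] at hZ ⊢
  rw [hZ]
  simp only [qComm, mul_add, add_mul, mul_sub, sub_mul, smul_mul_assoc, mul_smul_comm, mul_assoc,
    one_mul, mul_one, smul_add, smul_sub, smul_smul, inv_inv] at haw ⊢
  generalize X * (X * Y) = A1 at *
  generalize X * (Y * X) = A2 at *
  generalize Y * (X * X) = A3 at *
  linear_combination (norm := (match_scalars <;> field_simp <;> ring))
    (r / ((q ^ 2 + 1) * (q ^ 2 - 1) / q ^ 2)) ^ 2 • haw

end existence

/-! ### From the original hypotheses to normalized parameters -/

section conclusion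

variable {V : Type*} [AddCommGroup V] [Module ℂ V] {d : ℕ} {q r₀ : ℂ} {b c : Fin 3 → ℂ}
  {A : Fin 3 → Module.End ℂ V}

lemma IsQRacahTriple.c_eq (hA : IsQRacahTriple d q r₀ b c A) (x : Fin 3) :
    c x = (r₀ * b x)⁻¹ / r₀ := by
  have hr := hA.r_ne_zero
  have hb := hA.b_ne_zero x
  have h := hA.b_mul_c x
  rw [zpow_neg_two'] at h
  apply mul_left_cancel₀ hb
  rw [h]
  field_simp

lemma IsQRacahTriple.b_eq (hA : IsQRacahTriple d q r₀ b c A) (x : Fin 3) :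
    b x = r₀ * b x / r₀ := by
  have hr := hA.r_ne_zero
  field_simp

lemma IsQRacahTriple.params_eq (hA : IsQRacahTriple d q r₀ b c A) (i j k : Fin 3) :
    params d q r₀ b c i j k = ofBeta d q r₀ (r₀ * b i) (r₀ * b j) (r₀ * b k) := by
  simp only [params, ofBeta, Params.mk.injEq, true_and]
  exact ⟨hA.b_eq i, hA.c_eq i, hA.b_eq j, hA.c_eq j, hA.b_eq k, hA.c_eq k⟩

/-- The four conditions (ii), in the order 3, 4, 2, 1, become the families `uvw`, `uv`, `vw`, `wu`.
Their union is invariant under cyclic shifts, so assumptions made for one ordering of the labels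
serve all three. -/
lemma IsQRacahTriple.nondeg (hA : IsQRacahTriple d q r₀ b c A) :
    Nondeg d q r₀ (r₀ * b 0) (r₀ * b 1) (r₀ * b 2) := by
  have hr := hA.r_ne_zero
  have hq := hA.q_ne_zero
  have hb := hA.b_ne_zero
  have b0 := hb 0
  have b1 := hb 1
  have b2 := hb 2
  have hsq : ∀ x, ∀ M ≤ 2 * d, (r₀ * b x) ^ 2 * q ^ (2 * M) ≠ 1 := by
    intro x M hM he
    have hx := hb x
    have hy : q ^ (2 * M) ≠ 0 := pow_ne_zero _ hq
    refine hA.cond_i x M hM ?_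
    have e : b x / ((r₀ * b x)⁻¹ / r₀) = (r₀ * b x) ^ 2 := by field_simp
    rw [hA.c_eq x, zpow_neg_two_mul, e]
    exact eq_inv_of_mul_eq_one_left he
  refine ⟨hq, hA.q_not_root, hr, mul_ne_zero hr b0, mul_ne_zero hr b1, mul_ne_zero hr b2,
    hsq 0, hsq 1, hsq 2, fun k hk he => ?_, fun k hk he => ?_, fun k hk he => ?_,
    fun k hk he => ?_⟩
  · refine hA.cond_ii₃ (k + 1) (by omega) (by omega) ?_
    have e : q ^ (2 * ((k + 1 : ℕ) : ℤ) + 2 * (d : ℤ) - 1) = q ^ (2 * d) * q ^ (2 * k + 1) := by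
      rw [← pow_add, ← zpow_natCast]
      congr 1
      push_cast
      ring
    rw [hA.c_eq 0, e]
    rw [mul_assoc _ (q ^ (2 * d))] at he
    generalize q ^ (2 * d) * q ^ (2 * k + 1) = y at *
    field_simp
    linear_combination he
  · refine hA.cond_ii₄ (k + 1) (by omega) (by omega) ?_
    have e : q ^ (2 * ((k + 1 : ℕ) : ℤ) - 1) = q ^ (2 * k + 1) := by
      rw [← zpow_natCast]
      congr 1
      push_cast
      ring
    rw [hA.c_eq 1, hA.c_eq 2, e]
    generalize q ^ (2 * k + 1) = y at *
    field_simp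
    apply mul_left_cancel₀ hr
    linear_combination he
  -- The exponent `-2M + 1 + 2d` decreases with `M`, so the index is reversed.
  · refine hA.cond_ii₂ (d - k) (by omega) (by omega) ?_
    have e : q ^ (-2 * ((d - k : ℕ) : ℤ) + 1 + 2 * (d : ℤ)) = q ^ (2 * k + 1) := by
      rw [← zpow_natCast]
      congr 1
      push_cast [Nat.cast_sub hk.le]
      ring
    rw [e]
    generalize q ^ (2 * k + 1) = y at *
    apply mul_left_cancel₀ hr
    linear_combination he
  · refine hA.cond_ii₁ (k + 1) (by omega) (by omega) ?_
    have e : q ^ (-2 * ((k + 1 : ℕ) : ℤ) + 1) = (q ^ (2 * k + 1))⁻¹ := by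
      rw [← zpow_natCast, ← zpow_neg]
      congr 1
    have hy : q ^ (2 * k + 1) ≠ 0 := pow_ne_zero _ hq
    rw [hA.c_eq 0, hA.c_eq 1, hA.c_eq 2, e]
    generalize q ^ (2 * k + 1) = y at *
    field_simp
    apply mul_left_cancel₀ hr
    linear_combination he

/-- The conclusions for one of the three orderings of the labels. -/
lemma conclusion_of_isStd (hA : IsQRacahTriple d q r₀ b c A) {i j k : Fin 3}
    (h : Nondeg d q r₀ (r₀ * b i) (r₀ * b j) (r₀ * b k))
    (hk : IsThird (ofBeta d q r₀ (r₀ * b i) (r₀ * b j) (r₀ * b k)) (A i) (A j) (A k))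
    (hi : IsThird (ofBeta d q r₀ (r₀ * b j) (r₀ * b k) (r₀ * b i)) (A j) (A k) (A i))
    (hj : IsThird (ofBeta d q r₀ (r₀ * b k) (r₀ * b i) (r₀ * b j)) (A k) (A i) (A j))
    {v : Module.Basis (Fin (d + 1)) ℂ V}
    (hv : IsStd (ofBeta d q r₀ (r₀ * b i) (r₀ * b j) (r₀ * b k)) (A i) (A j) v) :
    (params d q r₀ b c i j k).trans * (params d q r₀ b c i j k).transInv = 1 ∧
    (params d q r₀ b c i j k).transInv * (params d q r₀ b c i j k).trans = 1 ∧
    (∃ va vb vc : Module.Basis (Fin (d + 1)) ℂ V, AreEigenbases d q r₀ b c A i j k va vb vc) ∧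
    ∀ va vb₀ vc : Module.Basis (Fin (d + 1)) ℂ V, AreEigenbases d q r₀ b c A i j k va vb₀ vc →
      ∃ (κ : ℂ) (g₀ : ℂ), κ ≠ 0 ∧ g₀ ≠ 0 ∧ ∀ f₀ : ℂ, f₀ ≠ 0 → ∃ h₀ : ℂ, h₀ ≠ 0 ∧
        ∀ vb : Fin (d + 1) → V, (∀ M : Fin (d + 1), vb M = κ • vb₀ M) →
        ∀ f g h : ℕ → ℂ, f = (params d q r₀ b c i j k).fFactor f₀ →
          g = (params d q r₀ b c i j k).gFactor g₀ →
          h = (params d q r₀ b c i j k).hFactor h₀ →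
          (∀ N : Fin (d + 1), vb N = ∑ M : Fin (d + 1),
            (params d q r₀ b c i j k).trans M N • va M) ∧
          (∀ M : Fin (d + 1), va M = ∑ N : Fin (d + 1),
            (params d q r₀ b c i j k).transInv N M • vb N) ∧
          (∀ N : Fin (d + 1), vc N = ∑ M : Fin (d + 1),
            (g M * (params d q r₀ b c j k i).trans M N) • vb M) ∧
          (∀ M : Fin (d + 1), vb M = ∑ N : Fin (d + 1),
            ((g M)⁻¹ * (params d q r₀ b c j k i).transInv N M) • vc N) ∧
          (∀ N : Fin (d + 1), va N = ∑ M : Fin (d + 1),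
            ((f N)⁻¹ * h M * (params d q r₀ b c k i j).trans M N) • vc M) ∧
          (∀ M : Fin (d + 1), vc M = ∑ N : Fin (d + 1),
            (f N * (h M)⁻¹ * (params d q r₀ b c k i j).transInv N M) • va N) := by
  have hp1 := hA.params_eq i j k
  have hp2 := hA.params_eq j k i
  have hp3 := hA.params_eq k i j
  have hθ : ∀ x, thetaMat d q (r₀ * b x / r₀) ((r₀ * b x)⁻¹ / r₀) =
      Matrix.diagonal fun M : Fin (d + 1) => theta q (b x) (c x) M := fun x => by
    rw [← hA.b_eq x, ← hA.c_eq x]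
    rfl
  refine ⟨?_, ?_, ?_, ?_⟩
  · rw [hp1]
    exact trans_mul_transInv h
  · rw [hp1]
    exact transInv_mul_trans h
  · obtain ⟨vb, -, vc, hb, -, hc⟩ := hv.exists_eigenbases h hk
    refine ⟨v, vb, vc, hv.1.trans (hθ i), hb.1.trans (hθ j), hc.1.trans (hθ k), ?_, ?_, ?_⟩
    · rw [hp1]
      exact hv.2
    · rw [hp1]
      exact hb.2
    · rw [hp2]
      exact hc.2
  · intro va vb₀ vc he
    have ha : IsStd (ofBeta d q r₀ (r₀ * b i) (r₀ * b j) (r₀ * b k)) (A i) (A j) va :=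
      ⟨he.diag_a.trans (hθ i).symm, hp1 ▸ he.tri_a⟩
    have hb : IsDual (ofBeta d q r₀ (r₀ * b i) (r₀ * b j) (r₀ * b k)) (A i) (A j) vb₀ :=
      ⟨he.diag_b.trans (hθ j).symm, hp1 ▸ he.tri_b⟩
    have hc : IsDual (ofBeta d q r₀ (r₀ * b j) (r₀ * b k) (r₀ * b i)) (A j) (A k) vc :=
      ⟨he.diag_c.trans (hθ k).symm, hp2 ▸ he.tri_c⟩
    rw [hp1, hp2, hp3]
    exact transition_relations h hk hi hj ha hb hc

end conclusion

end QRacah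

end

/-! ### Assembly of the theorem -/

open QRacah in
theorem mainTheorem8 {V : Type*} [AddCommGroup V] [Module ℂ V]
    (d : ℕ) (q r₀ : ℂ) (b c : Fin 3 → ℂ) (A : Fin 3 → Module.End ℂ V)
    (hA : IsQRacahTriple d q r₀ b c A) :
    IsLeonardTriple d A ∧
    ∀ i j k : Fin 3, (i, j, k) ∈ ({(0, 1, 2), (1, 2, 0), (2, 0, 1)} : Set (Fin 3 × Fin 3 × Fin 3)) →
      -- the second matrix is the inverse of the first
      (params d q r₀ b c i j k).trans * (params d q r₀ b c i j k).transInv = 1 ∧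
      (params d q r₀ b c i j k).transInv * (params d q r₀ b c i j k).trans = 1 ∧
      -- the eigenbases exist
      (∃ va vb vc : Module.Basis (Fin (d + 1)) ℂ V, AreEigenbases d q r₀ b c A i j k va vb vc) ∧
      -- and, once the scale of the second one is adjusted, they are related as follows
      ∀ va vb₀ vc : Module.Basis (Fin (d + 1)) ℂ V, AreEigenbases d q r₀ b c A i j k va vb₀ vc →
        ∃ (κ : ℂ) (g₀ : ℂ), κ ≠ 0 ∧ g₀ ≠ 0 ∧ ∀ f₀ : ℂ, f₀ ≠ 0 → ∃ h₀ : ℂ, h₀ ≠ 0 ∧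
          ∀ vb : Fin (d + 1) → V, (∀ M : Fin (d + 1), vb M = κ • vb₀ M) →
          ∀ f g h : ℕ → ℂ, f = (params d q r₀ b c i j k).fFactor f₀ →
            g = (params d q r₀ b c i j k).gFactor g₀ →
            h = (params d q r₀ b c i j k).hFactor h₀ →
            (∀ N : Fin (d + 1), vb N = ∑ M : Fin (d + 1), (params d q r₀ b c i j k).trans M N • va M) ∧
            (∀ M : Fin (d + 1), va M = ∑ N : Fin (d + 1), (params d q r₀ b c i j k).transInv N M • vb N) ∧
            (∀ N : Fin (d + 1), vc N = ∑ M : Fin (d + 1), (g M * (params d q r₀ b c j k i).trans M N) • vb M) ∧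
            (∀ M : Fin (d + 1), vb M = ∑ N : Fin (d + 1), ((g M)⁻¹ * (params d q r₀ b c j k i).transInv N M) • vc N) ∧
            (∀ N : Fin (d + 1), va N = ∑ M : Fin (d + 1), ((f N)⁻¹ * h M * (params d q r₀ b c k i j).trans M N) • vc M) ∧
            (∀ M : Fin (d + 1), vc M = ∑ N : Fin (d + 1), (f N * (h M)⁻¹ * (params d q r₀ b c k i j).transInv N M) • va N) := by
  have h := hA.nondeg
  have h2 : IsThird (ofBeta d q r₀ (r₀ * b 0) (r₀ * b 1) (r₀ * b 2)) (A 0) (A 1) (A 2) := by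
    rw [← hA.params_eq]
    exact hA.third
  have haw₁ := hA.aw₁
  have haw₂ := hA.aw₂
  rw [hA.params_eq, hA.params_eq] at haw₁ haw₂
  have h0 := isThird_rot h h2 haw₂
  have h1 := isThird_rot_rot h h2 haw₁
  have hpair := hA.pair
  rw [hA.b_eq 0, hA.c_eq 0, hA.b_eq 1, hA.c_eq 1] at hpair
  obtain ⟨v₀, hv₀⟩ := exists_std h hpair haw₁
  -- Each turn yields a dual basis `w` and a standard basis `v` for the next ordering. The bases
  -- `w₀`, `w₁`, `w₂` witness the Leonard triple, while `v₀`, `v₁`, `v₂` start the argument for the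
  -- three orderings.
  obtain ⟨w₁, v₁, -, hw₁, hv₁, -⟩ := hv₀.exists_eigenbases h h2
  obtain ⟨w₂, v₂, -, hw₂, hv₂, -⟩ := hv₁.exists_eigenbases h.rot h0
  obtain ⟨w₀, -, -, hw₀, -, -⟩ := hv₂.exists_eigenbases h.rot.rot h1
  refine ⟨?_, ?_⟩
  · have t0 := hw₀.irred h.rot.rot h1
    have t1 := hw₁.irred h h2
    have t2 := hw₂.irred h.rot h0
    intro i
    fin_cases i
    · refine ⟨w₀, t0.1, fun j hj => ?_⟩
      fin_cases j
      · exact absurd rfl hj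
      · exact t0.2.2
      · exact t0.2.1
    · refine ⟨w₁, t1.1, fun j hj => ?_⟩
      fin_cases j
      · exact t1.2.1
      · exact absurd rfl hj
      · exact t1.2.2
    · refine ⟨w₂, t2.1, fun j hj => ?_⟩
      fin_cases j
      · exact t2.2.2
      · exact t2.2.1
      · exact absurd rfl hj
  · intro i j k hijk
    simp only [Set.mem_insert_iff, Set.mem_singleton_iff, Prod.mk.injEq] at hijk
    rcases hijk with ⟨rfl, rfl, rfl⟩ | ⟨rfl, rfl, rfl⟩ | ⟨rfl, rfl, rfl⟩
    · exact conclusion_of_isStd hA h h2 h0 h1 hv₀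
    · exact conclusion_of_isStd hA h.rot h0 h1 h2 hv₁
    · exact conclusion_of_isStd hA h.rot.rot h1 h2 h0 hv₂
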